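/- Let $a_1>a_2>0$, $a_3>0$. In the Minkowski space $\mathbf{E}^{2,1}$, i.e. $\mathbf{R}^3$ with $\langle X,Y\rangle=X_1Y_1+X_2Y_2-X_3Y_3$, consider the ellipsoid $\mathcal{E}:\ x_1^2/a_1+x_2^2/a_2+x_3^2/a_3=1$ and its confocal quadrics $$\mathcal{Q}_\lambda:\ \frac{x_1^2}{a_1-\lambda}+\frac{x_2^2}{a_2-\lambda}+\frac{x_3^2}{a_3+\lambda}=1 .$$ A line is said to touch $\mathcal{Q}_\infty$ if it is light-like; for finite $\lambda\notin\{a_1,a_2,-a_3\}$, touching $\mathcal{Q}_\lambda$ means that the equation (of formal degree two) for the intersections of the line with $\mathcal{Q}_\lambda$ has zero discriminant. At $x\in\mathcal{E}$ put $N=(x_1/a_1,\,x_2/a_2,\,-x_3/a_3)$ (the normal) and $\dot N=(x_1/a_1^2,\,x_2/a_2^2,\,x_3/a_3^2)$ (the derivative of $N$ in the direction $N$). The tropic curves are the points of $\mathcal{E}$ where the metric induced on the tangent plane is degenerate; the (open) polar caps and the (open) equatorial belt are the sets of points where it is Riemannian, respectively Lorentzian. A billiard trajectory within $\mathcal{E}$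 is a sequence of impact points $(M_k)_{k\in\mathbf{Z}}$ on $\mathcal{E}$ with $M_k\neq M_{k+1}$, such that for all $k$ the vector $M_{k+2}-M_{k+1}$ is a positive multiple of the reflection at $M_{k+1}$ of $v=M_{k+1}-M_k$. At a point off the tropic curves the reflection of $v=a+b$, with $a$ tangent to $\mathcal{E}$ and $b$ orthogonal to the tangent plane, is $v'=a-b$. At a point of the tropic curves, the reflection, extended by continuity, of $v=a+b$, with $b$ in the plane spanned by $N$ and $\dot N$, and $a$ orthogonal to that plane, is $v'=a-b$; such an impact is counted as two reflections, one off a polar cap and one off the equatorial belt. A trajectory is $n$-periodic with $m_1$ reflections off the polar caps and $n_1$ off the equatorial belt if, for some $N_0\ge1$, $M_{k+N_0}=M_k$ for all $k\in\mathbf{Z}$, and, with this counting, $m_1$ and $n_1$ are the numbers of reflections off the polar caps and off the equatorial belt at $M_0,\dots,M_{N_0-1}$, and $n=m_1+n_1$. Let $\gamma_1,\gamma_2\in(\mathbf{R}\cup\{\infty\})\setminus\{a_1,a_2,-a_3\}$. A trajectory has the pair of caustics $\mathcal{Q}_{\gamma_1},\mathcal{Q}_{\gamma_2}$ if the line of each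 of its segments touches both of them when $\gamma_1\ne\gamma_2$, and lies on $\mathcal{Q}_{\gamma_1}$, $\gamma_1$ being finite, when $\gamma_1=\gamma_2$ (double caustic). **Theorem.** If some billiard trajectory within $\mathcal{E}$ with the pair of caustics $\mathcal{Q}_{\gamma_1},\mathcal{Q}_{\gamma_2}$ is $n$-periodic, with $m_1$ reflections off the polar caps and $n_1$ reflections off the equatorial belt, then every billiard trajectory within $\mathcal{E}$ with the same pair of caustics is $n$-periodic, with $m_1$ reflections off the polar caps and $n_1$ reflections off the equatorial belt. -/

import Mathlib

noncomputable section

namespace MinkowskiBilliard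

/-- The vector space underlying the Minkowski space `E^{2,1}`. -/
abbrev E21 : Type := Fin 3 → ℝ

/-- The Minkowski scalar product `X₁Y₁ + X₂Y₂ - X₃Y₃`. -/
def mink (x y : E21) : ℝ := x 0 * y 0 + x 1 * y 1 - x 2 * y 2

/-- The symmetric bilinear form whose quadratic form defines the confocal quadric with
parameter `l`. It is meaningful for `l ≠ a₁, a₂, -a₃`. -/
def confForm (a₁ a₂ a₃ l : ℝ) (x y : E21) : ℝ :=
  x 0 * y 0 / (a₁ - l) + x 1 * y 1 / (a₂ - l) + x 2 * y 2 / (a₃ + l)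

/-- The confocal quadric `x₁²/(a₁-l) + x₂²/(a₂-l) + x₃²/(a₃+l) = 1`. -/
def confQuadric (a₁ a₂ a₃ l : ℝ) : Set E21 := {x | confForm a₁ a₂ a₃ l x x = 1}

/-- The ellipsoid `x₁²/a₁ + x₂²/a₂ + x₃²/a₃ = 1`. -/
def ellipsoid (a₁ a₂ a₃ : ℝ) : Set E21 := confQuadric a₁ a₂ a₃ 0

/-- The (vectors of the) tangent plane of the ellipsoid at its point `x`. -/
def tangentPlane (a₁ a₂ a₃ : ℝ) (x : E21) : Set E21 := {w | confForm a₁ a₂ a₃ 0 x w = 0}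

/-- `x` lies on a tropic curve: the induced metric on the tangent plane at `x` is degenerate. -/
def IsTropic (a₁ a₂ a₃ : ℝ) (x : E21) : Prop :=
  ∃ w ∈ tangentPlane a₁ a₂ a₃ x, w ≠ 0 ∧ ∀ u ∈ tangentPlane a₁ a₂ a₃ x, mink w u = 0

/-- `x` lies in one of the two (open) polar caps: the induced metric is Riemannian. -/
def InPolarCap (a₁ a₂ a₃ : ℝ) (x : E21) : Prop :=
  ∀ w ∈ tangentPlane a₁ a₂ a₃ x, w ≠ 0 → 0 < mink w w

/-- `x` lies in the (open) equatorial belt: the induced metric is Lorentzian, i.e. it is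
nondegenerate and takes a negative value. -/
def InEquatorialBelt (a₁ a₂ a₃ : ℝ) (x : E21) : Prop :=
  ¬ IsTropic a₁ a₂ a₃ x ∧ ∃ w ∈ tangentPlane a₁ a₂ a₃ x, mink w w < 0

/-- The Minkowski normal vector of the ellipsoid at `x`; it is the gradient of
`x₁²/a₁ + x₂²/a₂ + x₃²/a₃` with respect to the Minkowski product, up to the factor `2`. -/
def normalVec (a₁ a₂ a₃ : ℝ) (x : E21) : E21 := ![x 0 / a₁, x 1 / a₂, -(x 2 / a₃)]

/-- The derivative of the normal field `normalVec` at `x` in the direction `normalVec x`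
(`normalVec` is linear in `x`). -/
def normalVecDeriv (a₁ a₂ a₃ : ℝ) (x : E21) : E21 :=
  normalVec a₁ a₂ a₃ (normalVec a₁ a₂ a₃ x)

/-- `v'` is the billiard reflection of `v` off the ellipsoid at its point `x`.

* Off the tropic curves: `v = a + b` with `a` tangent and `b` Minkowski orthogonal to the tangent
  plane, and `v' = a - b`.
* On the tropic curves, where the normal is light-like, the reflection is extended by continuity:
  two consecutive reflections near `x`, one off a polar cap and one off the equatorial belt, tend
  to the map that is minus the identity on the nondegenerate plane spanned by the normal and by
  its derivative along itself, and the identity on the Minkowski orthogonal complement of that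
  plane. -/
def IsReflection (a₁ a₂ a₃ : ℝ) (x v v' : E21) : Prop :=
  (¬ IsTropic a₁ a₂ a₃ x ∧
    ∃ a b : E21, a ∈ tangentPlane a₁ a₂ a₃ x ∧ (∀ u ∈ tangentPlane a₁ a₂ a₃ x, mink b u = 0) ∧
      v = a + b ∧ v' = a - b) ∨
  (IsTropic a₁ a₂ a₃ x ∧
    ∃ a b : E21,
      mink a (normalVec a₁ a₂ a₃ x) = 0 ∧ mink a (normalVecDeriv a₁ a₂ a₃ x) = 0 ∧
      (∃ s t : ℝ, b = s • normalVec a₁ a₂ a₃ x + t • normalVecDeriv a₁ a₂ a₃ x) ∧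
      v = a + b ∧ v' = a - b)

/-- A billiard trajectory within the ellipsoid, given by its consecutive points of impact: each
segment is a proper chord, and each outgoing segment has the direction of the reflection of the
incoming one. -/
def IsBilliardTrajectory (a₁ a₂ a₃ : ℝ) (M : ℤ → E21) : Prop :=
  ∀ k : ℤ, M k ∈ ellipsoid a₁ a₂ a₃ ∧ M k ≠ M (k + 1) ∧
    ∃ v' : E21, IsReflection a₁ a₂ a₃ (M (k + 1)) (M (k + 1) - M k) v' ∧
      ∃ t : ℝ, 0 < t ∧ M (k + 2) - M (k + 1) = t • v'

/-- The line through `x` with direction `v` touches the confocal quadric with parameter `g`.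
For real `g` this says that the quadratic equation
`confForm v v * t ^ 2 + 2 * confForm x v * t + (confForm x x - 1) = 0`
for its intersections with the quadric has zero discriminant (so contact at infinity and lines
lying on the quadric are included). A line touches the quadric with parameter `∞` if it is
light-like. -/
def Touches (a₁ a₂ a₃ : ℝ) (g : OnePoint ℝ) (x v : E21) : Prop :=
  match g with
  | OnePoint.infty => mink v v = 0
  | OnePoint.some l =>
      confForm a₁ a₂ a₃ l x v ^ 2 =
        confForm a₁ a₂ a₃ l v v * (confForm a₁ a₂ a₃ l x x - 1)

/-- The line through `x` with direction `v` lies on the confocal quadric with parameter `g`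
(no affine line lies on the plane at infinity). -/
def LiesOn (a₁ a₂ a₃ : ℝ) (g : OnePoint ℝ) (x v : E21) : Prop :=
  match g with
  | OnePoint.infty => False
  | OnePoint.some l => ∀ t : ℝ, x + t • v ∈ confQuadric a₁ a₂ a₃ l

/-- The trajectory `M` has the quadrics with parameters `g₁`, `g₂` as its pair of caustics: the
line of each segment touches both of them if they are distinct, and is a generatrix of the double
caustic if they coincide. -/
def HasCaustics (a₁ a₂ a₃ : ℝ) (g₁ g₂ : OnePoint ℝ) (M : ℤ → E21) : Prop :=
  ∀ k : ℤ,
    (g₁ ≠ g₂ ∧ Touches a₁ a₂ a₃ g₁ (M k) (M (k + 1) - M k) ∧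
      Touches a₁ a₂ a₃ g₂ (M k) (M (k + 1) - M k)) ∨
    (g₁ = g₂ ∧ LiesOn a₁ a₂ a₃ g₁ (M k) (M (k + 1) - M k))

/-- The parameter is not one of those of the coordinate planes. -/
def IsNondegenerate (a₁ a₂ a₃ : ℝ) (g : OnePoint ℝ) : Prop :=
  g ≠ ((a₁ : ℝ) : OnePoint ℝ) ∧ g ≠ ((a₂ : ℝ) : OnePoint ℝ) ∧ g ≠ ((-a₃ : ℝ) : OnePoint ℝ)

/-- The trajectory `M` is `n`-periodic, with `m₁` reflections off the polar caps and `n₁`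
reflections off the equatorial belt in a period: it closes after some number `N ≥ 1` of impacts,
and `n = m₁ + n₁`, where an impact at a tropic curve counts as two reflections, one off a polar
cap and one off the equatorial belt. -/
def IsPeriodic (a₁ a₂ a₃ : ℝ) (M : ℤ → E21) (n m₁ n₁ : ℕ) : Prop :=
  ∃ N : ℕ, 1 ≤ N ∧ (∀ k : ℤ, M (k + N) = M k) ∧
    m₁ = Set.ncard {k : ℕ | k < N ∧ (InPolarCap a₁ a₂ a₃ (M k) ∨ IsTropic a₁ a₂ a₃ (M k))} ∧
    n₁ = Set.ncard
      {k : ℕ | k < N ∧ (InEquatorialBelt a₁ a₂ a₃ (M k) ∨ IsTropic a₁ a₂ a₃ (M k))} ∧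
    n = m₁ + n₁

end MinkowskiBilliard

end

noncomputable section

open Polynomial Filter Asymptotics Topology
open scoped Matrix

namespace MinkowskiBilliard

/-! ### Simultaneous diagonalisation and inertia of real symmetric forms. -/

section Spectral

/-! The billiard is read as a string with point masses. Scale each incoming direction `y` so that
its product with the impact `x` in the form of the ellipsoid is 1. A reflection and the flight after
it then become `y' = y - (σ ζ + τ ζ²) x`, `x' = x + t y'`, where `ζ` runs over the inverse
parameters of the three coordinate planes. So each coordinate pair `(x i, y i)` is moved by one
polynomial 2×2 transfer matrix, evaluated at `z = ζ i`; `z` is the inverse of the confocal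
parameter. The mass is linear with `σ > 0` on the belt, linear with `σ < 0` on the caps, and truly
quadratic (`τ > 0`) on a tropic curve, so its degree is the number of reflections counted there.

Closing. The transfer matrices intertwine the Lax matrices of consecutive lines
(`Orbit.prod_mul_laxAt`), whose determinant depends only on the caustics. If one orbit closes, its
monodromy commutes with the Lax matrix; the latter is primitive once its content is removed
(`exists_primitive_lax`), so the monodromy is `p + q M` with polynomials `p`, `q`
(`exists_eq_add_smul`). For another orbit with the same caustics and primitive Lax matrix `M'`, `p -
q M'` inverts `p + q M'`. Comparison of growth at `z = ∞` (`Orbit.growth`,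
`Orbit.natDegree_prod_mul_le`) bounds the degree of the product of the first `k` transfer matrices
with `p - q M'` by the difference of the two reflection counts. When the counts agree the product is
constant, and a constant intertwiner normalised at `z = 0` is 1
(`Orbit.eq_smul_one_of_intertwines`). Hence the second monodromy is `p + q M'`. At the nodes it
multiplies `(x i, y i)` by `p (ζ i)`, which is 1 because the first orbit closes; so the second orbit
closes too, with the same trace `2 p` (`Orbit.exists_period`).

Counting. The roots of trace + 2 are the inverse nonzero eigenvalues of the antiperiodic string. By
Sylvester inertia and a degree bound, its positive and negative roots are as many as the positive
and negative masses, a quadratic mass counting as both (`card_roots_trace_transfer`). So the trace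
alone determines the numbers of reflections off the belt and off the caps. -/

theorem exists_eigenbasis_of_inner {E : Type*} [NormedAddCommGroup E] [InnerProductSpace ℝ E]
    [FiniteDimensional ℝ E] (B : LinearMap.BilinForm ℝ E) (hB : ∀ x y, B x y = B y x) :
    ∃ (e : OrthonormalBasis (Fin (Module.finrank ℝ E)) ℝ E) (μ : Fin (Module.finrank ℝ E) → ℝ),
      ∀ i x, B (e i) x = μ i * inner ℝ (e i) x := by
  let T : E →ₗ[ℝ] E :=
    { toFun := fun x => (InnerProductSpace.toDual ℝ E).symm (LinearMap.toContinuousLinearMap (B x))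
      map_add' := fun x y => by simp
      map_smul' := fun c x => by simp }
  have hT : ∀ x y, inner ℝ (T x) y = B x y := fun x y => by
    simp [T, InnerProductSpace.toDual_symm_apply]
  have hs : T.IsSymmetric := fun x y => by
    rw [hT, real_inner_comm, hT, hB]
  refine ⟨hs.eigenvectorBasis rfl, hs.eigenvalues rfl, fun i x => ?_⟩
  rw [← hT, hs.apply_eigenvectorBasis rfl i]
  simp [inner_smul_left]

/-- Simultaneous diagonalisation of a positive definite and an arbitrary symmetric form. -/
theorem exists_simultaneous_basis {V : Type*} [AddCommGroup V] [Module ℝ V]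
    [FiniteDimensional ℝ V] (K B : LinearMap.BilinForm ℝ V) (hK : ∀ x y, K x y = K y x)
    (hpos : ∀ x, x ≠ 0 → 0 < K x x) (hB : ∀ x y, B x y = B y x) :
    ∃ (e : Module.Basis (Fin (Module.finrank ℝ V)) ℝ V) (μ : Fin (Module.finrank ℝ V) → ℝ),
      (∀ i j, K (e i) (e j) = if i = j then 1 else 0) ∧ ∀ i x, B (e i) x = μ i * K (e i) x := by
  let core : InnerProductSpace.Core ℝ V :=
    { inner := fun x y => K x y
      conj_inner_symm := fun x y => by simp [hK y x]
      re_inner_nonneg := fun x => by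
        by_cases hx : x = 0
        · simp [hx]
        · exact (hpos x hx).le
      add_left := fun x y z => by simp
      smul_left := fun x y r => by simp
      definite := fun x hx => by
        by_contra h
        exact (hpos x h).ne' hx }
  let _ : NormedAddCommGroup V := core.toNormedAddCommGroup
  let _ : InnerProductSpace ℝ V := InnerProductSpace.ofCore core.toCore
  obtain ⟨e, μ, h⟩ := exists_eigenbasis_of_inner B hB
  refine ⟨e.toBasis, μ, fun i j => ?_, fun i x => ?_⟩
  · have := (orthonormal_iff_ite.mp e.orthonormal) i j
    rw [OrthonormalBasis.coe_toBasis]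
    exact this
  · rw [OrthonormalBasis.coe_toBasis]
    exact h i x

/-- The easy half of Sylvester's law of inertia, for a simultaneous eigenbasis. -/
theorem card_le_card_pos {V κ ι : Type*} [AddCommGroup V] [Module ℝ V] [Fintype κ] [DecidableEq κ]
    [Fintype ι]
    (K B : LinearMap.BilinForm ℝ V) (e : Module.Basis κ ℝ V) (μ : κ → ℝ)
    (hK : ∀ i j, K (e i) (e j) = if i = j then 1 else 0)
    (hB : ∀ i x, B (e i) x = μ i * K (e i) x)
    (p : (ι → ℝ) →ₗ[ℝ] V) (hp : ∀ c, c ≠ 0 → 0 < B (p c) (p c)) :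
    Fintype.card ι ≤ Fintype.card {i : κ // 0 < μ i} := by
  -- Project to the coordinates with positive eigenvalue. A kernel vector would have a nonpositive
  -- value of `B`, so the projection is injective on the positive subspace.
  let f : (ι → ℝ) →ₗ[ℝ] ({i : κ // 0 < μ i} → ℝ) :=
    { toFun := fun c i => e.repr (p c) i.1
      map_add' := fun x y => by ext; simp
      map_smul' := fun r x => by ext; simp }
  have hdiag : ∀ x, B x x = ∑ i, μ i * (e.repr x i) ^ 2 := fun x => by
    have hKi : ∀ i, K (e i) x = e.repr x i := fun i => by
      have h : K (e i) (∑ j, e.repr x j • e j) = e.repr x i := by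
        rw [map_sum]; simp [hK]
      rwa [e.sum_repr] at h
    have h : B (∑ i, e.repr x i • e i) x = ∑ i, μ i * (e.repr x i) ^ 2 := by
      rw [map_sum, LinearMap.sum_apply]
      refine Finset.sum_congr rfl fun i _ => ?_
      rw [map_smul, LinearMap.smul_apply, hB, hKi, smul_eq_mul]
      ring
    rwa [e.sum_repr] at h
  have hinj : Function.Injective f := by
    rw [← LinearMap.ker_eq_bot, LinearMap.ker_eq_bot']
    intro c hc
    by_contra hne
    refine absurd (hp c hne) (not_lt.mpr ?_)
    rw [hdiag]
    refine Finset.sum_nonpos fun i _ => ?_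
    by_cases hi : 0 < μ i
    · have : e.repr (p c) i = 0 := congrFun hc ⟨i, hi⟩
      simp [this]
    · exact mul_nonpos_of_nonpos_of_nonneg (not_lt.mp hi) (sq_nonneg _)
  have := LinearMap.finrank_le_finrank_of_injective hinj
  simpa using this

end Spectral

/-! ### Transfer matrices of a string with point masses. -/

/-- The mass at an impact, as a function of the spectral parameter `X`. -/
def mass (σ τ : ℝ) : ℝ[X] := C σ * X + C τ * X ^ 2

/-- The transfer matrix of a reflection followed by a free flight of length `t`. -/
def step (t σ τ : ℝ) : Matrix (Fin 2) (Fin 2) ℝ[X] :=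
  !![1 - C t * mass σ τ, C t; -mass σ τ, 1]

/-- The transfer matrix of the first `k` steps. -/
def transfer (t σ τ : ℕ → ℝ) : ℕ → Matrix (Fin 2) (Fin 2) ℝ[X]
  | 0 => 1
  | k + 1 => step (t k) (σ k) (τ k) * transfer t σ τ k

theorem det_step (t σ τ : ℝ) : (step t σ τ).det = 1 := by
  simp [step, Matrix.det_fin_two]

theorem det_transfer (t σ τ : ℕ → ℝ) (k : ℕ) : (transfer t σ τ k).det = 1 := by
  induction k with
  | zero => simp [transfer]
  | succ k ih => rw [transfer, Matrix.det_mul, det_step, ih, one_mul]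

/-- The number of reflections, counted with multiplicity, of an impact. -/
def massDegree (τ : ℝ) : ℕ := if τ = 0 then 1 else 2

theorem natDegree_mass_le (σ τ : ℝ) : (mass σ τ).natDegree ≤ massDegree τ := by
  unfold mass massDegree
  split_ifs with h
  · subst h; simpa using natDegree_C_mul_X_pow_le σ 1
  · compute_degree

theorem one_le_massDegree (τ : ℝ) : 1 ≤ massDegree τ := by
  unfold massDegree; split_ifs <;> norm_num

theorem natDegree_transfer_le (t σ τ : ℕ → ℝ) (k : ℕ) (i j : Fin 2) :
    (transfer t σ τ k i j).natDegree ≤ ∑ l ∈ Finset.range k, massDegree (τ l) := by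
  induction k generalizing i j with
  | zero => fin_cases i <;> fin_cases j <;> simp [transfer]
  | succ k ih =>
    have hs : ∀ i j, (step (t k) (σ k) (τ k) i j).natDegree ≤ massDegree (τ k) := by
      intro i j
      have hm := natDegree_mass_le (σ k) (τ k)
      fin_cases i <;> fin_cases j <;> simp [step]
      · refine (natDegree_sub_le _ _).trans (max_le (by simp) ?_)
        exact (natDegree_C_mul_le _ _).trans hm
      · exact hm
    rw [transfer, Matrix.mul_apply, Fin.sum_univ_two, Finset.sum_range_succ,
      add_comm (Finset.sum _ _)]
    refine (natDegree_add_le _ _).trans (max_le ?_ ?_) <;>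
      exact natDegree_mul_le.trans (add_le_add (hs _ _) (ih _ _))

/-- All masses vanish at spectral parameter zero and only the free flights remain. This gives trace
+ 2 the value 4 there, and later fixes the scalar in the comparison of two orbits. -/
theorem eval_zero_transfer (t σ τ : ℕ → ℝ) (k : ℕ) :
    (transfer t σ τ k).map (eval 0) = !![1, ∑ l ∈ Finset.range k, t l; 0, 1] := by
  induction k with
  | zero => ext i j; fin_cases i <;> fin_cases j <;> simp [transfer]
  | succ k ih =>
    have hs : (step (t k) (σ k) (τ k)).map (eval 0) = !![1, t k; 0, 1] := by
      ext i j; fin_cases i <;> fin_cases j <;> simp [step, mass]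
    have : (step (t k) (σ k) (τ k) * transfer t σ τ k).map (eval 0) =
        (step (t k) (σ k) (τ k)).map (eval 0) * (transfer t σ τ k).map (eval 0) :=
      Matrix.map_mul (f := evalRingHom 0)
    rw [transfer, this, hs, ih, Finset.sum_range_succ]
    ext i j; fin_cases i <;> fin_cases j <;> simp [add_comm]

/-! ### Antiperiodic solutions and the roots of trace + 2. -/

section Roots

variable {P : Matrix (Fin 2) (Fin 2) ℝ[X]} {z : ℝ}

theorem det_map_eval (P : Matrix (Fin 2) (Fin 2) ℝ[X]) (z : ℝ) :
    (P.map (eval z)).det = eval z P.det := by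
  simp [Matrix.det_fin_two]

/-- For a unimodular 2×2 matrix, `det (P + 1) = trace P + 2`. -/
theorem isRoot_trace_add_two (hP : P.det = 1) {ψ : Fin 2 → ℝ} (hψ : ψ ≠ 0)
    (h : P.map (eval z) *ᵥ ψ = -ψ) : (P.trace + 2).IsRoot z := by
  have h0 : (P.map (eval z) + 1).det = 0 := by
    rw [← Matrix.exists_mulVec_eq_zero_iff]
    exact ⟨ψ, hψ, by rw [Matrix.add_mulVec, h, Matrix.one_mulVec, neg_add_cancel]⟩
  have h1 := det_map_eval P z
  rw [hP] at h1
  simp [Matrix.det_fin_two] at h0 h1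
  simp [IsRoot, Matrix.trace_fin_two]
  linarith

/-- Write `P = -1 + (X - z) q`. Expanding `det P = 1` turns trace + 2 into `(X - z)² det q`. -/
theorem two_le_rootMultiplicity (hP : P.det = 1) (hf : P.trace + 2 ≠ 0)
    (h : P.map (eval z) = -1) : 2 ≤ (P.trace + 2).rootMultiplicity z := by
  rw [le_rootMultiplicity_iff hf]
  have key : ∀ i j, ∃ q, P i j = (if i = j then -1 else 0) + (X - C z) * q := fun i j => by
    have hij : eval z (P i j) = if i = j then -1 else 0 := by
      have := congrFun (congrFun h i) j
      rw [Matrix.map_apply, Matrix.neg_apply, Matrix.one_apply] at this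
      rw [this]; split_ifs <;> simp
    have : X - C z ∣ P i j - C (if i = j then -1 else 0) := by
      rw [dvd_iff_isRoot]; simp [IsRoot, hij]
    obtain ⟨q, hq⟩ := this
    refine ⟨q, ?_⟩
    rw [← hq]
    split_ifs <;> simp
  obtain ⟨q00, h00⟩ := key 0 0
  obtain ⟨q01, h01⟩ := key 0 1
  obtain ⟨q10, h10⟩ := key 1 0
  obtain ⟨q11, h11⟩ := key 1 1
  simp at h00 h01 h10 h11
  rw [Matrix.det_fin_two, h00, h01, h10, h11] at hP
  rw [Matrix.trace_fin_two, h00, h11]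
  refine ⟨q00 * q11 - q01 * q10, ?_⟩
  linear_combination -hP

theorem finrank_ker_le_rootMultiplicity (hP : P.det = 1) (hf : P.trace + 2 ≠ 0) :
    Module.finrank ℝ (LinearMap.ker (Matrix.toLin' (P.map (eval z) + 1))) ≤
      (P.trace + 2).rootMultiplicity z := by
  set W := LinearMap.ker (Matrix.toLin' (P.map (eval z) + 1)) with hW
  have h2 : Module.finrank ℝ W ≤ 2 := by
    simpa using Submodule.finrank_le W
  by_cases h : Module.finrank ℝ W = 2
  · rw [h]
    apply two_le_rootMultiplicity hP hf
    have htop : W = ⊤ := Submodule.eq_top_of_finrank_eq (by simpa using h)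
    have : Matrix.toLin' (P.map (eval z) + 1) = 0 := LinearMap.ker_eq_top.mp htop
    have := (LinearEquiv.map_eq_zero_iff _).mp this
    exact eq_neg_of_add_eq_zero_left this
  by_cases h0 : W = ⊥
  · rw [h0, finrank_bot]; exact Nat.zero_le _
  obtain ⟨ψ, hψ, hne⟩ := Submodule.exists_mem_ne_zero_of_ne_bot h0
  have hr : (P.trace + 2).IsRoot z := by
    refine isRoot_trace_add_two hP hne ?_
    have : (P.map (eval z) + 1) *ᵥ ψ = 0 := by
      rwa [hW, LinearMap.mem_ker, Matrix.toLin'_apply] at hψ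
    rw [Matrix.add_mulVec, Matrix.one_mulVec] at this
    exact eq_neg_of_add_eq_zero_left this
  have := (rootMultiplicity_pos hf).mpr hr
  omega

end Roots

/-! ### The antiperiodic string as an eigenvalue problem. -/

section Chain

variable {N : ℕ}

/-- The inertia form of the linearised string; an impact with a quadratic mass gives a hyperbolic
plane. -/
def inertia (σ τ : ℕ → ℝ) : LinearMap.BilinForm ℝ ((Fin N → ℝ) × (Fin N → ℝ)) :=
  LinearMap.mk₂ ℝ (fun x y =>
    ∑ k : Fin N, (σ k * (x.1 k * y.1 k) - √(τ k) * (x.1 k * y.2 k + x.2 k * y.1 k)))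
    (fun x y z => by
      rw [← Finset.sum_add_distrib]
      exact Finset.sum_congr rfl fun k _ => by simp; ring)
    (fun c x y => by
      rw [Finset.smul_sum]
      exact Finset.sum_congr rfl fun k _ => by simp; ring)
    (fun x y z => by
      rw [← Finset.sum_add_distrib]
      exact Finset.sum_congr rfl fun k _ => by simp; ring)
    (fun c x y => by
      rw [Finset.smul_sum]
      exact Finset.sum_congr rfl fun k _ => by simp; ring)

theorem inertia_apply (σ τ : ℕ → ℝ) (x y : (Fin N → ℝ) × (Fin N → ℝ)) :
    inertia σ τ x y =
      ∑ k : Fin N, (σ k * (x.1 k * y.1 k) - √(τ k) * (x.1 k * y.2 k + x.2 k * y.1 k)) := rfl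

/-- Vectors of the linearised string supported at the points satisfying `p`. -/
def supportedVectors (p : Fin N → Prop) [DecidablePred p] (r : Fin N → ℝ) :
    ({k // p k} → ℝ) →ₗ[ℝ] ((Fin N → ℝ) × (Fin N → ℝ)) where
  toFun c := (fun k => if h : p k then c ⟨k, h⟩ else 0,
    fun k => if h : p k then r k * c ⟨k, h⟩ else 0)
  map_add' c d := by
    ext k <;> by_cases h : p k <;> simp [h, mul_add]
  map_smul' a c := by
    ext k <;> by_cases h : p k <;> simp [h]; ring

/-- On these vectors the form is diagonal, and where `τ k ≠ 0` the ratio `r k` can give its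
coefficient either sign. This is why a quadratic mass counts both as positive and as negative. -/
theorem inertia_supportedVectors {σ τ : ℕ → ℝ} (p : Fin N → Prop) [DecidablePred p] (r : Fin N → ℝ)
    (c : {k // p k} → ℝ) : inertia σ τ (supportedVectors p r c) (supportedVectors p r c) =
      ∑ k : {k // p k}, (σ k - 2 * √(τ k) * r k) * c k ^ 2 := by
  rw [inertia_apply]
  let F : Fin N → ℝ := fun k =>
    (σ k - 2 * √(τ k) * r k) * (if h : p k then c ⟨k, h⟩ else 0) ^ 2
  have h1 : ∑ k : {k // p k}, (σ k - 2 * √(τ k) * r k) * c k ^ 2 = ∑ k : {k // p k}, F k :=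
    Finset.sum_congr rfl fun k _ => by simp [F, k.2]
  rw [h1, ← Finset.sum_subtype (Finset.univ.filter p) (by simp) F,
    Finset.sum_filter_of_ne (by
      intro k _ hk
      by_contra h
      simp [F, h] at hk)]
  refine Finset.sum_congr rfl fun k _ => ?_
  by_cases h : p k <;> simp [F, supportedVectors, h]
  ring

variable [NeZero N]

/-- The antiperiodic continuation of a function on `Fin N`, up to the argument `N`. -/
def antiperiodic : (Fin N → ℝ) →ₗ[ℝ] (ℕ → ℝ) where
  toFun ξ k := if h : k < N then ξ ⟨k, h⟩ else -ξ 0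
  map_add' ξ η := by ext k; by_cases h : k < N <;> simp [h, add_comm]
  map_smul' c ξ := by ext k; by_cases h : k < N <;> simp [h]

theorem antiperiodic_coe (ξ : Fin N → ℝ) (k : Fin N) : antiperiodic ξ k = ξ k := by
  simp [antiperiodic]

theorem antiperiodic_last (ξ : Fin N → ℝ) : antiperiodic ξ N = -antiperiodic ξ 0 := by
  simp [antiperiodic, Nat.pos_of_neZero N]

theorem antiperiodic_eq_zero {ξ : Fin N → ℝ} (h : ∀ k ≤ N, antiperiodic ξ k = 0) : ξ = 0 := by
  ext k
  rw [← antiperiodic_coe ξ k]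
  exact h k k.2.le

/-- The elastic energy of an antiperiodic string with auxiliary springs at its points. -/
def stiffness (t : ℕ → ℝ) : LinearMap.BilinForm ℝ ((Fin N → ℝ) × (Fin N → ℝ)) :=
  LinearMap.mk₂ ℝ (fun x y =>
    ∑ k ∈ Finset.range N, (antiperiodic x.1 (k + 1) - antiperiodic x.1 k) *
      (antiperiodic y.1 (k + 1) - antiperiodic y.1 k) / t k + ∑ k, x.2 k * y.2 k)
    (fun x y z => by
      rw [add_add_add_comm, ← Finset.sum_add_distrib, ← Finset.sum_add_distrib]
      congr 1 <;> exact Finset.sum_congr rfl fun k _ => by simp; ring)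
    (fun c x y => by
      rw [smul_add, Finset.smul_sum, Finset.smul_sum]
      congr 1 <;> exact Finset.sum_congr rfl fun k _ => by simp; ring)
    (fun x y z => by
      rw [add_add_add_comm, ← Finset.sum_add_distrib, ← Finset.sum_add_distrib]
      congr 1 <;> exact Finset.sum_congr rfl fun k _ => by simp; ring)
    (fun c x y => by
      rw [smul_add, Finset.smul_sum, Finset.smul_sum]
      congr 1 <;> exact Finset.sum_congr rfl fun k _ => by simp; ring)

theorem stiffness_apply (t : ℕ → ℝ) (x y : (Fin N → ℝ) × (Fin N → ℝ)) :
    stiffness t x y = ∑ k ∈ Finset.range N, (antiperiodic x.1 (k + 1) - antiperiodic x.1 k) *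
      (antiperiodic y.1 (k + 1) - antiperiodic y.1 k) / t k + ∑ k, x.2 k * y.2 k := rfl

theorem stiffness_pos {t : ℕ → ℝ} (ht : ∀ k, 0 < t k) {x : (Fin N → ℝ) × (Fin N → ℝ)}
    (hx : x ≠ 0) : 0 < stiffness t x x := by
  rw [stiffness_apply]
  have h1 : ∀ k ∈ Finset.range N, 0 ≤ (antiperiodic x.1 (k + 1) - antiperiodic x.1 k) *
      (antiperiodic x.1 (k + 1) - antiperiodic x.1 k) / t k :=
    fun k _ => div_nonneg (mul_self_nonneg _) (ht k).le
  have h2 : ∀ k ∈ Finset.univ, 0 ≤ x.2 k * x.2 k := fun k _ => mul_self_nonneg _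
  refine (add_nonneg (Finset.sum_nonneg h1) (Finset.sum_nonneg h2)).lt_of_ne' fun h => hx ?_
  obtain ⟨e1, e2⟩ := (add_eq_zero_iff_of_nonneg (Finset.sum_nonneg h1) (Finset.sum_nonneg h2)).mp h
  rw [Finset.sum_eq_zero_iff_of_nonneg h1] at e1
  rw [Finset.sum_eq_zero_iff_of_nonneg h2] at e2
  have hc : ∀ k ≤ N, antiperiodic x.1 k = antiperiodic x.1 0 := by
    intro k hk
    induction k with
    | zero => rfl
    | succ k ih =>
      have := e1 k (Finset.mem_range.mpr hk)
      rw [div_eq_zero_iff, or_iff_left (ht k).ne', mul_self_eq_zero, sub_eq_zero] at this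
      rw [this, ih (by omega)]
  -- A string without tension is constant, and antiperiodicity kills the constant. A periodic string
  -- would keep this zero mode, hence the use of trace + 2 instead of trace - 2.
  have h0 : antiperiodic x.1 0 = 0 := by
    have := hc N le_rfl
    rw [antiperiodic_last] at this
    linarith
  refine Prod.ext (antiperiodic_eq_zero fun k hk => by rw [hc k hk, h0]) (funext fun k => ?_)
  simpa using e2 k (Finset.mem_univ k)

/-- The slope of the string on the left of the point `k`. -/
def slope (t : ℕ → ℝ) : (Fin N → ℝ) →ₗ[ℝ] (ℕ → ℝ) where
  toFun ξ k := if k = 0 then -(antiperiodic ξ N - antiperiodic ξ (N - 1)) / t (N - 1)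
    else (antiperiodic ξ k - antiperiodic ξ (k - 1)) / t (k - 1)
  map_add' ξ η := by ext k; by_cases h : k = 0 <;> simp [h] <;> ring
  map_smul' c ξ := by ext k; by_cases h : k = 0 <;> simp [h] <;> ring

theorem slope_last (t : ℕ → ℝ) (ξ : Fin N → ℝ) : slope t ξ N = -slope t ξ 0 := by
  simp [slope, NeZero.ne N]; ring

theorem slope_succ (t : ℕ → ℝ) (ξ : Fin N → ℝ) (k : ℕ) :
    slope t ξ (k + 1) = (antiperiodic ξ (k + 1) - antiperiodic ξ k) / t k := by
  simp [slope]

/-- Summation by parts; the boundary terms cancel because the slope and `η` both change sign over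
the period. -/
theorem sum_slope_mul (t : ℕ → ℝ) (ξ η : Fin N → ℝ) :
    ∑ k ∈ Finset.range N, (antiperiodic ξ (k + 1) - antiperiodic ξ k) *
      (antiperiodic η (k + 1) - antiperiodic η k) / t k =
    ∑ k : Fin N, (slope t ξ k - slope t ξ (k + 1)) * η k := by
  have h : ∀ n, ∑ k ∈ Finset.range n, (antiperiodic ξ (k + 1) - antiperiodic ξ k) *
      (antiperiodic η (k + 1) - antiperiodic η k) / t k =
      ∑ k ∈ Finset.range n, (slope t ξ k - slope t ξ (k + 1)) * antiperiodic η k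
        + slope t ξ n * antiperiodic η n - slope t ξ 0 * antiperiodic η 0 := by
    intro n
    induction n with
    | zero => simp
    | succ n ih =>
      rw [Finset.sum_range_succ, Finset.sum_range_succ, ih, slope_succ]
      ring
  rw [h, slope_last, antiperiodic_last,
    Finset.sum_range fun k => (slope t ξ k - slope t ξ (k + 1)) * antiperiodic η k]
  simp only [antiperiodic_coe]
  ring

variable {t σ τ : ℕ → ℝ} {μ : ℝ} {x : (Fin N → ℝ) × (Fin N → ℝ)}

theorem eigenvector_snd (hμ : μ ≠ 0) (hx : ∀ y, inertia σ τ x y = μ * stiffness t x y)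
    (k : Fin N) : x.2 k = -(μ⁻¹ * √(τ k) * x.1 k) := by
  have := hx (0, Pi.single k 1)
  simp [inertia_apply, stiffness_apply, Pi.single_apply] at this
  field_simp
  linarith

/-- Eliminating the auxiliary coordinate `x.2 k` produces the term `τ k / μ²`, so the linear
eigenvalue problem becomes the string equation with quadratic mass at spectral parameter `μ⁻¹`. -/
theorem eigenvector_slope (hμ : μ ≠ 0) (hτ : ∀ k, 0 ≤ τ k)
    (hx : ∀ y, inertia σ τ x y = μ * stiffness t x y) (k : Fin N) :
    slope t x.1 (k + 1) = slope t x.1 k - eval μ⁻¹ (mass (σ k) (τ k)) * x.1 k := by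
  have h := hx (Pi.single k 1, 0)
  rw [inertia_apply, stiffness_apply, sum_slope_mul] at h
  simp [Pi.single_apply] at h
  rw [eigenvector_snd hμ hx] at h
  simp [mass]
  have hs := Real.mul_self_sqrt (hτ k)
  field_simp at h ⊢
  linear_combination h - x.1 k * hs

theorem step_mulVec_eigenvector (ht : ∀ k, 0 < t k) (hμ : μ ≠ 0) (hτ : ∀ k, 0 ≤ τ k)
    (hx : ∀ y, inertia σ τ x y = μ * stiffness t x y) {k : ℕ} (hk : k < N) :
    (step (t k) (σ k) (τ k)).map (eval μ⁻¹) *ᵥ ![antiperiodic x.1 k, slope t x.1 k] =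
      ![antiperiodic x.1 (k + 1), slope t x.1 (k + 1)] := by
  have h := eigenvector_slope hμ hτ hx ⟨k, hk⟩
  rw [← antiperiodic_coe x.1] at h
  simp only at h
  have h2 := slope_succ t x.1 k
  rw [eq_div_iff (ht k).ne'] at h2
  ext i
  fin_cases i
  · simp [step, Matrix.mulVec, dotProduct, Fin.sum_univ_two]
    linear_combination h2 - t k * h
  · simp [step, Matrix.mulVec, dotProduct, Fin.sum_univ_two]
    linear_combination -h

theorem transfer_mulVec_eigenvector (ht : ∀ k, 0 < t k) (hμ : μ ≠ 0) (hτ : ∀ k, 0 ≤ τ k)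
    (hx : ∀ y, inertia σ τ x y = μ * stiffness t x y) {k : ℕ} (hk : k ≤ N) :
    (transfer t σ τ k).map (eval μ⁻¹) *ᵥ ![antiperiodic x.1 0, slope t x.1 0] =
      ![antiperiodic x.1 k, slope t x.1 k] := by
  induction k with
  | zero =>
    have : (1 : Matrix (Fin 2) (Fin 2) ℝ[X]).map (eval μ⁻¹) = 1 :=
      Matrix.map_one _ (by simp) (by simp)
    rw [transfer, this, Matrix.one_mulVec]
  | succ k ih =>
    have : (step (t k) (σ k) (τ k) * transfer t σ τ k).map (eval μ⁻¹) =
        (step (t k) (σ k) (τ k)).map (eval μ⁻¹) * (transfer t σ τ k).map (eval μ⁻¹) :=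
      Matrix.map_mul (f := evalRingHom μ⁻¹)
    rw [transfer, this, ← Matrix.mulVec_mulVec, ih (by omega),
      step_mulVec_eigenvector ht hμ hτ hx hk]

theorem eigenvector_eq_zero (ht : ∀ k, 0 < t k) (hμ : μ ≠ 0) (hτ : ∀ k, 0 ≤ τ k)
    (hx : ∀ y, inertia σ τ x y = μ * stiffness t x y)
    (h0 : antiperiodic x.1 0 = 0) (h1 : slope t x.1 0 = 0) : x = 0 := by
  have h : x.1 = 0 := antiperiodic_eq_zero fun k hk => by
    have := congrFun (transfer_mulVec_eigenvector ht hμ hτ hx hk) 0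
    simpa [h0, h1] using this.symm
  refine Prod.ext h (funext fun k => ?_)
  simp [eigenvector_snd hμ hx, h]

/-- An eigenvector is determined by its initial position and slope, which form a vector sent to its
negative by the monodromy at `μ⁻¹`. So the eigenspace embeds in the kernel of monodromy + 1. -/
theorem card_eigenvalue_le_rootMultiplicity (ht : ∀ k, 0 < t k) (hμ : μ ≠ 0)
    (hτ : ∀ k, 0 ≤ τ k) (hf : (transfer t σ τ N).trace + 2 ≠ 0) {κ : Type*} [Fintype κ]
    (e : Module.Basis κ ℝ ((Fin N → ℝ) × (Fin N → ℝ))) (ν : κ → ℝ)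
    (he : ∀ i y, inertia σ τ (e i) y = ν i * stiffness t (e i) y) :
    Fintype.card {i // ν i = μ} ≤ ((transfer t σ τ N).trace + 2).rootMultiplicity μ⁻¹ := by
  refine le_trans ?_ (finrank_ker_le_rootMultiplicity (det_transfer t σ τ N) hf)
  let comb : ({i // ν i = μ} → ℝ) →ₗ[ℝ] ((Fin N → ℝ) × (Fin N → ℝ)) :=
    Fintype.linearCombination ℝ fun i => e i.1
  have hcomb : ∀ c y, inertia σ τ (comb c) y = μ * stiffness t (comb c) y := by
    intro c y
    simp only [comb, Fintype.linearCombination_apply, map_sum, map_smul, LinearMap.sum_apply,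
      LinearMap.smul_apply, he, smul_eq_mul, Finset.mul_sum]
    refine Finset.sum_congr rfl fun i _ => ?_
    rw [i.2]; ring
  let g : ({i // ν i = μ} → ℝ) →ₗ[ℝ] (Fin 2 → ℝ) :=
    { toFun := fun c => ![antiperiodic (comb c).1 0, slope t (comb c).1 0]
      map_add' := fun c d => by simp
      map_smul' := fun r c => by simp }
  have hg : ∀ c, g c ∈ LinearMap.ker
      (Matrix.toLin' ((transfer t σ τ N).map (eval μ⁻¹) + 1)) := by
    intro c
    rw [LinearMap.mem_ker, Matrix.toLin'_apply, Matrix.add_mulVec, Matrix.one_mulVec]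
    change _ *ᵥ ![antiperiodic (comb c).1 0, slope t (comb c).1 0] +
      ![antiperiodic (comb c).1 0, slope t (comb c).1 0] = 0
    rw [transfer_mulVec_eigenvector ht hμ hτ (hcomb c) le_rfl, antiperiodic_last, slope_last]
    simp
  have hinj : Function.Injective (g.codRestrict _ hg) := by
    rw [← LinearMap.ker_eq_bot, LinearMap.ker_codRestrict, LinearMap.ker_eq_bot']
    intro c hc
    have h0 := congrFun hc 0
    have h1 := congrFun hc 1
    have hz : comb c = 0 := eigenvector_eq_zero ht hμ hτ (hcomb c) h0 h1
    have hli : LinearIndependent ℝ fun i : {i // ν i = μ} => e i.1 :=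
      e.linearIndependent.comp _ Subtype.val_injective
    have := Fintype.linearIndependent_iff.mp hli c (by
      simpa [comb, Fintype.linearCombination_apply] using hz)
    exact funext this
  simpa using LinearMap.finrank_le_finrank_of_injective hinj

theorem card_pos_eigenvalues_le (ht : ∀ k, 0 < t k) (hτ : ∀ k, 0 ≤ τ k)
    (hf : (transfer t σ τ N).trace + 2 ≠ 0) {κ : Type*} [Fintype κ]
    (e : Module.Basis κ ℝ ((Fin N → ℝ) × (Fin N → ℝ))) (ν : κ → ℝ)
    (he : ∀ i y, inertia σ τ (e i) y = ν i * stiffness t (e i) y) (p : ℝ → Prop)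
    [DecidablePred p] (hp : ∀ r, p r → p r⁻¹) (hp0 : ¬ p 0) :
    Fintype.card {i // p (ν i)} ≤
      (((transfer t σ τ N).trace + 2).roots.filter p).card := by
  classical
  -- The inverse eigenvalues, with multiplicity; they are compared with the roots point by point.
  let s : Multiset ℝ := (Finset.univ.filter fun i => p (ν i)).val.map fun i => (ν i)⁻¹
  have hs : s ≤ ((transfer t σ τ N).trace + 2).roots.filter p := by
    rw [Multiset.le_filter]
    constructor
    · rw [Multiset.le_iff_count]
      intro z
      rw [count_roots]
      by_cases hz : z = 0
      · rw [Multiset.count_eq_zero_of_notMem]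
        · exact zero_le
        · intro hmem
          obtain ⟨i, hi, h⟩ := Multiset.mem_map.mp hmem
          rw [hz, inv_eq_zero] at h
          rw [Finset.mem_val, Finset.mem_filter, h] at hi
          exact hp0 hi.2
      · have := card_eigenvalue_le_rootMultiplicity ht (inv_ne_zero hz) hτ hf e ν he
        rw [inv_inv] at this
        refine le_trans ?_ this
        rw [Fintype.card_subtype, Multiset.count_map]
        refine Finset.card_le_card (s := (Finset.univ.filter fun i => p (ν i)).filter
          fun i => z = (ν i)⁻¹) fun i hi => ?_
        rw [Finset.mem_filter] at hi
        simp [hi.2]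
    · intro z hz
      obtain ⟨i, hi, h⟩ := Multiset.mem_map.mp hz
      rw [Finset.mem_val, Finset.mem_filter] at hi
      rw [← h]
      exact hp _ hi.2
  have := Multiset.card_le_card hs
  rwa [Multiset.card_map, Finset.card_val, ← Fintype.card_subtype] at this

theorem two_mul_sqrt_mul_div {τ : ℝ} (hτ : 0 < τ) (s : ℝ) : 2 * √τ * (s / (2 * √τ)) = s := by
  have := Real.sqrt_pos.mpr hτ
  field_simp

/-- An antiperiodic string has as many positive (negative) eigenvalues as positive (negative)
masses, where a quadratic mass counts as both. -/
theorem card_roots_trace_transfer (ht : ∀ k, 0 < t k) (hτ : ∀ k, 0 ≤ τ k)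
    (hστ : ∀ k, τ k = 0 → σ k ≠ 0) :
    (((transfer t σ τ N).trace + 2).roots.filter (0 < ·)).card =
        (Finset.univ.filter fun k : Fin N => τ k ≠ 0 ∨ 0 < σ k).card ∧
      (((transfer t σ τ N).trace + 2).roots.filter (· < 0)).card =
        (Finset.univ.filter fun k : Fin N => τ k ≠ 0 ∨ σ k < 0).card := by
  set f := (transfer t σ τ N).trace + 2 with hf
  -- Its value at 0 is 2 + 2 = 4.
  have hf0 : f ≠ 0 := by
    intro h
    have h1 := congrArg (eval 0) h
    have h2 := eval_zero_transfer t σ τ N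
    have h00 := congrFun (congrFun h2 0) 0
    have h11 := congrFun (congrFun h2 1) 1
    simp at h00 h11
    simp [hf, Matrix.trace_fin_two, h00, h11] at h1
    norm_num at h1
  have hdeg : f.natDegree ≤ ∑ k ∈ Finset.range N, massDegree (τ k) := by
    rw [hf, Matrix.trace_fin_two]
    refine (natDegree_add_le _ _).trans (max_le ((natDegree_add_le _ _).trans (max_le ?_ ?_)) ?_)
    · exact natDegree_transfer_le t σ τ N 0 0
    · exact natDegree_transfer_le t σ τ N 1 1
    · exact (natDegree_ofNat 2).le.trans (Nat.zero_le _)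
  have hcount : ∑ k ∈ Finset.range N, massDegree (τ k) =
      (Finset.univ.filter fun k : Fin N => τ k ≠ 0 ∨ 0 < σ k).card +
      (Finset.univ.filter fun k : Fin N => τ k ≠ 0 ∨ σ k < 0).card := by
    rw [Finset.card_filter, Finset.card_filter, ← Finset.sum_add_distrib, Finset.sum_range]
    refine Finset.sum_congr rfl fun k _ => ?_
    unfold massDegree
    by_cases h : τ k = 0
    · rcases lt_or_gt_of_ne (hστ k h) with h' | h'
      · simp [h, h', h'.not_gt]
      · simp [h, h', h'.not_gt]
    · simp [h]
  obtain ⟨e, ν, hK, hB⟩ := exists_simultaneous_basis (stiffness (N := N) t) (inertia σ τ)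
    (fun x y => by
      rw [stiffness_apply, stiffness_apply]
      congr 1 <;> exact Finset.sum_congr rfl fun _ _ => by ring)
    (fun x hx => stiffness_pos ht hx)
    (fun x y => by
      rw [inertia_apply, inertia_apply]
      exact Finset.sum_congr rfl fun _ _ => by ring)
  have hsum : ∀ {ι : Type} [Fintype ι] (a c : ι → ℝ), (∀ i, 0 < a i) → c ≠ 0 →
      0 < ∑ i, a i * c i ^ 2 := by
    intro ι _ a c ha hc
    obtain ⟨i, hi⟩ := Function.ne_iff.mp hc
    refine Finset.sum_pos' (fun j _ => mul_nonneg (ha j).le (sq_nonneg _))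
      ⟨i, Finset.mem_univ i, mul_pos (ha i) (sq_pos_of_ne_zero hi)⟩
  have hpos : (Finset.univ.filter fun k : Fin N => τ k ≠ 0 ∨ 0 < σ k).card ≤
      (f.roots.filter (0 < ·)).card := by
    have h1 := card_le_card_pos _ _ e ν hK hB
      (supportedVectors (fun k : Fin N => τ k ≠ 0 ∨ 0 < σ k)
        -- Chosen so that the diagonal coefficient is `σ k + |σ k| + 1 > 0`. If `τ k = 0` the
        -- quotient is 0 by convention and the coefficient is just `σ k`.
        fun k => -(|σ k| + 1) / (2 * √(τ k)))
      (fun c hc => by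
        rw [inertia_supportedVectors]
        refine hsum _ _ (fun k => ?_) hc
        by_cases h : τ k = 0
        · have := k.2.resolve_left (not_not.mpr h)
          simpa [h] using this
        · rw [two_mul_sqrt_mul_div ((hτ k).lt_of_ne' h)]
          linarith [neg_abs_le (σ k)])
    have h2 := card_pos_eigenvalues_le ht hτ hf0 e ν hB (0 < ·) (fun r hr => inv_pos.mpr hr)
      (lt_irrefl 0)
    rw [Fintype.card_subtype] at h1
    exact h1.trans h2
  have hneg : (Finset.univ.filter fun k : Fin N => τ k ≠ 0 ∨ σ k < 0).card ≤
      (f.roots.filter (· < 0)).card := by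
    have h1 := card_le_card_pos (stiffness t) (-inertia σ τ) e (fun i => -ν i) hK
      (fun i x => by simp [hB])
      (supportedVectors (fun k : Fin N => τ k ≠ 0 ∨ σ k < 0)
        fun k => (|σ k| + 1) / (2 * √(τ k)))
      (fun c hc => by
        rw [LinearMap.neg_apply, LinearMap.neg_apply, inertia_supportedVectors,
          ← Finset.sum_neg_distrib]
        simp only [← neg_mul]
        refine hsum _ _ (fun k => ?_) hc
        by_cases h : τ k = 0
        · have := k.2.resolve_left (not_not.mpr h)
          simpa [h] using this
        · rw [two_mul_sqrt_mul_div ((hτ k).lt_of_ne' h)]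
          linarith [le_abs_self (σ k)])
    have h2 := card_pos_eigenvalues_le ht hτ hf0 e ν hB (· < 0) (fun r hr => inv_lt_zero.mpr hr)
      (lt_irrefl 0)
    simp only [neg_pos] at h1
    rw [Fintype.card_subtype] at h1
    exact h1.trans h2
  -- The two lower bounds already add up to the upper bound for the degree, so all three
  -- inequalities are equalities.
  have htot : (f.roots.filter (0 < ·)).card + (f.roots.filter (· < 0)).card ≤ f.natDegree := by
    refine le_trans ?_ (card_roots' f)
    have h := Multiset.filter_add_filter (fun r : ℝ => 0 < r) (fun r => r < 0) f.roots
    have h0 : f.roots.filter (fun r : ℝ => 0 < r ∧ r < 0) = 0 :=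
      Multiset.filter_eq_nil.mpr fun r _ hr => lt_asymm hr.1 hr.2
    rw [h0, add_zero] at h
    rw [← Multiset.card_add, h]
    exact Multiset.card_le_card (Multiset.filter_le _ _)
  omega

end Chain

/-! ### The Lax representation of the billiard map. -/

section Lax

variable (b ζ : Fin 3 → ℝ)

/-- The polynomial whose roots are the parameters of the coordinate planes. -/
def nodal : ℝ[X] := (X - C (ζ 0)) * (X - C (ζ 1)) * (X - C (ζ 2))

/-- The bilinear forms of the confocal family, as functions of the spectral parameter and
multiplied by `nodal`. -/
def pencil (x y : Fin 3 → ℝ) : ℝ[X] :=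
  C (b 0 * x 0 * y 0) * X * ((X - C (ζ 1)) * (X - C (ζ 2))) +
  C (b 1 * x 1 * y 1) * X * ((X - C (ζ 0)) * (X - C (ζ 2))) +
  C (b 2 * x 2 * y 2) * X * ((X - C (ζ 0)) * (X - C (ζ 1)))

/-- The moments of a pair of vectors. -/
def moment (j : ℕ) (x y : Fin 3 → ℝ) : ℝ :=
  b 0 * ζ 0 ^ j * x 0 * y 0 + b 1 * ζ 1 ^ j * x 1 * y 1 + b 2 * ζ 2 ^ j * x 2 * y 2

/-- The Lax matrix of the line through `x` with direction `y`. -/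
def lax (x y : Fin 3 → ℝ) : Matrix (Fin 2) (Fin 2) ℝ[X] :=
  !![-pencil b ζ x y, pencil b ζ x x - nodal ζ; -pencil b ζ y y, pencil b ζ x y]

variable {b ζ}

theorem pencil_comm (x y : Fin 3 → ℝ) : pencil b ζ x y = pencil b ζ y x := by
  simp only [pencil, map_mul]; ring

theorem pencil_add_right (x y y' : Fin 3 → ℝ) :
    pencil b ζ x (y + y') = pencil b ζ x y + pencil b ζ x y' := by
  simp only [pencil, Pi.add_apply, map_mul, map_add]; ring

theorem pencil_smul_right (c : ℝ) (x y : Fin 3 → ℝ) :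
    pencil b ζ x (c • y) = C c * pencil b ζ x y := by
  simp only [pencil, Pi.smul_apply, smul_eq_mul, map_mul]; ring

theorem pencil_add_left (x x' y : Fin 3 → ℝ) :
    pencil b ζ (x + x') y = pencil b ζ x y + pencil b ζ x' y := by
  rw [pencil_comm, pencil_add_right, pencil_comm y, pencil_comm y]

theorem pencil_smul_left (c : ℝ) (x y : Fin 3 → ℝ) :
    pencil b ζ (c • x) y = C c * pencil b ζ x y := by
  rw [pencil_comm, pencil_smul_right, pencil_comm y]

theorem pencil_mul_right (x y : Fin 3 → ℝ) :
    pencil b ζ x (ζ * y) = X * pencil b ζ x y - C (moment b ζ 0 x y) * X * nodal ζ := by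
  simp only [pencil, moment, nodal, Pi.mul_apply, map_mul, map_add, pow_zero, mul_one]; ring

theorem pencil_mul_left (x y : Fin 3 → ℝ) :
    pencil b ζ (ζ * x) y = X * pencil b ζ x y - C (moment b ζ 0 x y) * X * nodal ζ := by
  rw [pencil_comm, pencil_mul_right, pencil_comm y]
  simp only [moment]; congr 3; ring_nf

/-- The direction after a reflection with masses `σ`, `τ` at `x`. -/
def deflect (ζ : Fin 3 → ℝ) (σ τ : ℝ) (x y : Fin 3 → ℝ) : Fin 3 → ℝ :=
  fun i => y i - (σ * ζ i + τ * ζ i ^ 2) * x i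

theorem deflect_eq (σ τ : ℝ) (x y : Fin 3 → ℝ) :
    deflect ζ σ τ x y = y + (-σ) • (ζ * x) + (-τ) • (ζ * (ζ * x)) := by
  ext i; simp [deflect]; ring

/-- The relations between the masses of an impact and the incoming line. -/
structure IsImpact (b ζ : Fin 3 → ℝ) (x y : Fin 3 → ℝ) (σ τ : ℝ) : Prop where
  on : moment b ζ 0 x x = 1
  dir : moment b ζ 0 x y = 1
  law : (τ = 0 ∧ σ * moment b ζ 1 x x = 2) ∨
    -- In the tropic case the last equation says, given `dir`, that the Minkowski square of the
    -- direction is preserved; it determines `σ`.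
    (moment b ζ 1 x x = 0 ∧ 0 < τ ∧ τ * moment b ζ 2 x x = 2 ∧
      2 * σ + 2 * τ * moment b ζ 1 x y = 2 * σ * τ * moment b ζ 2 x x + τ ^ 2 * moment b ζ 3 x x)

/-- The matrix of a reflection. -/
def kick (σ τ : ℝ) : Matrix (Fin 2) (Fin 2) ℝ[X] := !![1, 0; -mass σ τ, 1]

/-- The matrix of a free flight. -/
def flight (t : ℝ) : Matrix (Fin 2) (Fin 2) ℝ[X] := !![1, C t; 0, 1]

theorem flight_mul_kick (t σ τ : ℝ) : flight t * kick σ τ = step t σ τ := by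
  rw [flight, kick, step, Matrix.mul_fin_two]
  simp [sub_eq_add_neg]

theorem moment_mul_right (j : ℕ) (x y : Fin 3 → ℝ) :
    moment b ζ j x (ζ * y) = moment b ζ (j + 1) x y := by
  simp only [moment, Pi.mul_apply]; ring

theorem moment_mul_left (j : ℕ) (x y : Fin 3 → ℝ) :
    moment b ζ j (ζ * x) y = moment b ζ (j + 1) x y := by
  simp only [moment, Pi.mul_apply]; ring

theorem moment_comm (j : ℕ) (x y : Fin 3 → ℝ) : moment b ζ j x y = moment b ζ j y x := by
  simp only [moment]; ring

variable {x y : Fin 3 → ℝ} {σ τ : ℝ}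

theorem pencil_deflect (h : IsImpact b ζ x y σ τ) :
    pencil b ζ x (deflect ζ σ τ x y) =
      pencil b ζ x y - mass σ τ * (pencil b ζ x x - nodal ζ) := by
  have hτ : C τ * C (moment b ζ 1 x x) = 0 := by
    rw [← map_mul]
    rcases h.law with h | h <;> simp [h.1]
  have hon : C (moment b ζ 0 x x) = 1 := by rw [h.on, map_one]
  rw [deflect_eq]
  simp only [pencil_add_right, pencil_smul_right, pencil_mul_right, moment_mul_right, mass, map_neg]
  linear_combination (C σ * X * nodal ζ + C τ * X ^ 2 * nodal ζ) * hon + X * nodal ζ * hτ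

theorem pencil_deflect_deflect (h : IsImpact b ζ x y σ τ) :
    pencil b ζ (deflect ζ σ τ x y) (deflect ζ σ τ x y) =
      pencil b ζ y y - 2 * mass σ τ * pencil b ζ x y
        + mass σ τ ^ 2 * (pencil b ζ x x - nodal ζ) := by
  have hτ : C τ * C (moment b ζ 1 x x) = 0 := by
    rw [← map_mul]
    rcases h.law with h | h <;> simp [h.1]
  have hon : C (moment b ζ 0 x x) = 1 := by rw [h.on, map_one]
  have hdir : C (moment b ζ 0 x y) = 1 := by rw [h.dir, map_one]
  have h2 : C τ ^ 2 * C (moment b ζ 2 x x) = 2 * C τ := by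
    have : τ ^ 2 * moment b ζ 2 x x = 2 * τ := by
      rcases h.law with h | h
      · simp [h.1]
      · linear_combination τ * h.2.2.1
    simpa [show (C (2 : ℝ)) = 2 from rfl] using congrArg (C : ℝ → ℝ[X]) this
  have h1 : 2 * C σ + 2 * C τ * C (moment b ζ 1 x y) = C σ ^ 2 * C (moment b ζ 1 x x) +
      2 * C σ * C τ * C (moment b ζ 2 x x) + C τ ^ 2 * C (moment b ζ 3 x x) := by
    have : 2 * σ + 2 * τ * moment b ζ 1 x y = σ ^ 2 * moment b ζ 1 x x +
        2 * σ * τ * moment b ζ 2 x x + τ ^ 2 * moment b ζ 3 x x := by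
      rcases h.law with h | h
      · rw [h.1]; linear_combination -σ * h.2
      · rw [h.1]; linear_combination h.2.2.2
    simpa [show (C (2 : ℝ)) = 2 from rfl] using congrArg (C : ℝ → ℝ[X]) this
  rw [deflect_eq]
  simp only [pencil_add_right, pencil_smul_right, pencil_add_left, pencil_smul_left, map_neg]
  simp only [pencil_mul_right, pencil_mul_left, moment_mul_right, moment_mul_left, mass,
    pencil_comm y x, moment_comm _ y x, zero_add, Nat.reduceAdd]
  linear_combination -nodal ζ * (C σ * X + C τ * X ^ 2) ^ 2 * hon
    + nodal ζ * X * (h1 + 2 * C σ * hdir)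
    + nodal ζ * X ^ 2 * (2 * C τ * hdir - h2 - 2 * C σ * hτ) - X ^ 3 * nodal ζ * C τ * hτ

/-- Conjugating the Lax matrix by the kick changes its entries exactly as the reflection changes the
pencil. The impact law is what cancels the extra multiples of `nodal`. -/
theorem kick_mul_lax (h : IsImpact b ζ x y σ τ) :
    kick σ τ * lax b ζ x y = lax b ζ x (deflect ζ σ τ x y) * kick σ τ := by
  rw [kick, lax, lax, Matrix.mul_fin_two, Matrix.mul_fin_two, pencil_deflect h,
    pencil_deflect_deflect h]
  refine Matrix.ext fun i j => ?_
  fin_cases i <;> fin_cases j <;> simp <;> ring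

theorem flight_mul_lax (t : ℝ) (x y : Fin 3 → ℝ) :
    flight t * lax b ζ x y = lax b ζ (x + t • y) y * flight t := by
  rw [flight, lax, lax, Matrix.mul_fin_two, Matrix.mul_fin_two]
  simp only [pencil_add_right, pencil_smul_right, pencil_add_left, pencil_smul_left,
    pencil_comm y x]
  refine Matrix.ext fun i j => ?_
  fin_cases i <;> fin_cases j <;> simp <;> ring

variable (b ζ) in
/-- A sequence of impacts; `y k` is the direction of the line coming in at `x k`. -/
structure Orbit where
  x : ℕ → Fin 3 → ℝ
  y : ℕ → Fin 3 → ℝ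
  t : ℕ → ℝ
  σ : ℕ → ℝ
  τ : ℕ → ℝ
  t_pos : ∀ k, 0 < t k
  impact : ∀ k, IsImpact b ζ (x k) (y k) (σ k) (τ k)
  y_succ : ∀ k, y (k + 1) = deflect ζ (σ k) (τ k) (x k) (y k)
  x_succ : ∀ k, x (k + 1) = x k + t k • y (k + 1)

namespace Orbit

variable (O : Orbit b ζ)

/-- The Lax matrix of the line coming in at the impact `k`. -/
def laxAt (k : ℕ) : Matrix (Fin 2) (Fin 2) ℝ[X] := lax b ζ (O.x k) (O.y k)

/-- The product of the transfer matrices of the first `k` steps. -/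
def prod (k : ℕ) : Matrix (Fin 2) (Fin 2) ℝ[X] := transfer O.t O.σ O.τ k

/-- The number of reflections at the first `k` impacts. -/
def count (k : ℕ) : ℕ := ∑ l ∈ Finset.range k, massDegree (O.τ l)

theorem prod_succ (k : ℕ) :
    O.prod (k + 1) = step (O.t k) (O.σ k) (O.τ k) * O.prod k := rfl

theorem step_mul_laxAt (k : ℕ) : step (O.t k) (O.σ k) (O.τ k) * O.laxAt k =
    O.laxAt (k + 1) * step (O.t k) (O.σ k) (O.τ k) := by
  rw [laxAt, laxAt, ← flight_mul_kick, Matrix.mul_assoc, kick_mul_lax (O.impact k),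
    ← Matrix.mul_assoc, flight_mul_lax, Matrix.mul_assoc, O.x_succ, O.y_succ]

theorem prod_mul_laxAt (k : ℕ) : O.prod k * O.laxAt 0 = O.laxAt k * O.prod k := by
  induction k with
  | zero => simp [prod, transfer]
  | succ k ih =>
    rw [prod_succ, Matrix.mul_assoc, ih, ← Matrix.mul_assoc, step_mul_laxAt, Matrix.mul_assoc]

theorem det_prod (k : ℕ) : (O.prod k).det = 1 := det_transfer _ _ _ k

theorem det_laxAt (k : ℕ) : (O.laxAt k).det = (O.laxAt 0).det := by
  have := congrArg Matrix.det (O.prod_mul_laxAt k)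
  rw [Matrix.det_mul, Matrix.det_mul, det_prod, one_mul, mul_one] at this
  exact this.symm

/-- Each coordinate of the orbit is itself a solution of the string equation, at the spectral
parameter `ζ i`. This is how closing of the orbit is read off from the transfer matrices. -/
theorem step_eval_mulVec (k : ℕ) (i : Fin 3) :
    (step (O.t k) (O.σ k) (O.τ k)).map (eval (ζ i)) *ᵥ ![O.x k i, O.y k i] =
      ![O.x (k + 1) i, O.y (k + 1) i] := by
  have h1 := congrFun (O.y_succ k) i
  have h2 := congrFun (O.x_succ k) i
  simp only [deflect, Pi.add_apply, Pi.smul_apply, smul_eq_mul] at h1 h2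
  ext j
  fin_cases j
  · simp [step, mass, Matrix.mulVec, dotProduct, Fin.sum_univ_two]
    rw [h2, h1]; ring
  · simp [step, mass, Matrix.mulVec, dotProduct, Fin.sum_univ_two]
    rw [h1]; ring

theorem prod_eval_mulVec (k : ℕ) (i : Fin 3) :
    (O.prod k).map (eval (ζ i)) *ᵥ ![O.x 0 i, O.y 0 i] = ![O.x k i, O.y k i] := by
  induction k with
  | zero =>
    have : (1 : Matrix (Fin 2) (Fin 2) ℝ[X]).map (eval (ζ i)) = 1 :=
      Matrix.map_one _ (by simp) (by simp)
    rw [prod, transfer, this, Matrix.one_mulVec]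
  | succ k ih =>
    have : (step (O.t k) (O.σ k) (O.τ k) * O.prod k).map (eval (ζ i)) =
        (step (O.t k) (O.σ k) (O.τ k)).map (eval (ζ i)) * (O.prod k).map (eval (ζ i)) :=
      Matrix.map_mul (f := evalRingHom (ζ i))
    rw [prod_succ, this, ← Matrix.mulVec_mulVec, ih, step_eval_mulVec]

end Orbit

end Lax

/-! ### Growth orders of matrix functions at infinity. -/

section Growth

/-- The entries of a matrix function are `O(z ^ k)` at infinity. -/
def MatrixIsBigO (A : ℝ → Matrix (Fin 2) (Fin 2) ℝ) (k : ℤ) : Prop :=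
  ∀ i j, (fun z => A z i j) =O[atTop] fun z : ℝ => z ^ k

variable {A B : ℝ → Matrix (Fin 2) (Fin 2) ℝ} {k l : ℤ}

theorem isBigO_zpow_mul_zpow {f g : ℝ → ℝ} (hf : f =O[atTop] fun z : ℝ => z ^ k)
    (hg : g =O[atTop] fun z : ℝ => z ^ l) :
    (fun z => f z * g z) =O[atTop] fun z : ℝ => z ^ (k + l) := by
  refine (hf.mul hg).trans_eventuallyEq ?_
  filter_upwards [eventually_ne_atTop 0] with z hz
  rw [zpow_add₀ hz]

theorem isBigO_zpow_of_le (h : k ≤ l) :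
    (fun z : ℝ => z ^ k) =O[atTop] fun z : ℝ => z ^ l := by
  refine IsBigO.of_bound 1 ?_
  filter_upwards [eventually_ge_atTop 1] with z hz
  have h0 : (0 : ℝ) < z := by linarith
  rw [one_mul, Real.norm_of_nonneg (zpow_pos h0 _).le, Real.norm_of_nonneg (zpow_pos h0 _).le]
  exact zpow_le_zpow_right₀ hz h

theorem isBigO_zpow_zero_of_tendsto {f : ℝ → ℝ} {c : ℝ} (h : Tendsto f atTop (𝓝 c)) :
    f =O[atTop] fun z : ℝ => z ^ (0 : ℤ) := by
  simpa using h.isBigO_one ℝ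

theorem MatrixIsBigO.mul (hA : MatrixIsBigO A k) (hB : MatrixIsBigO B l) :
    MatrixIsBigO (fun z => A z * B z) (k + l) := by
  intro i j
  simp only [Matrix.mul_apply, Fin.sum_univ_two]
  exact (isBigO_zpow_mul_zpow (hA i _) (hB _ j)).add (isBigO_zpow_mul_zpow (hA i _) (hB _ j))

theorem MatrixIsBigO.add (hA : MatrixIsBigO A k) (hB : MatrixIsBigO B k) :
    MatrixIsBigO (fun z => A z + B z) k := fun i j => (hA i j).add (hB i j)

theorem MatrixIsBigO.congr' (hA : MatrixIsBigO A k) (h : A =ᶠ[atTop] B) : MatrixIsBigO B k :=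
  fun i j => (hA i j).congr' (h.mono fun z hz => by simp only [hz]) EventuallyEq.rfl

theorem MatrixIsBigO.mono (hA : MatrixIsBigO A k) (h : k ≤ l) : MatrixIsBigO A l :=
  fun i j => (hA i j).trans (isBigO_zpow_of_le h)

theorem MatrixIsBigO.smul {f : ℝ → ℝ} (hf : f =O[atTop] fun z : ℝ => z ^ k)
    (hA : MatrixIsBigO A l) : MatrixIsBigO (fun z => f z • A z) (k + l) :=
  fun i j => by simpa using isBigO_zpow_mul_zpow hf (hA i j)

theorem matrixIsBigO_const (M : Matrix (Fin 2) (Fin 2) ℝ) : MatrixIsBigO (fun _ => M) 0 :=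
  fun _ _ => isBigO_zpow_zero_of_tendsto tendsto_const_nhds

/-- Reflection in a mass `m` of degree `d` damps the growing eigenline of the incoming Lax matrix
by the factor `z ^ (-d)`. -/
theorem kick_mul_projection_isBigO {l u w m ε : ℝ → ℝ} {d : ℤ}
    (hl : Tendsto l atTop (𝓝 (-1))) (hu : u =O[atTop] fun z : ℝ => z ^ (-d))
    (hw : w =O[atTop] fun z : ℝ => z ^ (0 : ℤ)) (hε : Tendsto ε atTop (𝓝 1))
    (hdet : ∀ᶠ z in atTop, ε z ^ 2 = l z ^ 2 + u z * w z)
    (hl' : Tendsto (fun z => l z + m z * u z) atTop (𝓝 1))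
    (hw' : (fun z => w z - 2 * m z * l z - m z ^ 2 * u z) =O[atTop] fun z : ℝ => z ^ (0 : ℤ)) :
    MatrixIsBigO (fun z => !![1, 0; -m z, 1] * !![ε z + l z, u z; w z, ε z - l z]) (-d) := by
  have h1 : Tendsto (fun z => ε z - l z) atTop (𝓝 2) := by
    convert hε.sub hl using 2; norm_num
  have h2 : Tendsto (fun z => ε z + (l z + m z * u z)) atTop (𝓝 2) := by
    convert hε.add hl' using 2; norm_num
  have n1 : ∀ᶠ z in atTop, ε z - l z ≠ 0 := h1.eventually_ne two_ne_zero
  have n2 : ∀ᶠ z in atTop, ε z + (l z + m z * u z) ≠ 0 := h2.eventually_ne two_ne_zero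
  have i1 := isBigO_zpow_zero_of_tendsto (h1.inv₀ two_ne_zero)
  have i2 := isBigO_zpow_zero_of_tendsto (h2.inv₀ two_ne_zero)
  -- The sum is `u w / (ε - l)`, with denominator tending to 2. The other diagonal entry is handled
  -- likewise with the reflected Lax entries, and the lower left entry equals the product of `ε - (l
  -- + m u)` and `w / (ε - l)`.
  have e00 : (fun z => ε z + l z) =O[atTop] fun z : ℝ => z ^ (-d) := by
    have := isBigO_zpow_mul_zpow (isBigO_zpow_mul_zpow hu hw) i1
    rw [add_zero, add_zero] at this
    refine this.congr' ?_ EventuallyEq.rfl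
    filter_upwards [n1, hdet] with z hz hd
    rw [← div_eq_mul_inv, div_eq_iff hz]
    linear_combination -hd
  have e11 : (fun z => ε z - (l z + m z * u z)) =O[atTop] fun z : ℝ => z ^ (-d) := by
    have := isBigO_zpow_mul_zpow (isBigO_zpow_mul_zpow hu hw') i2
    rw [add_zero, add_zero] at this
    refine this.congr' ?_ EventuallyEq.rfl
    filter_upwards [n2, hdet] with z hz hd
    rw [← div_eq_mul_inv, div_eq_iff hz]
    linear_combination -hd
  have e10 : (fun z => w z - m z * (ε z + l z)) =O[atTop] fun z : ℝ => z ^ (-d) := by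
    have := isBigO_zpow_mul_zpow (isBigO_zpow_mul_zpow e11 hw) i1
    rw [add_zero, add_zero] at this
    refine this.congr' ?_ EventuallyEq.rfl
    filter_upwards [n1, hdet] with z hz hd
    rw [← div_eq_mul_inv, div_eq_iff hz]
    linear_combination m z * hd
  intro i j
  rw [show (fun z => (!![1, 0; -m z, 1] * !![ε z + l z, u z; w z, ε z - l z]) i j) =
    fun z => !![ε z + l z, u z; w z - m z * (ε z + l z), ε z - (l z + m z * u z)] i j by
      funext z
      rw [Matrix.mul_fin_two]
      ring_nf]
  fin_cases i <;> fin_cases j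
  · exact e00
  · exact hu
  · exact e10
  · exact e11

end Growth

/-! ### Growth of the transfer matrices along the two eigenlines of the Lax matrix. -/

section Asymptotics

variable {b ζ : Fin 3 → ℝ}

theorem eventually_nodal_ne_zero (ζ : Fin 3 → ℝ) : ∀ᶠ z in atTop, eval z (nodal ζ) ≠ 0 := by
  filter_upwards [eventually_ne_atTop (ζ 0), eventually_ne_atTop (ζ 1),
    eventually_ne_atTop (ζ 2)] with z h0 h1 h2
  simp [nodal, sub_eq_zero, h0, h1, h2]

theorem tendsto_pencil_div (x y : Fin 3 → ℝ) :
    Tendsto (fun z => eval z (pencil b ζ x y) / eval z (nodal ζ)) atTop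
      (𝓝 (moment b ζ 0 x y)) := by
  have h : ∀ c : ℝ, Tendsto (fun z : ℝ => z / (z - c)) atTop (𝓝 1) := by
    intro c
    have h1 : Tendsto (fun z : ℝ => 1 + c * (z - c)⁻¹) atTop (𝓝 (1 + c * 0)) :=
      tendsto_const_nhds.add ((tendsto_inv_atTop_zero.comp
        (tendsto_atTop_add_const_right _ (-c) tendsto_id)).const_mul c)
    rw [mul_zero, add_zero] at h1
    refine h1.congr' ?_
    filter_upwards [eventually_ne_atTop c] with z hz
    have := sub_ne_zero.mpr hz
    field_simp
    ring
  have := (((h (ζ 0)).const_mul (b 0 * x 0 * y 0)).add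
    ((h (ζ 1)).const_mul (b 1 * x 1 * y 1))).add ((h (ζ 2)).const_mul (b 2 * x 2 * y 2))
  simp only [mul_one] at this
  simp only [moment, pow_zero, mul_one]
  refine this.congr' ?_
  filter_upwards [eventually_ne_atTop (ζ 0), eventually_ne_atTop (ζ 1),
    eventually_ne_atTop (ζ 2)] with z h0 h1 h2
  have h0 := sub_ne_zero.mpr h0
  have h1 := sub_ne_zero.mpr h1
  have h2 := sub_ne_zero.mpr h2
  simp [nodal, pencil]
  field_simp

/-- The quotient has the expansion `∑ j, moment j * z ^ (-j)` at infinity. At a tropic impact the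
first moment of `x` vanishes, so the upper right Lax entry decays to exactly the order needed by a
quadratic mass. -/
theorem pencil_div_sub_moment_isBigO (x y : Fin 3 → ℝ) :
    ((fun z => eval z (pencil b ζ x y) / eval z (nodal ζ) - moment b ζ 0 x y) =O[atTop]
      fun z : ℝ => z ^ (-1 : ℤ)) ∧ (moment b ζ 1 x y = 0 →
    (fun z => eval z (pencil b ζ x y) / eval z (nodal ζ) - moment b ζ 0 x y) =O[atTop]
      fun z : ℝ => z ^ (-2 : ℤ)) := by
  have key : ∀ x y : Fin 3 → ℝ,
      (fun z => eval z (pencil b ζ x y) / eval z (nodal ζ) - moment b ζ 0 x y) =ᶠ[atTop]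
      fun z => (eval z (pencil b ζ x (ζ * y)) / eval z (nodal ζ)) * z ^ (-1 : ℤ) := by
    intro x y
    filter_upwards [eventually_nodal_ne_zero ζ, eventually_ne_atTop 0] with z hz h0
    rw [pencil_mul_right]
    simp
    field_simp
  have hO : ∀ x y : Fin 3 → ℝ,
      (fun z => eval z (pencil b ζ x y) / eval z (nodal ζ) - moment b ζ 0 x y) =O[atTop]
      fun z : ℝ => z ^ (-1 : ℤ) := by
    intro x y
    refine IsBigO.congr' ?_ (key x y).symm EventuallyEq.rfl
    simpa using isBigO_zpow_mul_zpow (isBigO_zpow_zero_of_tendsto (tendsto_pencil_div x (ζ * y)))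
      (isBigO_refl (fun z : ℝ => z ^ (-1 : ℤ)) atTop)
  refine ⟨hO x y, fun h => ?_⟩
  refine IsBigO.congr' ?_ (key x y).symm EventuallyEq.rfl
  have h2 := hO x (ζ * y)
  rw [moment_mul_right, zero_add, h] at h2
  simp only [sub_zero] at h2
  exact isBigO_zpow_mul_zpow h2 (isBigO_refl (fun z : ℝ => z ^ (-1 : ℤ)) atTop)

theorem eval_mass_isBigO (σ τ : ℝ) :
    (fun z => eval z (mass σ τ)) =O[atTop] fun z : ℝ => z ^ (massDegree τ : ℤ) := by
  have h : (mass σ τ).degree ≤ (X ^ massDegree τ : ℝ[X]).degree := by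
    rw [degree_X_pow]
    exact degree_le_of_natDegree_le (natDegree_mass_le σ τ)
  simpa using isBigO_atTop_of_degree_le _ _ h

theorem moment_deflect {x y : Fin 3 → ℝ} {σ τ : ℝ} (h : IsImpact b ζ x y σ τ) :
    moment b ζ 0 x (deflect ζ σ τ x y) = -1 := by
  have h1 : moment b ζ 0 x (deflect ζ σ τ x y) =
      moment b ζ 0 x y - σ * moment b ζ 1 x x - τ * moment b ζ 2 x x := by
    simp only [moment, deflect]; ring
  rw [h1, h.dir]
  rcases h.law with ⟨h2, h3⟩ | ⟨h2, -, h3, -⟩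
  · rw [h3, h2]; norm_num
  · rw [h3, h2]; norm_num

/-- The Lax matrix divided by `nodal`, as a function of a real spectral parameter. -/
def laxFun (b ζ x y : Fin 3 → ℝ) (z : ℝ) : Matrix (Fin 2) (Fin 2) ℝ :=
  (eval z (nodal ζ))⁻¹ • (lax b ζ x y).map (eval z)

/-- A square root of minus the determinant of the normalised Lax matrix. -/
def laxRoot (b ζ x y : Fin 3 → ℝ) (z : ℝ) : ℝ := √(-(laxFun b ζ x y z).det)

theorem laxFun_eventuallyEq (x y : Fin 3 → ℝ) : laxFun b ζ x y =ᶠ[atTop] fun z =>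
    !![-(eval z (pencil b ζ x y) / eval z (nodal ζ)),
        eval z (pencil b ζ x x) / eval z (nodal ζ) - 1;
      -(eval z (pencil b ζ y y) / eval z (nodal ζ)),
        eval z (pencil b ζ x y) / eval z (nodal ζ)] := by
  filter_upwards [eventually_nodal_ne_zero ζ] with z hz
  ext i j
  fin_cases i <;> fin_cases j <;> simp [laxFun, lax] <;> field_simp

theorem tendsto_det_laxFun {x y : Fin 3 → ℝ} (hx : moment b ζ 0 x x = 1)
    (hy : moment b ζ 0 x y = 1) :
    Tendsto (fun z => -(laxFun b ζ x y z).det) atTop (𝓝 1) := by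
  have h := ((tendsto_pencil_div (b := b) (ζ := ζ) x y).pow 2).add
    (((tendsto_pencil_div (b := b) (ζ := ζ) x x).sub_const 1).mul
      (tendsto_pencil_div (b := b) (ζ := ζ) y y).neg)
  rw [hx, hy] at h
  simp only [one_pow, sub_self, zero_mul, add_zero] at h
  refine h.congr' ?_
  filter_upwards [laxFun_eventuallyEq (b := b) (ζ := ζ) x y] with z hz
  rw [hz, Matrix.det_fin_two_of]
  ring

theorem tendsto_laxRoot {x y : Fin 3 → ℝ} (hx : moment b ζ 0 x x = 1)
    (hy : moment b ζ 0 x y = 1) : Tendsto (laxRoot b ζ x y) atTop (𝓝 1) := by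
  have := (tendsto_det_laxFun hx hy).sqrt
  rwa [Real.sqrt_one] at this

theorem laxRoot_sq {x y : Fin 3 → ℝ} (hx : moment b ζ 0 x x = 1)
    (hy : moment b ζ 0 x y = 1) :
    ∀ᶠ z in atTop, laxRoot b ζ x y z ^ 2 = -(laxFun b ζ x y z).det := by
  filter_upwards [(tendsto_det_laxFun hx hy).eventually (lt_mem_nhds one_pos)] with z hz
  exact Real.sq_sqrt hz.le

theorem laxFun_mul_self (b ζ x y : Fin 3 → ℝ) (z : ℝ) :
    laxFun b ζ x y z * laxFun b ζ x y z = (-(laxFun b ζ x y z).det) • 1 := by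
  have h : laxFun b ζ x y z 1 1 = -laxFun b ζ x y z 0 0 := by
    simp [laxFun, lax]
  rw [Matrix.det_fin_two, h]
  ext i j
  fin_cases i <;> fin_cases j <;> simp [Matrix.mul_apply, Fin.sum_univ_two, h] <;> ring

theorem laxFun_isBigO (x y : Fin 3 → ℝ) : MatrixIsBigO (laxFun b ζ x y) 0 := by
  refine MatrixIsBigO.congr' ?_ (laxFun_eventuallyEq x y).symm
  intro i j
  have h := fun x y => isBigO_zpow_zero_of_tendsto (tendsto_pencil_div (b := b) (ζ := ζ) x y)
  fin_cases i <;> fin_cases j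
  · exact (h x y).neg_left
  · exact isBigO_zpow_zero_of_tendsto ((tendsto_pencil_div x x).sub_const 1)
  · exact (h y y).neg_left
  · exact h x y

theorem kick_isBigO (σ τ : ℝ) :
    MatrixIsBigO (fun z => (kick σ τ).map (eval z)) (massDegree τ) := by
  have h1 : (fun _ : ℝ => (1 : ℝ)) =O[atTop] fun z : ℝ => z ^ (massDegree τ : ℤ) :=
    (isBigO_zpow_zero_of_tendsto tendsto_const_nhds).trans (isBigO_zpow_of_le (by positivity))
  intro i j
  fin_cases i <;> fin_cases j <;> simp only [kick] <;> simp
  · simpa using h1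
  · simpa using isBigO_zero _ _
  · simpa using eval_mass_isBigO σ τ
  · simpa using h1

theorem kick_mul_laxFun_isBigO {x y : Fin 3 → ℝ} {σ τ : ℝ} (h : IsImpact b ζ x y σ τ) :
    MatrixIsBigO (fun z => (kick σ τ).map (eval z) *
      (laxRoot b ζ x y z • 1 + laxFun b ζ x y z)) (-massDegree τ) := by
  have hE := laxFun_eventuallyEq (b := b) (ζ := ζ) x y
  have hu : (fun z => eval z (pencil b ζ x x) / eval z (nodal ζ) - 1) =O[atTop]
      fun z : ℝ => z ^ (-(massDegree τ : ℤ)) := by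
    have h2 := pencil_div_sub_moment_isBigO (b := b) (ζ := ζ) x x
    rw [h.on] at h2
    unfold massDegree
    rcases h.law with h3 | h3
    · simpa [h3.1] using h2.1
    · simpa [h3.2.1.ne'] using h2.2 h3.1
  have hm : ∀ᶠ z in atTop, -(eval z (pencil b ζ x y) / eval z (nodal ζ)) +
      eval z (mass σ τ) * (eval z (pencil b ζ x x) / eval z (nodal ζ) - 1) =
      -(eval z (pencil b ζ x (deflect ζ σ τ x y)) / eval z (nodal ζ)) := by
    filter_upwards [eventually_nodal_ne_zero ζ] with z hz
    rw [pencil_deflect h]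
    simp
    field_simp
    ring
  have hm' : ∀ᶠ z in atTop, -(eval z (pencil b ζ y y) / eval z (nodal ζ)) -
      2 * eval z (mass σ τ) * -(eval z (pencil b ζ x y) / eval z (nodal ζ)) -
      eval z (mass σ τ) ^ 2 * (eval z (pencil b ζ x x) / eval z (nodal ζ) - 1) =
      -(eval z (pencil b ζ (deflect ζ σ τ x y) (deflect ζ σ τ x y)) / eval z (nodal ζ)) := by
    filter_upwards [eventually_nodal_ne_zero ζ] with z hz
    rw [pencil_deflect_deflect h]
    simp
    field_simp
    ring
  have hl := (tendsto_pencil_div (b := b) (ζ := ζ) x y).neg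
  rw [h.dir] at hl
  have hl' := (tendsto_pencil_div (b := b) (ζ := ζ) x (deflect ζ σ τ x y)).neg
  rw [moment_deflect h, neg_neg] at hl'
  refine MatrixIsBigO.congr' (kick_mul_projection_isBigO (ε := laxRoot b ζ x y)
    (m := fun z => eval z (mass σ τ)) hl hu
    (isBigO_zpow_zero_of_tendsto (tendsto_pencil_div y y).neg)
    (tendsto_laxRoot h.on h.dir) ?_ (hl'.congr' (hm.mono fun z hz => hz.symm))
    ((isBigO_zpow_zero_of_tendsto (tendsto_pencil_div _ _).neg).congr'
      (hm'.mono fun z hz => hz.symm) EventuallyEq.rfl)) ?_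
  · filter_upwards [hE, laxRoot_sq h.on h.dir] with z hz hr
    rw [hr, hz, Matrix.det_fin_two_of]
    ring
  · filter_upwards [hE] with z hz
    rw [hz]
    congr 1
    · ext i j
      fin_cases i <;> fin_cases j <;> simp [kick]
    · ext i j
      fin_cases i <;> fin_cases j <;> simp [sub_eq_add_neg]

theorem map_eval_mul (A B : Matrix (Fin 2) (Fin 2) ℝ[X]) (z : ℝ) :
    (A * B).map (eval z) = A.map (eval z) * B.map (eval z) :=
  Matrix.map_mul (f := evalRingHom z)

/-- Since `ε + L` is `2 ε` times a projector and passes through `P`, it can be duplicated: the decay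
of each single step then multiplies along the product. -/
theorem mul_projection_mul_projection (A : Matrix (Fin 2) (Fin 2) ℝ)
    {P L L' : Matrix (Fin 2) (Fin 2) ℝ} {ε : ℝ} (h : P * L = L' * P) (hL : L * L = ε ^ 2 • 1) :
    A * (ε • 1 + L') * (P * (ε • 1 + L)) = (2 * ε) • (A * P * (ε • 1 + L)) := by
  have e3 : (ε • 1 + L) * (ε • 1 + L) = (2 * ε) • (ε • 1 + L) := by
    rw [add_mul, mul_add, mul_add, hL, smul_one_mul, smul_one_mul, mul_smul_one]
    module
  have e4 : (ε • 1 + L') * P = P * (ε • 1 + L) := by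
    rw [add_mul, mul_add, h, smul_one_mul, mul_smul_one]
  rw [Matrix.mul_assoc, ← Matrix.mul_assoc _ P, e4, Matrix.mul_assoc P, e3, Matrix.mul_smul,
    Matrix.mul_smul, Matrix.mul_assoc]

namespace Orbit

variable (O : Orbit b ζ)

theorem det_laxFun (k : ℕ) (z : ℝ) :
    (laxFun b ζ (O.x k) (O.y k) z).det = (laxFun b ζ (O.x 0) (O.y 0) z).det := by
  have := O.det_laxAt k
  simp only [laxFun, Matrix.det_smul, det_map_eval]
  rw [← laxAt, ← laxAt, this]

theorem laxRoot_eq (k : ℕ) (z : ℝ) :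
    laxRoot b ζ (O.x k) (O.y k) z = laxRoot b ζ (O.x 0) (O.y 0) z := by
  rw [laxRoot, laxRoot, det_laxFun]

theorem prod_mul_laxFun (k : ℕ) (z : ℝ) :
    (O.prod k).map (eval z) * laxFun b ζ (O.x 0) (O.y 0) z =
      laxFun b ζ (O.x k) (O.y k) z * (O.prod k).map (eval z) := by
  rw [laxFun, laxFun, Matrix.mul_smul, Matrix.smul_mul, ← map_eval_mul, ← map_eval_mul,
    ← laxAt, ← laxAt, prod_mul_laxAt]

theorem step_mul_laxFun_isBigO (k : ℕ) :
    MatrixIsBigO (fun z => (step (O.t k) (O.σ k) (O.τ k)).map (eval z) *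
      (laxRoot b ζ (O.x 0) (O.y 0) z • 1 + laxFun b ζ (O.x k) (O.y k) z))
      (-massDegree (O.τ k)) := by
  have hf : MatrixIsBigO (fun z => (flight (O.t k)).map (eval z)) 0 := by
    refine (matrixIsBigO_const !![1, O.t k; 0, 1]).congr' (Eventually.of_forall fun z => ?_)
    ext i j
    fin_cases i <;> fin_cases j <;> simp [flight]
  have := hf.mul (kick_mul_laxFun_isBigO (O.impact k))
  rw [zero_add] at this
  refine this.congr' (Eventually.of_forall fun z => ?_)
  simp only [← flight_mul_kick, map_eval_mul, laxRoot_eq, Matrix.mul_assoc]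

theorem step_isBigO (k : ℕ) :
    MatrixIsBigO (fun z => (step (O.t k) (O.σ k) (O.τ k)).map (eval z)) (massDegree (O.τ k)) := by
  have hf : MatrixIsBigO (fun z => (flight (O.t k)).map (eval z)) 0 := by
    refine (matrixIsBigO_const !![1, O.t k; 0, 1]).congr' (Eventually.of_forall fun z => ?_)
    ext i j
    fin_cases i <;> fin_cases j <;> simp [flight]
  have := hf.mul (kick_isBigO (O.σ k) (O.τ k))
  rw [zero_add] at this
  refine this.congr' (Eventually.of_forall fun z => ?_)
  simp only [← flight_mul_kick, map_eval_mul]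

theorem count_succ (k : ℕ) : O.count (k + 1) = massDegree (O.τ k) + O.count k := by
  rw [count, Finset.sum_range_succ, add_comm, count]

theorem tendsto_laxRoot : Tendsto (laxRoot b ζ (O.x 0) (O.y 0)) atTop (𝓝 1) :=
  MinkowskiBilliard.tendsto_laxRoot (O.impact 0).on (O.impact 0).dir

theorem prod_mul_sub_isBigO (k : ℕ) :
    MatrixIsBigO (fun z => (O.prod k).map (eval z) *
      (laxRoot b ζ (O.x 0) (O.y 0) z • 1 - laxFun b ζ (O.x 0) (O.y 0) z)) (O.count k) := by
  induction k with
  | zero =>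
    have h1 := (MatrixIsBigO.smul (isBigO_zpow_zero_of_tendsto O.tendsto_laxRoot)
      (matrixIsBigO_const 1)).add (MatrixIsBigO.smul (isBigO_zpow_zero_of_tendsto
        (tendsto_const_nhds (x := (-1 : ℝ)))) (laxFun_isBigO (b := b) (ζ := ζ) (O.x 0) (O.y 0)))
    refine MatrixIsBigO.congr' h1 (Eventually.of_forall fun z => ?_)
    have : (1 : Matrix (Fin 2) (Fin 2) ℝ[X]).map (eval z) = 1 :=
      Matrix.map_one _ (by simp) (by simp)
    simp [prod, transfer, this, sub_eq_add_neg]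
  | succ k ih =>
    have := (O.step_isBigO k).mul ih
    rw [count_succ, Nat.cast_add]
    refine this.congr' (Eventually.of_forall fun z => ?_)
    simp only [prod_succ, map_eval_mul, Matrix.mul_assoc]

/-- On this eigenline every impact damps by its full degree. On the opposite one,
`prod_mul_sub_isBigO`, the crude bound by the total degree suffices. -/
theorem prod_mul_add_isBigO (k : ℕ) :
    MatrixIsBigO (fun z => (O.prod k).map (eval z) *
      (laxRoot b ζ (O.x 0) (O.y 0) z • 1 + laxFun b ζ (O.x 0) (O.y 0) z)) (-O.count k) := by
  induction k with
  | zero =>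
    have h1 := (MatrixIsBigO.smul (isBigO_zpow_zero_of_tendsto O.tendsto_laxRoot)
      (matrixIsBigO_const 1)).add (laxFun_isBigO (b := b) (ζ := ζ) (O.x 0) (O.y 0))
    refine MatrixIsBigO.congr' h1 (Eventually.of_forall fun z => ?_)
    have : (1 : Matrix (Fin 2) (Fin 2) ℝ[X]).map (eval z) = 1 :=
      Matrix.map_one _ (by simp) (by simp)
    simp [prod, transfer, this]
  | succ k ih =>
    have h2 : Tendsto (fun z => (2 * laxRoot b ζ (O.x 0) (O.y 0) z)⁻¹) atTop (𝓝 (2 * 1)⁻¹) :=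
      (O.tendsto_laxRoot.const_mul 2).inv₀ (by norm_num)
    have := MatrixIsBigO.smul (isBigO_zpow_zero_of_tendsto h2)
      ((O.step_mul_laxFun_isBigO k).mul ih)
    rw [zero_add] at this
    rw [count_succ, Nat.cast_add, neg_add]
    refine this.congr' ?_
    filter_upwards [O.tendsto_laxRoot.eventually_ne one_ne_zero,
      laxRoot_sq (O.impact 0).on (O.impact 0).dir] with z hz hsq
    rw [inv_smul_eq_iff₀ (mul_ne_zero two_ne_zero hz)]
    have e2 := laxFun_mul_self b ζ (O.x 0) (O.y 0) z
    rw [← hsq] at e2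
    rw [prod_succ, map_eval_mul]
    exact mul_projection_mul_projection _ (O.prod_mul_laxFun k z) e2

end Orbit

end Asymptotics

/-! ### Matrices commuting with a primitive traceless matrix. -/

section Commutant

/-- An irreducible common factor would divide `l² + u w`, hence a split polynomial; so it would be
linear and give a common root in `s`. -/
theorem exists_combination_eq_one {l u w : ℝ[X]} {s : Multiset ℝ}
    (hs : l ^ 2 + u * w ∣ (s.map fun r => X - C r).prod)
    (h : ∀ r ∈ s, ¬ (eval r l = 0 ∧ eval r u = 0 ∧ eval r w = 0)) :
    ∃ α β γ : ℝ[X], α * l + β * u + γ * w = 1 := by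
  classical
  set d := EuclideanDomain.gcd l (EuclideanDomain.gcd u w) with hd
  have hdl : d ∣ l := EuclideanDomain.gcd_dvd_left _ _
  have hdu : d ∣ u := (EuclideanDomain.gcd_dvd_right _ _).trans (EuclideanDomain.gcd_dvd_left _ _)
  have hdw : d ∣ w := (EuclideanDomain.gcd_dvd_right _ _).trans (EuclideanDomain.gcd_dvd_right _ _)
  have hunit : IsUnit d := by
    by_contra hu
    have hd0 : d ≠ 0 := by
      intro h0
      have hl0 : l = 0 := by rwa [h0, zero_dvd_iff] at hdl
      have hu0 : u = 0 := by rwa [h0, zero_dvd_iff] at hdu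
      rw [hl0, hu0] at hs
      simp only [ne_eq, OfNat.ofNat_ne_zero, not_false_eq_true, zero_pow, zero_mul, add_zero,
        zero_dvd_iff] at hs
      exact (monic_multiset_prod_of_monic s _ fun r _ => monic_X_sub_C r).ne_zero hs
    obtain ⟨f, hf, hfd⟩ := WfDvdMonoid.exists_irreducible_factor hu hd0
    have hfs : f ∣ (s.map fun r => X - C r).prod := by
      refine dvd_trans (dvd_add ?_ ?_) hs
      · exact (hfd.trans hdl).trans (dvd_pow_self _ two_ne_zero)
      · exact (hfd.trans hdu).mul_right _
    obtain ⟨r, hr, hfr⟩ := hf.prime.exists_mem_multiset_map_dvd hfs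
    have hrd : X - C r ∣ d := (hf.dvd_symm (irreducible_X_sub_C r) hfr).trans hfd
    exact h r hr ⟨dvd_iff_isRoot.mp (hrd.trans hdl), dvd_iff_isRoot.mp (hrd.trans hdu),
      dvd_iff_isRoot.mp (hrd.trans hdw)⟩
  obtain ⟨v, hv⟩ := hunit.exists_right_inv
  have h1 := EuclideanDomain.gcd_eq_gcd_ab l (EuclideanDomain.gcd u w)
  have h2 := EuclideanDomain.gcd_eq_gcd_ab u w
  rw [← hd] at h1
  set g := EuclideanDomain.gcd u w
  refine ⟨EuclideanDomain.gcdA l g * v,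
    EuclideanDomain.gcdB l g * EuclideanDomain.gcdA u w * v,
    EuclideanDomain.gcdB l g * EuclideanDomain.gcdB u w * v, ?_⟩
  rw [← hv]
  linear_combination -v * h1 - EuclideanDomain.gcdB l g * v * h2

/-- A matrix commuting with a primitive traceless matrix is a polynomial in it. -/
theorem exists_eq_add_smul {l u w α β γ : ℝ[X]} (h : α * l + β * u + γ * w = 1)
    {P : Matrix (Fin 2) (Fin 2) ℝ[X]} (hP : P * !![l, u; w, -l] = !![l, u; w, -l] * P) :
    ∃ p q : ℝ[X], P = p • 1 + q • !![l, u; w, -l] := by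
  have h00 := congrFun (congrFun hP 0) 0
  have h01 := congrFun (congrFun hP 0) 1
  have h10 := congrFun (congrFun hP 1) 0
  simp [Matrix.mul_apply, Fin.sum_univ_two] at h00 h01 h10
  have half : (C (1 / 2) : ℝ[X]) * 2 = 1 := by
    rw [show (2 : ℝ[X]) = C 2 from rfl, ← C_mul]; norm_num
  set c : ℝ[X] := C (1 / 2)
  set A' := c * (P 0 0 - P 1 1) with hA'
  have e1 : u * A' = l * P 0 1 := by
    rw [hA']; linear_combination c * h01 + l * P 0 1 * half
  have e2 : w * A' = l * P 1 0 := by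
    rw [hA']; linear_combination -c * h10 + l * P 1 0 * half
  have e3 : P 0 1 * w = u * P 1 0 := by linear_combination h00
  -- Commuting makes the traceless part of `P` proportional to `(l, u, w)`; pairing it with the
  -- Bézout coefficients extracts the factor without division.
  refine ⟨c * (P 0 0 + P 1 1), α * A' + β * P 0 1 + γ * P 1 0, ?_⟩
  refine Matrix.ext fun i j => ?_
  fin_cases i <;> fin_cases j <;> simp
  · linear_combination (-A') * h - P 0 0 * half + β * e1 + γ * e2
  · linear_combination (-P 0 1) * h - α * e1 + γ * e3
  · linear_combination (-P 1 0) * h - α * e2 - β * e3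
  · linear_combination (A') * h - P 1 1 * half - β * e1 - γ * e2

end Commutant

/-! ### The content of the Lax matrix and its values at the nodes. -/

section Caustics

variable {b ζ : Fin 3 → ℝ} {g₁ g₂ : ℝ} {x y : Fin 3 → ℝ}

/-- Admissible parameters of a confocal family and a pair of caustics. -/
structure IsAdmissible (b ζ : Fin 3 → ℝ) (g₁ g₂ : ℝ) : Prop where
  pos : ∀ i, 0 < b i
  ne_zero : ∀ i, ζ i ≠ 0
  inj : Function.Injective ζ
  ne₁ : ∀ i, ζ i ≠ g₁
  ne₂ : ∀ i, ζ i ≠ g₂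
  double : g₁ = g₂ → g₁ ≠ 0

/-- The line through `x` with direction `y` has the given pair of caustics. -/
structure IsCausticLine (b ζ : Fin 3 → ℝ) (g₁ g₂ : ℝ) (x y : Fin 3 → ℝ) : Prop where
  det : -(lax b ζ x y).det = X * ((X - C g₁) * (X - C g₂)) * nodal ζ
  double : g₁ = g₂ → ∀ i j, X - C g₁ ∣ lax b ζ x y i j

/-- The common divisor of the Lax matrices, nontrivial for a double caustic. -/
def laxContent (g₁ g₂ : ℝ) : ℝ[X] := if g₁ = g₂ then X - C g₁ else 1

theorem laxContent_ne_zero (g₁ g₂ : ℝ) : laxContent g₁ g₂ ≠ 0 := by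
  unfold laxContent; split_ifs
  · exact X_sub_C_ne_zero g₁
  · exact one_ne_zero

/-- The determinant is quadratic in the entries, so it vanishes to second order where they all
vanish. Consequently the Lax matrix is nonzero at simple roots of its determinant. -/
theorem eval_derivative_eq_zero {r : ℝ} (h : (lax b ζ x y).map (eval r) = 0) :
    eval r (derivative (-(lax b ζ x y).det)) = 0 := by
  have h' : ∀ i j, eval r (lax b ζ x y i j) = 0 := fun i j => congrFun (congrFun h i) j
  rw [Matrix.det_fin_two]
  simp [h']

theorem lax_eval_ne_zero_of_simple (h : IsCausticLine b ζ g₁ g₂ x y) {r : ℝ} {G : ℝ[X]}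
    (hG : X * ((X - C g₁) * (X - C g₂)) * nodal ζ = (X - C r) * G) (hr : eval r G ≠ 0) :
    (lax b ζ x y).map (eval r) ≠ 0 := by
  intro h0
  have := eval_derivative_eq_zero h0
  rw [h.det, hG] at this
  simp at this
  exact hr this

theorem lax_eval_node_ne_zero (hA : IsAdmissible b ζ g₁ g₂) (h : IsCausticLine b ζ g₁ g₂ x y)
    (i : Fin 3) : (lax b ζ x y).map (eval (ζ i)) ≠ 0 := by
  have h01 : ζ 0 - ζ 1 ≠ 0 := sub_ne_zero.mpr (hA.inj.ne (by decide))
  have h02 : ζ 0 - ζ 2 ≠ 0 := sub_ne_zero.mpr (hA.inj.ne (by decide))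
  have h12 : ζ 1 - ζ 2 ≠ 0 := sub_ne_zero.mpr (hA.inj.ne (by decide))
  have h10 : ζ 1 - ζ 0 ≠ 0 := sub_ne_zero.mpr (hA.inj.ne (by decide))
  have h20 : ζ 2 - ζ 0 ≠ 0 := sub_ne_zero.mpr (hA.inj.ne (by decide))
  have h21 : ζ 2 - ζ 1 ≠ 0 := sub_ne_zero.mpr (hA.inj.ne (by decide))
  have hz := hA.ne_zero i
  have h1 := sub_ne_zero.mpr (hA.ne₁ i)
  have h2 := sub_ne_zero.mpr (hA.ne₂ i)
  fin_cases i
  · refine lax_eval_ne_zero_of_simple (r := ζ 0) h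
      (G := X * ((X - C g₁) * (X - C g₂)) * ((X - C (ζ 1)) * (X - C (ζ 2))))
      (by rw [nodal]; ring) ?_
    simp only [eval_mul, eval_sub, eval_X, eval_C]
    exact mul_ne_zero (mul_ne_zero hz (mul_ne_zero h1 h2)) (mul_ne_zero h01 h02)
  · refine lax_eval_ne_zero_of_simple (r := ζ 1) h
      (G := X * ((X - C g₁) * (X - C g₂)) * ((X - C (ζ 0)) * (X - C (ζ 2))))
      (by rw [nodal]; ring) ?_
    simp only [eval_mul, eval_sub, eval_X, eval_C]
    exact mul_ne_zero (mul_ne_zero hz (mul_ne_zero h1 h2)) (mul_ne_zero h10 h12)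
  · refine lax_eval_ne_zero_of_simple (r := ζ 2) h
      (G := X * ((X - C g₁) * (X - C g₂)) * ((X - C (ζ 0)) * (X - C (ζ 1))))
      (by rw [nodal]; ring) ?_
    simp only [eval_mul, eval_sub, eval_X, eval_C]
    exact mul_ne_zero (mul_ne_zero hz (mul_ne_zero h1 h2)) (mul_ne_zero h20 h21)

theorem lax_eval_zero (x y : Fin 3 → ℝ) :
    (lax b ζ x y).map (eval 0) = !![0, ζ 0 * ζ 1 * ζ 2; 0, 0] := by
  ext i j
  fin_cases i <;> fin_cases j <;> simp [lax, pencil, nodal]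

theorem nodal_eval_node (i : Fin 3) : eval (ζ i) (nodal ζ) = 0 := by
  fin_cases i <;> simp [nodal]

theorem pencil_eval_node (i : Fin 3) : ∃ c : ℝ, ∀ x y : Fin 3 → ℝ,
    eval (ζ i) (pencil b ζ x y) = c * (x i * y i) := by
  fin_cases i
  · exact ⟨b 0 * ζ 0 * ((ζ 0 - ζ 1) * (ζ 0 - ζ 2)), fun x y => by simp [pencil]; ring⟩
  · exact ⟨b 1 * ζ 1 * ((ζ 1 - ζ 0) * (ζ 1 - ζ 2)), fun x y => by simp [pencil]; ring⟩
  · exact ⟨b 2 * ζ 2 * ((ζ 2 - ζ 0) * (ζ 2 - ζ 1)), fun x y => by simp [pencil]; ring⟩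

/-- At a node only the `i`-th term of the pencil survives, so the Lax matrix has rank at most one
there. -/
theorem lax_eval_node_mulVec (x y : Fin 3 → ℝ) (i : Fin 3) :
    (lax b ζ x y).map (eval (ζ i)) *ᵥ ![x i, y i] = 0 := by
  obtain ⟨c, hc⟩ := pencil_eval_node (b := b) (ζ := ζ) i
  ext j
  fin_cases j <;>
    simp [lax, Matrix.mulVec, dotProduct, Fin.sum_univ_two, hc, nodal_eval_node] <;> ring

theorem coord_ne_zero (hA : IsAdmissible b ζ g₁ g₂) (h : IsCausticLine b ζ g₁ g₂ x y)
    (i : Fin 3) : ![x i, y i] ≠ 0 := by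
  intro h0
  apply lax_eval_node_ne_zero hA h i
  have hx : x i = 0 := congrFun h0 0
  have hy : y i = 0 := congrFun h0 1
  obtain ⟨c, hc⟩ := pencil_eval_node (b := b) (ζ := ζ) i
  ext j k
  fin_cases j <;> fin_cases k <;> simp [lax, hc, hx, hy, nodal_eval_node]

/-- The Lax matrix of a line with given caustics, divided by its content, is primitive. -/
theorem exists_primitive_lax (hA : IsAdmissible b ζ g₁ g₂) (h : IsCausticLine b ζ g₁ g₂ x y) :
    ∃ l u w : ℝ[X], lax b ζ x y = laxContent g₁ g₂ • !![l, u; w, -l] ∧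
      laxContent g₁ g₂ ^ 2 * (l ^ 2 + u * w) = X * ((X - C g₁) * (X - C g₂)) * nodal ζ ∧
      ∃ α β γ : ℝ[X], α * l + β * u + γ * w = 1 := by
  have hdiv : ∀ i j, laxContent g₁ g₂ ∣ lax b ζ x y i j := by
    intro i j
    unfold laxContent
    split_ifs with hg
    · exact h.double hg i j
    · exact one_dvd _
  obtain ⟨l, hl⟩ := hdiv 0 0
  obtain ⟨u, hu⟩ := hdiv 0 1
  obtain ⟨w, hw⟩ := hdiv 1 0
  have hL : lax b ζ x y = laxContent g₁ g₂ • !![l, u; w, -l] := by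
    refine Matrix.ext fun i j => ?_
    fin_cases i <;> fin_cases j
    · simpa using hl
    · simpa using hu
    · simpa using hw
    · have : lax b ζ x y 1 1 = -lax b ζ x y 0 0 := by simp [lax]
      simp [this, hl]
  have hdet : laxContent g₁ g₂ ^ 2 * (l ^ 2 + u * w) =
      X * ((X - C g₁) * (X - C g₂)) * nodal ζ := by
    rw [← h.det, hL, Matrix.det_smul, Matrix.det_fin_two_of, Fintype.card_fin]
    ring
  refine ⟨l, u, w, hL, hdet, ?_⟩
  have hcommon : ∀ r, eval r l = 0 ∧ eval r u = 0 ∧ eval r w = 0 →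
      (lax b ζ x y).map (eval r) = 0 := by
    rintro r ⟨h1, h2, h3⟩
    rw [hL]
    ext i j
    fin_cases i <;> fin_cases j <;> simp [h1, h2, h3]
  have h0 : (lax b ζ x y).map (eval 0) ≠ 0 := by
    intro h0
    have := congrFun (congrFun h0 0) 1
    rw [lax_eval_zero] at this
    simp [hA.ne_zero] at this
  have hnodes := lax_eval_node_ne_zero hA h
  by_cases hg : g₁ = g₂
  · have hd : l ^ 2 + u * w = X * nodal ζ := by
      have h2 : (X - C g₁ : ℝ[X]) ^ 2 ≠ 0 := pow_ne_zero 2 (X_sub_C_ne_zero g₁)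
      rw [laxContent, if_pos hg, ← hg] at hdet
      refine mul_left_cancel₀ h2 ?_
      linear_combination hdet
    refine exists_combination_eq_one (s := {0, ζ 0, ζ 1, ζ 2}) ?_ ?_
    · rw [hd]
      simp [nodal, mul_assoc]
    · intro r hr hc
      simp at hr
      rcases hr with rfl | rfl | rfl | rfl
      · exact h0 (hcommon _ hc)
      · exact hnodes 0 (hcommon _ hc)
      · exact hnodes 1 (hcommon _ hc)
      · exact hnodes 2 (hcommon _ hc)
  · have hd : l ^ 2 + u * w = X * ((X - C g₁) * (X - C g₂)) * nodal ζ := by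
      rwa [laxContent, if_neg hg, one_pow, one_mul] at hdet
    refine exists_combination_eq_one (s := {0, ζ 0, ζ 1, ζ 2, g₁, g₂}) ?_ ?_
    · rw [hd]
      refine dvd_of_eq ?_
      simp [nodal]
      ring
    · intro r hr hc
      have hr0 : r ≠ 0 := fun hr0 => h0 (hr0 ▸ hcommon _ hc)
      have hi : ∀ i, r ≠ ζ i := fun i hri => hnodes i (hri ▸ hcommon _ hc)
      have hn : eval r (nodal ζ) ≠ 0 := by
        simp [nodal, sub_eq_zero, hi]
      simp [hr0, hi] at hr
      rcases hr with rfl | rfl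
      · refine lax_eval_ne_zero_of_simple h (G := X * (X - C g₂) * nodal ζ) (by ring) ?_
          (hcommon _ hc)
        simp only [eval_mul, eval_sub, eval_X, eval_C]
        exact mul_ne_zero (mul_ne_zero hr0 (sub_ne_zero.mpr hg)) hn
      · refine lax_eval_ne_zero_of_simple h (G := X * (X - C g₁) * nodal ζ) (by ring) ?_
          (hcommon _ hc)
        simp only [eval_mul, eval_sub, eval_X, eval_C]
        exact mul_ne_zero (mul_ne_zero hr0 (sub_ne_zero.mpr (Ne.symm hg))) hn

theorem laxContent_eval_ne_zero {r : ℝ} (h : r ≠ g₁) : eval r (laxContent g₁ g₂) ≠ 0 := by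
  unfold laxContent; split_ifs
  · simpa [sub_eq_zero] using h
  · simp

end Caustics

/-! ### Comparing the monodromy of one orbit with the transfer matrices of another. -/

theorem natDegree_le_of_isBigO {P : ℝ[X]} {j : ℕ}
    (h : (fun z => eval z P) =O[atTop] fun z : ℝ => z ^ (j : ℤ)) : P.natDegree ≤ j := by
  by_contra hlt
  rw [not_le] at hlt
  have hP : P ≠ 0 := fun h0 => by simp [h0] at hlt
  have h1 : (fun z => eval z (X ^ j : ℝ[X])) =o[atTop] fun z => eval z P := by
    refine isLittleO_atTop_of_degree_lt _ _ ?_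
    rw [degree_X_pow, degree_eq_natDegree hP]
    exact_mod_cast hlt
  have h2 : (fun z => eval z P) =o[atTop] fun z => eval z P := by
    refine IsBigO.trans_isLittleO ?_ h1
    simpa using h
  exact isLittleO_irrefl ((eventually_atTop_not_isRoot P hP).frequently) h2

section Transport

variable {b ζ : Fin 3 → ℝ} {g₁ g₂ : ℝ}

theorem eventually_eval_laxContent_ne_zero (g₁ g₂ : ℝ) :
    ∀ᶠ z in atTop, eval z (laxContent g₁ g₂) ≠ 0 :=
  eventually_atTop_not_isRoot _ (laxContent_ne_zero g₁ g₂)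

/-- The factor between the primitive Lax matrix and the normalised one. -/
def laxScale (ζ : Fin 3 → ℝ) (g₁ g₂ : ℝ) (z : ℝ) : ℝ :=
  eval z (nodal ζ) / eval z (laxContent g₁ g₂)

theorem map_eval_primitive {x y : Fin 3 → ℝ} {M : Matrix (Fin 2) (Fin 2) ℝ[X]}
    (hM : lax b ζ x y = laxContent g₁ g₂ • M) {z : ℝ} (h1 : eval z (nodal ζ) ≠ 0)
    (h2 : eval z (laxContent g₁ g₂) ≠ 0) :
    M.map (eval z) = laxScale ζ g₁ g₂ z • laxFun b ζ x y z := by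
  rw [laxFun, hM, laxScale]
  ext i j
  simp
  field_simp

theorem map_eval_add_smul (p q : ℝ[X]) (M : Matrix (Fin 2) (Fin 2) ℝ[X]) (z : ℝ) :
    (p • 1 + q • M).map (eval z) = eval z p • 1 + eval z q • M.map (eval z) := by
  ext i j
  fin_cases i <;> fin_cases j <;> simp

theorem laxRoot_congr {x y x' y' : Fin 3 → ℝ} (h : IsCausticLine b ζ g₁ g₂ x y)
    (h' : IsCausticLine b ζ g₁ g₂ x' y') : laxRoot b ζ x y = laxRoot b ζ x' y' := by
  have hd : (lax b ζ x y).det = (lax b ζ x' y').det := neg_injective (by rw [h.det, h'.det])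
  funext z
  simp only [laxRoot, laxFun, Matrix.det_smul, det_map_eval, hd]

namespace Orbit

/-- The two functions are the eigenvalues of the monodromy on the eigenlines of the Lax matrix. They
are read from a diagonal entry of `ε ± L` that tends to 2. The resulting bounds involve only `p`,
`q` and the caustics, so they pass to other orbits. -/
theorem growth (O : Orbit b ζ) {p q : ℝ[X]} {M : Matrix (Fin 2) (Fin 2) ℝ[X]}
    (hM : O.laxAt 0 = laxContent g₁ g₂ • M) {N : ℕ} (hN : O.prod N = p • 1 + q • M) :
    ((fun z => eval z p + eval z q * laxScale ζ g₁ g₂ z * laxRoot b ζ (O.x 0) (O.y 0) z) =O[atTop]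
      fun z : ℝ => z ^ (-O.count N : ℤ)) ∧
    ((fun z => eval z p - eval z q * laxScale ζ g₁ g₂ z * laxRoot b ζ (O.x 0) (O.y 0) z) =O[atTop]
      fun z : ℝ => z ^ (O.count N : ℤ)) := by
  set ε := laxRoot b ζ (O.x 0) (O.y 0) with hε
  set L := laxFun b ζ (O.x 0) (O.y 0) with hLdef
  set s := laxScale ζ g₁ g₂
  have hε1 : Tendsto ε atTop (𝓝 1) := O.tendsto_laxRoot
  have hlim := tendsto_pencil_div (b := b) (ζ := ζ) (O.x 0) (O.y 0)
  rw [(O.impact 0).dir] at hlim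
  have hL11 : Tendsto (fun z => L z 1 1) atTop (𝓝 1) := by
    refine hlim.congr' ?_
    filter_upwards [laxFun_eventuallyEq (b := b) (ζ := ζ) (O.x 0) (O.y 0)] with z hz
    rw [hLdef, hz]; simp
  have hL00 : Tendsto (fun z => L z 0 0) atTop (𝓝 (-1)) := by
    refine hlim.neg.congr' ?_
    filter_upwards [laxFun_eventuallyEq (b := b) (ζ := ζ) (O.x 0) (O.y 0)] with z hz
    rw [hLdef, hz]; simp
  have hprod : ∀ᶠ z in atTop, (O.prod N).map (eval z) = eval z p • 1 + (eval z q * s z) • L z := by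
    filter_upwards [eventually_nodal_ne_zero ζ, eventually_eval_laxContent_ne_zero g₁ g₂]
      with z h1 h2
    rw [hN, map_eval_add_smul, map_eval_primitive hM h1 h2, smul_smul]
  have hsq : ∀ᶠ z in atTop, L z * L z = ε z ^ 2 • 1 := by
    filter_upwards [laxRoot_sq (O.impact 0).on (O.impact 0).dir] with z hz
    rw [hLdef, laxFun_mul_self, ← hz]
  constructor
  · have h1 := O.prod_mul_add_isBigO N 1 1
    have h2 : Tendsto (fun z => (ε z + L z 1 1)⁻¹) atTop (𝓝 (1 + 1)⁻¹) :=
      (hε1.add hL11).inv₀ (by norm_num)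
    have h3 := isBigO_zpow_mul_zpow h1 (isBigO_zpow_zero_of_tendsto h2)
    rw [add_zero] at h3
    refine h3.congr' ?_ EventuallyEq.rfl
    filter_upwards [hprod, hsq, (hε1.add hL11).eventually_ne (show (1 : ℝ) + 1 ≠ 0 by norm_num)]
      with z hz hq hne
    have h4 : (O.prod N).map (eval z) * (ε z • 1 + L z) =
        (eval z p + eval z q * s z * ε z) • (ε z • 1 + L z) := by
      rw [hz, add_mul, mul_add, mul_add, smul_one_mul, smul_one_mul, smul_mul_assoc,
        smul_mul_assoc, mul_smul_one, hq]
      module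
    rw [h4]
    simp
    field_simp
  · have h1 := O.prod_mul_sub_isBigO N 0 0
    have h2 : Tendsto (fun z => (ε z - L z 0 0)⁻¹) atTop (𝓝 (1 - -1)⁻¹) :=
      (hε1.sub hL00).inv₀ (by norm_num)
    have h3 := isBigO_zpow_mul_zpow h1 (isBigO_zpow_zero_of_tendsto h2)
    rw [add_zero] at h3
    refine h3.congr' ?_ EventuallyEq.rfl
    filter_upwards [hprod, hsq, (hε1.sub hL00).eventually_ne (show (1 : ℝ) - -1 ≠ 0 by norm_num)]
      with z hz hq hne
    have h4 : (O.prod N).map (eval z) * (ε z • 1 - L z) =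
        (eval z p - eval z q * s z * ε z) • (ε z • 1 - L z) := by
      rw [hz, add_mul, mul_sub, mul_sub, smul_one_mul, smul_one_mul, smul_mul_assoc,
        smul_mul_assoc, mul_smul_one, hq]
      module
    rw [h4]
    simp
    field_simp

/-- Split the matrix along the two eigenlines: on one, decay by `O.count k` meets growth by `n`; on
the other the roles are exchanged. So the degree is at most the distance between `O.count k` and
`n`. -/
theorem natDegree_prod_mul_le (O : Orbit b ζ) {p q : ℝ[X]} {M : Matrix (Fin 2) (Fin 2) ℝ[X]}
    (hM : O.laxAt 0 = laxContent g₁ g₂ • M) {n k j : ℕ}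
    (hadd : (fun z => eval z p + eval z q * laxScale ζ g₁ g₂ z * laxRoot b ζ (O.x 0) (O.y 0) z)
      =O[atTop] fun z : ℝ => z ^ (-n : ℤ))
    (hsub : (fun z => eval z p - eval z q * laxScale ζ g₁ g₂ z * laxRoot b ζ (O.x 0) (O.y 0) z)
      =O[atTop] fun z : ℝ => z ^ (n : ℤ))
    (h1 : n ≤ O.count k + j) (h2 : O.count k ≤ n + j) (i i' : Fin 2) :
    ((O.prod k * (p • 1 + (-q) • M)) i i').natDegree ≤ j := by
  apply natDegree_le_of_isBigO
  set ε := laxRoot b ζ (O.x 0) (O.y 0) with hε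
  set L := laxFun b ζ (O.x 0) (O.y 0) with hLdef
  set s := laxScale ζ g₁ g₂
  have hε1 : Tendsto ε atTop (𝓝 1) := O.tendsto_laxRoot
  have h3 := ((O.prod_mul_add_isBigO k).smul hsub).mono (l := j) (by lia)
  have h4 := ((O.prod_mul_sub_isBigO k).smul hadd).mono (l := j) (by lia)
  have h5 := (h3.add h4).smul (isBigO_zpow_zero_of_tendsto ((hε1.const_mul 2).inv₀ (by norm_num)))
  rw [zero_add] at h5
  suffices h : MatrixIsBigO (fun z => (O.prod k * (p • 1 + (-q) • M)).map (eval z)) j from h i i'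
  refine h5.congr' ?_
  filter_upwards [eventually_nodal_ne_zero ζ, eventually_eval_laxContent_ne_zero g₁ g₂,
    hε1.eventually_ne one_ne_zero] with z hz1 hz2 hz3
  rw [inv_smul_eq_iff₀ (mul_ne_zero two_ne_zero hz3), map_eval_mul, map_eval_add_smul,
    map_eval_primitive hM hz1 hz2, smul_smul, ← Matrix.mul_smul, ← Matrix.mul_smul,
    ← Matrix.mul_smul, ← Matrix.mul_add, eval_neg]
  congr 1
  module

end Orbit
end Transport

/-! ### The Poncelet porism for orbits. -/

section Period

variable {b ζ : Fin 3 → ℝ} {g₁ g₂ : ℝ}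

theorem moment_self_pos (hb : ∀ i, 0 < b i) {y : Fin 3 → ℝ} (hy : y ≠ 0) :
    0 < moment b ζ 0 y y := by
  have h0 : moment b ζ 0 y y = b 0 * y 0 ^ 2 + b 1 * y 1 ^ 2 + b 2 * y 2 ^ 2 := by
    simp only [moment]; ring
  have h1 := fun i => mul_nonneg (hb i).le (sq_nonneg (y i))
  obtain ⟨i, hi⟩ := Function.ne_iff.mp hy
  have h2 : 0 < b i * y i ^ 2 := mul_pos (hb i) (sq_pos_of_ne_zero hi)
  rw [h0]
  have := h1 0; have := h1 1; have := h1 2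
  fin_cases i <;> simp at h2 <;> linarith

theorem primitive_mul_self (l u w : ℝ[X]) :
    (!![l, u; w, -l] * !![l, u; w, -l] : Matrix (Fin 2) (Fin 2) ℝ[X]) =
      (l ^ 2 + u * w) • 1 := by
  refine Matrix.ext fun i j => ?_
  fin_cases i <;> fin_cases j <;> simp [Matrix.mul_apply, Fin.sum_univ_two] <;> ring

theorem det_add_smul_primitive (p q l u w : ℝ[X]) :
    (p • 1 + q • !![l, u; w, -l] : Matrix (Fin 2) (Fin 2) ℝ[X]).det =
      p ^ 2 - q ^ 2 * (l ^ 2 + u * w) := by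
  rw [Matrix.det_fin_two]
  simp
  ring

/-- A unimodular matrix of degree at most one is not the image of another one under a reflection
of degree two. -/
theorem not_natDegree_le_one_of_step {t σ τ : ℝ} (hτ : τ ≠ 0) {Z : Matrix (Fin 2) (Fin 2) ℝ[X]}
    (hdet : Z.det = 1) (h : ∀ i j, (Z i j).natDegree ≤ 1)
    (h' : ∀ i j, ((step t σ τ * Z) i j).natDegree ≤ 1) : False := by
  have hm : (mass σ τ).natDegree = 2 := by
    unfold mass; compute_degree!
  have hm0 : mass σ τ ≠ 0 := fun h0 => by simp [h0] at hm
  have hrow : ∀ j, Z 0 j = 0 := by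
    intro j
    by_contra hne
    have h1 : mass σ τ * Z 0 j = Z 1 j - (step t σ τ * Z) 1 j := by
      simp [step, Matrix.mul_apply, Fin.sum_univ_two]
    have h2 := natDegree_mul hm0 hne
    rw [h1, hm] at h2
    have h3 := natDegree_sub_le (Z 1 j) ((step t σ τ * Z) 1 j)
    have h4 := max_le (h 1 j) (h' 1 j)
    omega
  rw [Matrix.det_fin_two, hrow, hrow] at hdet
  simp at hdet

namespace Orbit

variable (O : Orbit b ζ)

theorem count_zero : O.count 0 = 0 := rfl

theorem le_count (k : ℕ) : k ≤ O.count k := by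
  induction k with
  | zero => exact Nat.zero_le _
  | succ k ih => rw [count_succ]; have := one_le_massDegree (O.τ k); omega

/-- The count grows by 1 or 2 at each impact, so `n` can be missed only by jumping over it at a
quadratic mass. -/
theorem exists_count_eq {n : ℕ}
    (h : ∀ k, O.τ k ≠ 0 → O.count k + 1 = n → O.count (k + 1) = n + 1 → False) :
    ∃ k, O.count k = n := by
  classical
  have hex : ∃ k, n ≤ O.count k := ⟨n, O.le_count n⟩
  rcases hk : Nat.find hex with _ | k
  · have h0 := Nat.find_spec hex
    rw [hk, count_zero] at h0
    exact ⟨0, by rw [count_zero]; omega⟩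
  · have h1 := Nat.find_spec hex
    have h2 : ¬ n ≤ O.count k := Nat.find_min hex (by omega)
    rw [hk] at h1
    refine ⟨k + 1, ?_⟩
    by_contra hne
    have h3 := O.count_succ k
    have h4 : massDegree (O.τ k) ≤ 2 := by unfold massDegree; split_ifs <;> norm_num
    have hτ : O.τ k ≠ 0 := by
      intro h0
      simp [massDegree, h0] at h3
      omega
    exact h k hτ (by omega) (by omega)

theorem y_ne_zero (k : ℕ) : O.y k ≠ 0 := by
  intro h
  have := (O.impact k).dir
  rw [h] at this
  simp [moment] at this

/-- The only constant matrices intertwining Lax matrices of an orbit are `1` and `-1`. -/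
theorem eq_smul_one_of_intertwines (hA : IsAdmissible b ζ g₁ g₂) {k : ℕ}
    {Q : Matrix (Fin 2) (Fin 2) ℝ}
    (hQ : ∀ z, Q * (O.laxAt 0).map (eval z) = (O.laxAt k).map (eval z) * Q) :
    Q = Q 0 0 • 1 := by
  have h0 := hQ 0
  rw [laxAt, laxAt, lax_eval_zero, lax_eval_zero] at h0
  have hne : ζ 0 * ζ 1 * ζ 2 ≠ 0 :=
    mul_ne_zero (mul_ne_zero (hA.ne_zero 0) (hA.ne_zero 1)) (hA.ne_zero 2)
  have e00 := congrFun (congrFun h0 0) 0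
  have e01 := congrFun (congrFun h0 0) 1
  simp [Matrix.mul_apply, Fin.sum_univ_two, -mul_eq_zero, -zero_eq_mul] at e00 e01
  -- At `z = 0` the Lax matrix is a fixed nilpotent, so `Q` is upper triangular with equal diagonal
  -- entries; the limit at infinity then removes `Q 0 1`.
  have hc : Q 1 0 = 0 := by
    rcases mul_eq_zero.mp e00.symm with h | h
    · exact absurd h hne
    · exact h
  have hd : Q 0 0 = Q 1 1 := mul_right_cancel₀ hne (by rw [e01]; ring)
  have hlim : ∀ k, Tendsto (fun z => laxFun b ζ (O.x k) (O.y k) z 0 0) atTop (𝓝 (-1)) := by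
    intro k
    have h1 := (tendsto_pencil_div (b := b) (ζ := ζ) (O.x k) (O.y k)).neg
    rw [(O.impact k).dir] at h1
    refine h1.congr' ?_
    filter_upwards [laxFun_eventuallyEq (b := b) (ζ := ζ) (O.x k) (O.y k)] with z hz
    rw [hz]; simp
  have hlim' : Tendsto (fun z => laxFun b ζ (O.x 0) (O.y 0) z 1 0) atTop
      (𝓝 (-moment b ζ 0 (O.y 0) (O.y 0))) := by
    refine (tendsto_pencil_div (b := b) (ζ := ζ) (O.y 0) (O.y 0)).neg.congr' ?_
    filter_upwards [laxFun_eventuallyEq (b := b) (ζ := ζ) (O.x 0) (O.y 0)] with z hz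
    rw [hz]; simp
  have h1 := ((hlim 0).const_mul (Q 0 0)).add (hlim'.const_mul (Q 0 1))
  have h2 := (hlim k).mul_const (Q 0 0)
  have heq : (fun z => Q 0 0 * laxFun b ζ (O.x 0) (O.y 0) z 0 0 +
      Q 0 1 * laxFun b ζ (O.x 0) (O.y 0) z 1 0) =
      fun z => laxFun b ζ (O.x k) (O.y k) z 0 0 * Q 0 0 := by
    funext z
    have h3 := congrFun (congrFun (hQ z) 0) 0
    simp only [Matrix.mul_apply, Fin.sum_univ_two, hc, mul_zero, add_zero, laxAt] at h3
    simp only [laxFun, Matrix.smul_apply, smul_eq_mul]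
    linear_combination (eval z (nodal ζ))⁻¹ * h3
  rw [heq] at h1
  have h4 := tendsto_nhds_unique h1 h2
  have hb : Q 0 1 = 0 := by
    have h5 := (moment_self_pos (ζ := ζ) hA.pos (O.y_ne_zero 0)).ne'
    refine (mul_eq_zero.mp (?_ : Q 0 1 * moment b ζ 0 (O.y 0) (O.y 0) = 0)).resolve_right h5
    linear_combination -h4
  ext i j
  fin_cases i <;> fin_cases j <;> simp [hb, hc, hd]

/-- The Poncelet porism for orbits: closing of one orbit forces closing of every orbit with the
same caustics, with the same trace of the monodromy. -/
theorem exists_period (hA : IsAdmissible b ζ g₁ g₂) (O O' : Orbit b ζ)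
    (h : IsCausticLine b ζ g₁ g₂ (O.x 0) (O.y 0))
    (h' : IsCausticLine b ζ g₁ g₂ (O'.x 0) (O'.y 0)) {N : ℕ} (hN : 1 ≤ N)
    (hx : O.x N = O.x 0) (hy : O.y N = O.y 0) :
    ∃ k, 1 ≤ k ∧ O'.x k = O'.x 0 ∧ O'.y k = O'.y 0 ∧ (O'.prod k).trace = (O.prod N).trace := by
  obtain ⟨l, u, w, hM, hF, α, β, γ, hprim⟩ := exists_primitive_lax hA h
  obtain ⟨l', u', w', hM', hF', -⟩ := exists_primitive_lax hA h'
  set M : Matrix (Fin 2) (Fin 2) ℝ[X] := !![l, u; w, -l] with hMdef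
  set M' : Matrix (Fin 2) (Fin 2) ℝ[X] := !![l', u'; w', -l'] with hM'def
  have hc := laxContent_ne_zero g₁ g₂
  have hFF : l ^ 2 + u * w = l' ^ 2 + u' * w' :=
    mul_left_cancel₀ (pow_ne_zero 2 hc) (hF.trans hF'.symm)
  have hcomm : O.prod N * M = M * O.prod N := by
    have h1 := O.prod_mul_laxAt N
    rw [laxAt, laxAt, hx, hy, hM, Matrix.mul_smul, Matrix.smul_mul] at h1
    refine Matrix.ext fun i j => mul_left_cancel₀ hc ?_
    exact congrFun (congrFun h1 i) j
  obtain ⟨p, q, hpq⟩ := exists_eq_add_smul hprim hcomm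
  rw [← hMdef] at hpq
  have hdet : p ^ 2 - q ^ 2 * (l ^ 2 + u * w) = 1 := by
    rw [← det_add_smul_primitive, ← hMdef, ← hpq, det_prod]
  obtain ⟨hadd, hsub⟩ := O.growth hM hpq
  rw [laxRoot_congr h h'] at hadd hsub
  set n := O.count N
  set Y := p • 1 + (-q) • M' with hY
  set W := p • 1 + q • M' with hW
  have hYW : Y * W = 1 := by
    have h1 : M' * M' = (l' ^ 2 + u' * w') • 1 := primitive_mul_self l' u' w'
    rw [hY, hW, add_mul, mul_add, mul_add, smul_one_mul, smul_one_mul, smul_mul_assoc,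
      smul_mul_assoc, mul_smul_one, mul_smul_comm, h1]
    rw [← hFF, smul_smul, smul_smul, smul_smul, smul_smul]
    trans (p ^ 2 - q ^ 2 * (l ^ 2 + u * w)) • (1 : Matrix (Fin 2) (Fin 2) ℝ[X])
    · module
    · rw [hdet, one_smul]
  have hYdet : Y.det = 1 := by
    rw [hY, hM'def, det_add_smul_primitive, ← hFF]
    linear_combination hdet
  -- If a tropic impact jumped over `n`, the comparison matrix would have degree at most 1 both
  -- before and after a step of degree 2, which unimodularity forbids.
  obtain ⟨k, hk⟩ : ∃ k, O'.count k = n := by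
    refine O'.exists_count_eq fun k hτ h1 h2 => ?_
    refine not_natDegree_le_one_of_step (t := O'.t k) (σ := O'.σ k) hτ (Z := O'.prod k * Y)
      (by rw [Matrix.det_mul, det_prod, hYdet, one_mul]) ?_ ?_
    · exact O'.natDegree_prod_mul_le hM' hadd hsub (by omega) (by omega)
    · rw [← Matrix.mul_assoc, ← prod_succ]
      exact O'.natDegree_prod_mul_le hM' hadd hsub (by omega) (by omega)
  have hdeg := O'.natDegree_prod_mul_le hM' hadd hsub (k := k) (j := 0) (by omega) (by omega)
  set Q : Matrix (Fin 2) (Fin 2) ℝ := (O'.prod k * Y).map (eval 0) with hQdef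
  have hQC : ∀ z, (O'.prod k * Y).map (eval z) = Q := by
    intro z
    ext i j
    have h1 := eq_C_of_natDegree_le_zero (hdeg i j)
    rw [hQdef, Matrix.map_apply, Matrix.map_apply]
    rw [← hY] at h1
    rw [h1, eval_C, eval_C]
  have hYM : Y * O'.laxAt 0 = O'.laxAt 0 * Y := by
    rw [laxAt, hM', hY, Matrix.mul_smul, Matrix.smul_mul, add_mul, mul_add, smul_one_mul,
      mul_smul_one, smul_mul_assoc, mul_smul_comm]
  have hprodW : O'.prod k = (O'.prod k * Y) * W := by
    rw [Matrix.mul_assoc, hYW, Matrix.mul_one]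
  have hQ1 : Q = Q 0 0 • 1 := by
    refine O'.eq_smul_one_of_intertwines hA (k := k) fun z => ?_
    rw [← hQC z, ← map_eval_mul, ← map_eval_mul, Matrix.mul_assoc, hYM, ← Matrix.mul_assoc,
      prod_mul_laxAt, Matrix.mul_assoc]
  -- The diagonal of the Lax matrix vanishes at 0 and its content does not; a double caustic with
  -- parameter 0 is excluded by `IsAdmissible.double`.
  have hc0 : ∀ {x y : Fin 3 → ℝ} {l u w : ℝ[X]},
      lax b ζ x y = laxContent g₁ g₂ • !![l, u; w, -l] → eval 0 l = 0 := by
    intro x y l u w hl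
    have h1 := congrFun (congrFun (lax_eval_zero (b := b) (ζ := ζ) x y) 0) 0
    rw [hl] at h1
    simp at h1
    refine h1.resolve_left ?_
    unfold laxContent
    split_ifs with hg
    · simpa using hA.double hg
    · simp
  have hp0 : eval 0 p = 1 := by
    have h1 := congrFun (congrFun (eval_zero_transfer O.t O.σ O.τ N) 0) 0
    change (O.prod N).map (eval 0) 0 0 = _ at h1
    rw [hpq, hMdef] at h1
    simpa [hc0 hM] using h1
  have hQ00 : Q 0 0 = 1 := by
    have h1 := congrFun (congrFun (eval_zero_transfer O'.t O'.σ O'.τ k) 0) 0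
    change (O'.prod k).map (eval 0) 0 0 = _ at h1
    rw [hprodW, map_eval_mul, hQC, hQ1, hW, hM'def] at h1
    simpa [hc0 hM', hp0] using h1
  have hprod : O'.prod k = W := by
    have h1 : O'.prod k * Y = 1 := by
      refine Matrix.ext fun i j => Polynomial.funext fun z => ?_
      have := congrFun (congrFun ((hQC z).trans hQ1) i) j
      rw [hQ00, one_smul, Matrix.map_apply] at this
      rw [this, Matrix.one_apply, Matrix.one_apply]
      split_ifs <;> simp
    rw [hprodW, h1, Matrix.one_mul]
  have hfix : ∀ {x y : Fin 3 → ℝ} {M : Matrix (Fin 2) (Fin 2) ℝ[X]},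
      lax b ζ x y = laxContent g₁ g₂ • M → ∀ i,
      (p • 1 + q • M).map (eval (ζ i)) *ᵥ ![x i, y i] = eval (ζ i) p • ![x i, y i] := by
    intro x y M hM i
    have h1 := lax_eval_node_mulVec (b := b) (ζ := ζ) x y i
    have h2 : (lax b ζ x y).map (eval (ζ i)) =
        eval (ζ i) (laxContent g₁ g₂) • M.map (eval (ζ i)) := by
      rw [hM]; ext; simp
    rw [h2, Matrix.smul_mulVec, smul_eq_zero] at h1
    have h3 := h1.resolve_left (laxContent_eval_ne_zero (hA.ne₁ i))
    rw [map_eval_add_smul, Matrix.add_mulVec, Matrix.smul_mulVec, Matrix.smul_mulVec, h3,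
      Matrix.one_mulVec, smul_zero, add_zero]
  -- The closed orbit fixes the nonzero vector `(x i, y i)`, which the monodromy multiplies by `p (ζ
  -- i)`.
  have hp : ∀ i, eval (ζ i) p = 1 := by
    intro i
    have h1 := O.prod_eval_mulVec N i
    rw [hpq, hfix hM, hx, hy] at h1
    by_contra hne
    apply coord_ne_zero hA h i
    have h2 : (eval (ζ i) p - 1) • ![O.x 0 i, O.y 0 i] = 0 := by
      rw [sub_smul, h1, one_smul, sub_self]
    exact (smul_eq_zero.mp h2).resolve_left (sub_ne_zero.mpr hne)
  have hper : ∀ i, ![O'.x k i, O'.y k i] = ![O'.x 0 i, O'.y 0 i] := by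
    intro i
    rw [← O'.prod_eval_mulVec k i, hprod, hW, hfix hM', hp, one_smul]
  refine ⟨k, ?_, funext fun i => congrFun (hper i) 0, funext fun i => congrFun (hper i) 1, ?_⟩
  · have := O.le_count N
    rcases k with _ | k
    · rw [count_zero] at hk; omega
    · omega
  · rw [hprod, hpq, hW, hMdef, hM'def]
    simp [Matrix.trace_fin_two]

end Orbit
end Period

/-! ### Minkowski geometry of the ellipsoid and the reflection law. -/

section Geometry

variable {a₁ a₂ a₃ : ℝ}

/-- The weights of the form defining the ellipsoid. -/
def weights (a₁ a₂ a₃ : ℝ) : Fin 3 → ℝ := ![a₁⁻¹, a₂⁻¹, a₃⁻¹]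

/-- The parameters of the coordinate planes, in the inverse spectral parameter. -/
def nodes (a₁ a₂ a₃ : ℝ) : Fin 3 → ℝ := ![a₁⁻¹, a₂⁻¹, -a₃⁻¹]

/-- The moments of the ellipsoid. -/
abbrev mom (a₁ a₂ a₃ : ℝ) (j : ℕ) (x y : E21) : ℝ :=
  moment (weights a₁ a₂ a₃) (nodes a₁ a₂ a₃) j x y

theorem confForm_zero (x y : E21) : confForm a₁ a₂ a₃ 0 x y = mom a₁ a₂ a₃ 0 x y := by
  simp [confForm, moment, weights, div_eq_mul_inv]; ring

theorem mom_mul_right (j : ℕ) (x y : E21) :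
    mom a₁ a₂ a₃ j x (nodes a₁ a₂ a₃ * y) = mom a₁ a₂ a₃ (j + 1) x y :=
  moment_mul_right j x y

theorem mom_mul_left (j : ℕ) (x y : E21) :
    mom a₁ a₂ a₃ j (nodes a₁ a₂ a₃ * x) y = mom a₁ a₂ a₃ (j + 1) x y :=
  moment_mul_left j x y

theorem mom_comm (j : ℕ) (x y : E21) : mom a₁ a₂ a₃ j x y = mom a₁ a₂ a₃ j y x :=
  moment_comm j x y

theorem normalVec_eq (x : E21) : normalVec a₁ a₂ a₃ x = nodes a₁ a₂ a₃ * x := by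
  ext i; fin_cases i <;> simp [normalVec, nodes, div_eq_mul_inv, mul_comm]

theorem normalVecDeriv_eq (x : E21) :
    normalVecDeriv a₁ a₂ a₃ x = nodes a₁ a₂ a₃ * (nodes a₁ a₂ a₃ * x) := by
  rw [normalVecDeriv, normalVec_eq, normalVec_eq]

theorem mink_nodes_mul (x y : E21) :
    mink (nodes a₁ a₂ a₃ * x) y = mom a₁ a₂ a₃ 0 x y := by
  simp [mink, moment, weights, nodes]

theorem mink_comm (x y : E21) : mink x y = mink y x := by
  simp only [mink]; ring

theorem mink_add_right (x y y' : E21) : mink x (y + y') = mink x y + mink x y' := by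
  simp only [mink, Pi.add_apply]; ring

theorem mink_smul_right (c : ℝ) (x y : E21) : mink x (c • y) = c * mink x y := by
  simp only [mink, Pi.smul_apply, smul_eq_mul]; ring

theorem mem_tangentPlane_iff (x u : E21) :
    u ∈ tangentPlane a₁ a₂ a₃ x ↔ mink (normalVec a₁ a₂ a₃ x) u = 0 := by
  rw [normalVec_eq, mink_nodes_mul, ← confForm_zero]; rfl

theorem mem_ellipsoid_iff (x : E21) : x ∈ ellipsoid a₁ a₂ a₃ ↔ mom a₁ a₂ a₃ 0 x x = 1 := by
  rw [← confForm_zero]; rfl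

theorem eq_smul_of_orthogonal {n w : E21} (hn : n ≠ 0)
    (h : ∀ u, mink n u = 0 → mink w u = 0) : ∃ c : ℝ, w = c • n := by
  have h01 := h ![n 1, -n 0, 0] (by simp [mink]; ring)
  have h02 := h ![n 2, 0, n 0] (by simp [mink]; ring)
  have h12 := h ![0, n 2, n 1] (by simp [mink]; ring)
  simp [mink] at h01 h02 h12
  obtain ⟨i, hi⟩ := Function.ne_iff.mp hn
  refine ⟨w i / n i, funext fun j => ?_⟩
  simp only [Pi.smul_apply, smul_eq_mul]
  rw [Pi.zero_apply] at hi
  rw [div_mul_eq_mul_div, eq_div_iff hi]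
  fin_cases i <;> fin_cases j <;> simp <;> linarith

theorem normalVec_ne_zero {x : E21} (hx : x ∈ ellipsoid a₁ a₂ a₃) : normalVec a₁ a₂ a₃ x ≠ 0 := by
  intro h
  rw [mem_ellipsoid_iff, ← mink_nodes_mul, ← normalVec_eq, h] at hx
  simp [mink] at hx

theorem mink_normalVec_self (x : E21) :
    mink (normalVec a₁ a₂ a₃ x) (normalVec a₁ a₂ a₃ x) = mom a₁ a₂ a₃ 1 x x := by
  rw [normalVec_eq, mink_nodes_mul, mom_mul_right]

theorem isTropic_iff {x : E21} (hx : x ∈ ellipsoid a₁ a₂ a₃) :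
    IsTropic a₁ a₂ a₃ x ↔ mom a₁ a₂ a₃ 1 x x = 0 := by
  simp only [IsTropic, mem_tangentPlane_iff]
  rw [← mink_normalVec_self]
  constructor
  · rintro ⟨w, hw, hne, horth⟩
    obtain ⟨c, rfl⟩ := eq_smul_of_orthogonal (normalVec_ne_zero hx) horth
    rw [mink_smul_right] at hw
    exact (mul_eq_zero.mp hw).resolve_left fun hc => hne (by rw [hc, zero_smul])
  · exact fun h => ⟨_, h, normalVec_ne_zero hx, fun u hu => hu⟩

theorem mink_self_pos_of_orthogonal {n w : E21} (hn : mink n n < 0) (hw : mink n w = 0)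
    (hne : w ≠ 0) : 0 < mink w w := by
  simp only [mink] at hn hw ⊢
  by_contra hle
  rw [not_lt] at hle
  -- Cauchy–Schwarz in the two space-like coordinates, after using orthogonality.
  have h1 : (n 2 * w 2) ^ 2 ≤ (n 0 ^ 2 + n 1 ^ 2) * (w 0 ^ 2 + w 1 ^ 2) := by
    rw [show n 2 * w 2 = n 0 * w 0 + n 1 * w 1 by linarith]
    nlinarith [sq_nonneg (n 0 * w 1 - n 1 * w 0)]
  have h2 : 0 < n 2 ^ 2 := by nlinarith [sq_nonneg (n 0), sq_nonneg (n 1)]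
  have h3 : w 2 ^ 2 = 0 := by
    by_contra h
    have h4 : 0 < w 2 ^ 2 := lt_of_le_of_ne (sq_nonneg _) (Ne.symm h)
    nlinarith [mul_pos h2 h4, mul_nonneg (add_nonneg (sq_nonneg (n 0)) (sq_nonneg (n 1)))
      (show 0 ≤ w 2 ^ 2 - (w 0 ^ 2 + w 1 ^ 2) by nlinarith)]
  have h0 : w 0 = 0 := by nlinarith [sq_nonneg (w 0), sq_nonneg (w 1)]
  have h1 : w 1 = 0 := by nlinarith [sq_nonneg (w 0), sq_nonneg (w 1)]
  exact hne (funext fun i => by fin_cases i <;> simp_all)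

theorem exists_orthogonal_mink_neg {n : E21} (hn : 0 < mink n n) :
    ∃ w, mink n w = 0 ∧ mink w w < 0 := by
  -- The vector orthogonal to `n` in the plane of `n` and the time axis; its square is `-(n 0 ^ 2 +
  -- n 1 ^ 2)` times that of `n`.
  refine ⟨![n 0 * n 2, n 1 * n 2, n 0 ^ 2 + n 1 ^ 2], by simp [mink]; ring, ?_⟩
  simp only [mink] at hn
  simp [mink]
  nlinarith [sq_nonneg (n 2), sq_nonneg (n 0), sq_nonneg (n 1),
    mul_pos (show 0 < n 0 ^ 2 + n 1 ^ 2 by nlinarith [sq_nonneg (n 2)]) hn]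

theorem inPolarCap_iff {x : E21} (hx : x ∈ ellipsoid a₁ a₂ a₃) :
    InPolarCap a₁ a₂ a₃ x ↔ mom a₁ a₂ a₃ 1 x x < 0 := by
  simp only [InPolarCap, mem_tangentPlane_iff]
  rw [← mink_normalVec_self]
  constructor
  · intro h
    rcases lt_trichotomy (mink (normalVec a₁ a₂ a₃ x) (normalVec a₁ a₂ a₃ x)) 0 with h0 | h0 | h0
    · exact h0
    · exact absurd (h _ h0 (normalVec_ne_zero hx)) h0.not_gt
    · obtain ⟨w, hw, hneg⟩ := exists_orthogonal_mink_neg h0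
      have hne : w ≠ 0 := by rintro rfl; simp [mink] at hneg
      exact absurd (h w hw hne) hneg.not_gt
  · exact fun h w hw hne => mink_self_pos_of_orthogonal h hw hne

theorem inEquatorialBelt_iff {x : E21} (hx : x ∈ ellipsoid a₁ a₂ a₃) :
    InEquatorialBelt a₁ a₂ a₃ x ↔ 0 < mom a₁ a₂ a₃ 1 x x := by
  rw [InEquatorialBelt, isTropic_iff hx]
  simp only [mem_tangentPlane_iff]
  rw [← mink_normalVec_self]
  constructor
  · rintro ⟨h0, w, hw, hneg⟩
    by_contra h
    have hne : w ≠ 0 := by rintro rfl; simp [mink] at hneg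
    exact hneg.not_gt (mink_self_pos_of_orthogonal (lt_of_le_of_ne (not_lt.mp h) h0) hw hne)
  · exact fun h => ⟨h.ne', exists_orthogonal_mink_neg h⟩

theorem mom_self_pos (h₁ : 0 < a₁) (h₂ : 0 < a₂) (h₃ : 0 < a₃) {y : E21} (hy : y ≠ 0) :
    0 < mom a₁ a₂ a₃ 0 y y :=
  moment_self_pos (by intro i; fin_cases i <;> simp [weights, h₁, h₂, h₃]) hy

theorem mom_two_pos (h₁ : 0 < a₁) (h₂ : 0 < a₂) (h₃ : 0 < a₃) {x : E21}
    (hx : x ∈ ellipsoid a₁ a₂ a₃) : 0 < mom a₁ a₂ a₃ 2 x x := by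
  have hne : nodes a₁ a₂ a₃ * x ≠ 0 := by
    rw [← normalVec_eq]; exact normalVec_ne_zero hx
  have := mom_self_pos h₁ h₂ h₃ hne
  rwa [mom_mul_left, mom_mul_right] at this

/-- Reflections are given by impacts of the string. -/
theorem IsReflection.exists_isImpact (h₁ : 0 < a₁) (h₂ : 0 < a₂) (h₃ : 0 < a₃) {x y y' : E21}
    (hx : x ∈ ellipsoid a₁ a₂ a₃) (hy : mom a₁ a₂ a₃ 0 x y = 1)
    (h : IsReflection a₁ a₂ a₃ x y y') :
    ∃ σ τ, IsImpact (weights a₁ a₂ a₃) (nodes a₁ a₂ a₃) x y σ τ ∧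
      y' = deflect (nodes a₁ a₂ a₃) σ τ x y := by
  have hon := (mem_ellipsoid_iff x).mp hx
  set ζ := nodes a₁ a₂ a₃ with hζ
  rcases h with ⟨-, a, b, ha, hb, rfl, rfl⟩ | ⟨ht, a, b, ha, ha', ⟨s, t, rfl⟩, rfl, rfl⟩
  · simp only [mem_tangentPlane_iff] at ha hb
    obtain ⟨c, rfl⟩ := eq_smul_of_orthogonal (normalVec_ne_zero hx) hb
    -- The reflection subtracts `2 b`, and `b` is `c` times the normal. In the tropic case the
    -- coefficients of `b` are doubled in the same way.
    refine ⟨2 * c, 0, ⟨hon, hy, Or.inl ⟨rfl, ?_⟩⟩, ?_⟩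
    · rw [← mink_nodes_mul, ← normalVec_eq, mink_add_right, ha, mink_smul_right,
        mink_normalVec_self] at hy
      linarith
    · ext i
      simp [deflect, normalVec_eq, hζ]
      ring
  · rw [isTropic_iff hx] at ht
    have e0 : mink (ζ * x) a = 0 := by rw [mink_comm, hζ, ← normalVec_eq]; exact ha
    have e1 : mink (ζ * (ζ * x)) a = 0 := by
      rw [mink_comm, hζ, ← normalVecDeriv_eq]; exact ha'
    rw [normalVec_eq, normalVecDeriv_eq] at *
    have hth : t * mom a₁ a₂ a₃ 2 x x = 1 := by
      have := hy
      rw [← mink_nodes_mul, mink_add_right, mink_add_right, mink_smul_right, mink_smul_right, e0,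
        mink_nodes_mul, mink_nodes_mul, mom_mul_right, mom_mul_right, mom_mul_right,
        zero_add, ht] at this
      linarith
    have hB : mom a₁ a₂ a₃ 1 x (a + (s • (ζ * x) + t • (ζ * (ζ * x)))) =
        s * mom a₁ a₂ a₃ 2 x x + t * mom a₁ a₂ a₃ 3 x x := by
      have := mink_nodes_mul (a₁ := a₁) (a₂ := a₂) (a₃ := a₃) (ζ * x)
        (a + (s • (ζ * x) + t • (ζ * (ζ * x))))
      rw [mom_mul_left, zero_add, ← hζ] at this
      rw [← this, mink_add_right, mink_add_right, mink_smul_right, mink_smul_right, e1,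
        mink_nodes_mul, mink_nodes_mul, mom_mul_left, mom_mul_left, mom_mul_right,
        mom_mul_right, mom_mul_right]
      ring
    have hpos := mom_two_pos h₁ h₂ h₃ hx
    refine ⟨2 * s, 2 * t, ⟨hon, hy, Or.inr ⟨ht, ?_, by linear_combination 2 * hth, ?_⟩⟩, ?_⟩
    · have : 0 < t := by
        by_contra hle
        nlinarith [mul_nonneg (neg_nonneg.mpr (not_lt.mp hle)) hpos.le]
      linarith
    · refine Eq.trans (congrArg (fun z => 2 * (2 * s) + 2 * (2 * t) * z) hB) ?_
      change _ = 2 * (2 * s) * (2 * t) * mom a₁ a₂ a₃ 2 x x +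
        (2 * t) ^ 2 * mom a₁ a₂ a₃ 3 x x
      linear_combination (-4 * s) * hth
    · ext i
      simp [deflect, hζ]
      ring

theorem IsImpact.unique {b ζ x y : Fin 3 → ℝ} {σ τ σ' τ' : ℝ} (h : IsImpact b ζ x y σ τ)
    (h' : IsImpact b ζ x y σ' τ') : σ = σ' ∧ τ = τ' := by
  rcases h.law with ⟨h1, h2⟩ | ⟨h1, h2, h3, h4⟩ <;>
    rcases h'.law with ⟨h1', h2'⟩ | ⟨h1', h2', h3', h4'⟩
  · have hk : moment b ζ 1 x x ≠ 0 := fun h0 => by simp [h0] at h2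
    exact ⟨mul_right_cancel₀ hk (h2.trans h2'.symm), h1.trans h1'.symm⟩
  · simp [h1'] at h2
  · simp [h1] at h2'
  · have hk : moment b ζ 2 x x ≠ 0 := fun h0 => by simp [h0] at h3
    have hτ : τ = τ' := mul_right_cancel₀ hk (h3.trans h3'.symm)
    subst hτ
    refine ⟨?_, rfl⟩
    have e1 : 2 * σ * τ * moment b ζ 2 x x = 4 * σ := by linear_combination 2 * σ * h3
    have e2 : 2 * σ' * τ * moment b ζ 2 x x = 4 * σ' := by linear_combination 2 * σ' * h3
    linarith

theorem IsReflection.unique (h₁ : 0 < a₁) (h₂ : 0 < a₂) (h₃ : 0 < a₃) {x y y' y'' : E21}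
    (hx : x ∈ ellipsoid a₁ a₂ a₃) (hy : mom a₁ a₂ a₃ 0 x y = 1)
    (h' : IsReflection a₁ a₂ a₃ x y y') (h'' : IsReflection a₁ a₂ a₃ x y y'') : y' = y'' := by
  obtain ⟨σ, τ, hi, rfl⟩ := h'.exists_isImpact h₁ h₂ h₃ hx hy
  obtain ⟨σ', τ', hi', rfl⟩ := h''.exists_isImpact h₁ h₂ h₃ hx hy
  obtain ⟨rfl, rfl⟩ := hi.unique hi'
  rfl

theorem IsReflection.smul {x v v' : E21} (h : IsReflection a₁ a₂ a₃ x v v') (c : ℝ) :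
    IsReflection a₁ a₂ a₃ x (c • v) (c • v') := by
  have hm : ∀ u w : E21, mink (c • u) w = c * mink u w := fun u w => by
    rw [mink_comm, mink_smul_right, mink_comm]
  rcases h with ⟨ht, a, b, ha, hb, rfl, rfl⟩ | ⟨ht, a, b, ha, ha', ⟨s, t, rfl⟩, rfl, rfl⟩
  · refine Or.inl ⟨ht, c • a, c • b, ?_, fun u hu => ?_, smul_add _ _ _, smul_sub _ _ _⟩
    · rw [mem_tangentPlane_iff] at ha ⊢
      rw [mink_smul_right, ha, mul_zero]
    · rw [hm, hb u hu, mul_zero]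
  · refine Or.inr ⟨ht, c • a, c • (s • normalVec a₁ a₂ a₃ x + t • normalVecDeriv a₁ a₂ a₃ x),
      ?_, ?_, ⟨c * s, c * t, ?_⟩, smul_add _ _ _, smul_sub _ _ _⟩
    · rw [hm, ha, mul_zero]
    · rw [hm, ha', mul_zero]
    · rw [smul_add, smul_smul, smul_smul]

theorem IsReflection.symm {x v v' : E21} (h : IsReflection a₁ a₂ a₃ x v v') :
    IsReflection a₁ a₂ a₃ x v' v := by
  have hm : ∀ u w : E21, mink (-u) w = -mink u w := fun u w => by simp [mink]; ring
  rcases h with ⟨ht, a, b, ha, hb, rfl, rfl⟩ | ⟨ht, a, b, ha, ha', ⟨s, t, rfl⟩, rfl, rfl⟩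
  · exact Or.inl ⟨ht, a, -b, ha, fun u hu => by rw [hm, hb u hu, neg_zero], by abel, by abel⟩
  · exact Or.inr ⟨ht, a, _, ha, ha', ⟨-s, -t, rfl⟩, by module, by module⟩

/-- The second intersection of a line with the ellipsoid is unique. -/
theorem chord_unique {x y : E21} {s s' : ℝ} (hx : x ∈ ellipsoid a₁ a₂ a₃)
    (hy : mom a₁ a₂ a₃ 0 x y ≠ 0) (hs : s ≠ 0) (hs' : s' ≠ 0)
    (h : x + s • y ∈ ellipsoid a₁ a₂ a₃) (h' : x + s' • y ∈ ellipsoid a₁ a₂ a₃) : s = s' := by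
  rw [mem_ellipsoid_iff] at hx h h'
  have key : ∀ s : ℝ, mom a₁ a₂ a₃ 0 (x + s • y) (x + s • y) = mom a₁ a₂ a₃ 0 x x +
      s * (2 * mom a₁ a₂ a₃ 0 x y + s * mom a₁ a₂ a₃ 0 y y) := fun s => by
    simp only [mom, moment, Pi.add_apply, Pi.smul_apply, smul_eq_mul]; ring
  rw [key, hx, add_eq_left] at h h'
  have e := (mul_eq_zero.mp h).resolve_left hs
  have e' := (mul_eq_zero.mp h').resolve_left hs'
  have hA : mom a₁ a₂ a₃ 0 y y ≠ 0 := fun h0 => hy (by rw [h0] at e; linarith)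
  exact mul_right_cancel₀ hA (by linarith)

end Geometry

/-! ### From billiard trajectories to normalised states. -/

section Trajectory

variable {a₁ a₂ a₃ : ℝ} {M : ℤ → E21}

/-- The length, in the normalisation of `inDir`, of the segment ending at the impact `k`. -/
def inLen (a₁ a₂ a₃ : ℝ) (M : ℤ → E21) (k : ℤ) : ℝ :=
  mom a₁ a₂ a₃ 0 (M k) (M k - M (k - 1))

/-- The normalised direction of the segment ending at the impact `k`. -/
def inDir (a₁ a₂ a₃ : ℝ) (M : ℤ → E21) (k : ℤ) : E21 :=
  (inLen a₁ a₂ a₃ M k)⁻¹ • (M k - M (k - 1))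

theorem mom_smul_right (j : ℕ) (c : ℝ) (x y : E21) :
    mom a₁ a₂ a₃ j x (c • y) = c * mom a₁ a₂ a₃ j x y := by
  simp only [mom, moment, Pi.smul_apply, smul_eq_mul]; ring

theorem mom_sub_right (j : ℕ) (x y y' : E21) :
    mom a₁ a₂ a₃ j x (y - y') = mom a₁ a₂ a₃ j x y - mom a₁ a₂ a₃ j x y' := by
  simp only [mom, moment, Pi.sub_apply]; ring

theorem chord_pos (h₁ : 0 < a₁) (h₂ : 0 < a₂) (h₃ : 0 < a₃) {x x' : E21}
    (hx : x ∈ ellipsoid a₁ a₂ a₃) (hx' : x' ∈ ellipsoid a₁ a₂ a₃) (hne : x ≠ x') :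
    0 < mom a₁ a₂ a₃ 0 x' (x' - x) := by
  have h := mom_self_pos h₁ h₂ h₃ (sub_ne_zero.mpr hne)
  rw [mem_ellipsoid_iff] at hx hx'
  have e1 : mom a₁ a₂ a₃ 0 (x - x') (x - x') = mom a₁ a₂ a₃ 0 x x + mom a₁ a₂ a₃ 0 x' x' -
      2 * mom a₁ a₂ a₃ 0 x' x := by
    simp only [mom, moment, Pi.sub_apply]; ring
  rw [mom_sub_right]
  rw [e1] at h
  linarith

theorem inLen_pos (h₁ : 0 < a₁) (h₂ : 0 < a₂) (h₃ : 0 < a₃)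
    (hM : IsBilliardTrajectory a₁ a₂ a₃ M) (k : ℤ) : 0 < inLen a₁ a₂ a₃ M k := by
  have h := (hM (k - 1)).2.1
  rw [sub_add_cancel] at h
  exact chord_pos h₁ h₂ h₃ (hM _).1 (hM k).1 h

theorem mom_inDir (h₁ : 0 < a₁) (h₂ : 0 < a₂) (h₃ : 0 < a₃)
    (hM : IsBilliardTrajectory a₁ a₂ a₃ M) (k : ℤ) :
    mom a₁ a₂ a₃ 0 (M k) (inDir a₁ a₂ a₃ M k) = 1 := by
  rw [inDir, mom_smul_right]
  exact inv_mul_cancel₀ (inLen_pos h₁ h₂ h₃ hM k).ne'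

theorem flight_eq (h₁ : 0 < a₁) (h₂ : 0 < a₂) (h₃ : 0 < a₃)
    (hM : IsBilliardTrajectory a₁ a₂ a₃ M) (k : ℤ) :
    M (k + 1) = M k + inLen a₁ a₂ a₃ M (k + 1) • inDir a₁ a₂ a₃ M (k + 1) := by
  rw [inDir, smul_inv_smul₀ (inLen_pos h₁ h₂ h₃ hM (k + 1)).ne', add_sub_cancel_right]
  abel

/-- A reflection sends product 1 with the impact to product -1, and the products of a chord with its
two endpoints are opposite. So the normalisation is preserved exactly, and the free positive factor
in the definition of a trajectory disappears. -/
theorem isReflection_inDir (h₁ : 0 < a₁) (h₂ : 0 < a₂) (h₃ : 0 < a₃)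
    (hM : IsBilliardTrajectory a₁ a₂ a₃ M) (k : ℤ) :
    IsReflection a₁ a₂ a₃ (M k) (inDir a₁ a₂ a₃ M k) (inDir a₁ a₂ a₃ M (k + 1)) := by
  obtain ⟨-, -, v', hv, t, ht, hstep⟩ := hM (k - 1)
  rw [sub_add_cancel] at hv hstep
  rw [show k - 1 + 2 = k + 1 by ring] at hstep
  have hr := hv.smul (inLen a₁ a₂ a₃ M k)⁻¹
  have hpos := inLen_pos h₁ h₂ h₃ hM k
  obtain ⟨σ, τ, hi, he⟩ := hr.exists_isImpact h₁ h₂ h₃ (hM k).1 (mom_inDir h₁ h₂ h₃ hM k)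
  have h1 := moment_deflect hi
  rw [← he] at h1
  change mom a₁ a₂ a₃ 0 (M k) _ = -1 at h1
  rw [mom_smul_right] at h1
  have h2 : inLen a₁ a₂ a₃ M (k + 1) = t * inLen a₁ a₂ a₃ M k := by
    have e1 : mom a₁ a₂ a₃ 0 (M (k + 1)) (M (k + 1)) = 1 := (mem_ellipsoid_iff _).mp (hM _).1
    have e2 : mom a₁ a₂ a₃ 0 (M k) (M k) = 1 := (mem_ellipsoid_iff _).mp (hM _).1
    have e3 : mom a₁ a₂ a₃ 0 (M k) (M (k + 1) - M k) = t * mom a₁ a₂ a₃ 0 (M k) v' := by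
      rw [hstep, mom_smul_right]
    rw [mom_sub_right, e2] at e3
    rw [inLen, add_sub_cancel_right, mom_sub_right, e1, mom_comm]
    field_simp at h1
    change 1 - mom a₁ a₂ a₃ 0 (M k) (M (k + 1)) = _
    linear_combination -e3 - t * h1
  rw [inDir, inDir, h2, add_sub_cancel_right, hstep, smul_smul]
  convert hr using 2
  field_simp

theorem exists_impact (h₁ : 0 < a₁) (h₂ : 0 < a₂) (h₃ : 0 < a₃)
    (hM : IsBilliardTrajectory a₁ a₂ a₃ M) (k : ℤ) :
    ∃ σ τ, IsImpact (weights a₁ a₂ a₃) (nodes a₁ a₂ a₃) (M k) (inDir a₁ a₂ a₃ M k) σ τ ∧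
    inDir a₁ a₂ a₃ M (k + 1) = deflect (nodes a₁ a₂ a₃) σ τ (M k) (inDir a₁ a₂ a₃ M k) :=
  (isReflection_inDir h₁ h₂ h₃ hM k).exists_isImpact h₁ h₂ h₃ (hM k).1 (mom_inDir h₁ h₂ h₃ hM k)

theorem mom_inDir_succ (h₁ : 0 < a₁) (h₂ : 0 < a₂) (h₃ : 0 < a₃)
    (hM : IsBilliardTrajectory a₁ a₂ a₃ M) (k : ℤ) :
    mom a₁ a₂ a₃ 0 (M k) (inDir a₁ a₂ a₃ M (k + 1)) = -1 := by
  obtain ⟨σ, τ, hi, he⟩ := exists_impact h₁ h₂ h₃ hM k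
  rw [he]
  exact moment_deflect hi

theorem state_succ (h₁ : 0 < a₁) (h₂ : 0 < a₂) (h₃ : 0 < a₃)
    (hM : IsBilliardTrajectory a₁ a₂ a₃ M) (k : ℤ) {l : ℤ}
    (hx : M k = M l) (hy : inDir a₁ a₂ a₃ M k = inDir a₁ a₂ a₃ M l) :
    M (k + 1) = M (l + 1) ∧ inDir a₁ a₂ a₃ M (k + 1) = inDir a₁ a₂ a₃ M (l + 1) := by
  have hk := isReflection_inDir h₁ h₂ h₃ hM k
  have hl := isReflection_inDir h₁ h₂ h₃ hM l
  rw [← hx, ← hy] at hl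
  have hd := hk.unique h₁ h₂ h₃ (hM k).1 (mom_inDir h₁ h₂ h₃ hM k) hl
  refine ⟨?_, hd⟩
  have fk := flight_eq h₁ h₂ h₃ hM k
  have fl := flight_eq h₁ h₂ h₃ hM l
  rw [← hx, ← hd] at fl
  have := chord_unique (hM k).1 (by rw [mom_inDir_succ h₁ h₂ h₃ hM k]; norm_num)
    (inLen_pos h₁ h₂ h₃ hM (k + 1)).ne' (inLen_pos h₁ h₂ h₃ hM (l + 1)).ne'
    (fk ▸ (hM (k + 1)).1) (fl ▸ (hM (l + 1)).1)
  rw [fk, fl, this]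

theorem state_pred (h₁ : 0 < a₁) (h₂ : 0 < a₂) (h₃ : 0 < a₃)
    (hM : IsBilliardTrajectory a₁ a₂ a₃ M) (k : ℤ) {l : ℤ} (hx : M (k + 1) = M (l + 1))
    (hy : inDir a₁ a₂ a₃ M (k + 1) = inDir a₁ a₂ a₃ M (l + 1)) :
    M k = M l ∧ inDir a₁ a₂ a₃ M k = inDir a₁ a₂ a₃ M l := by
  have fk : M k = M (k + 1) + (-inLen a₁ a₂ a₃ M (k + 1)) • inDir a₁ a₂ a₃ M (k + 1) := by
    rw [neg_smul, ← sub_eq_add_neg, eq_sub_iff_add_eq]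
    exact (flight_eq h₁ h₂ h₃ hM k).symm
  have fl : M l = M (l + 1) + (-inLen a₁ a₂ a₃ M (l + 1)) • inDir a₁ a₂ a₃ M (l + 1) := by
    rw [neg_smul, ← sub_eq_add_neg, eq_sub_iff_add_eq]
    exact (flight_eq h₁ h₂ h₃ hM l).symm
  rw [← hx, ← hy] at fl
  have := chord_unique (hM (k + 1)).1 (by rw [mom_inDir h₁ h₂ h₃ hM (k + 1)]; norm_num)
    (neg_ne_zero.mpr (inLen_pos h₁ h₂ h₃ hM (k + 1)).ne')
    (neg_ne_zero.mpr (inLen_pos h₁ h₂ h₃ hM (l + 1)).ne')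
    (fk ▸ (hM k).1) (fl ▸ (hM l).1)
  have hxx : M k = M l := by rw [fk, fl, this]
  refine ⟨hxx, ?_⟩
  -- Time reversal; the sign turns the outgoing product -1 into the incoming normalisation 1.
  have hk := (isReflection_inDir h₁ h₂ h₃ hM k).symm.smul (-1)
  have hl := (isReflection_inDir h₁ h₂ h₃ hM l).symm.smul (-1)
  rw [← hxx, ← hy] at hl
  have hd := hk.unique h₁ h₂ h₃ (hM k).1
    (by rw [mom_smul_right, mom_inDir_succ h₁ h₂ h₃ hM k]; norm_num) hl
  simpa using hd

theorem periodic_of_state_eq (h₁ : 0 < a₁) (h₂ : 0 < a₂) (h₃ : 0 < a₃)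
    (hM : IsBilliardTrajectory a₁ a₂ a₃ M) {N : ℤ} (hx : M N = M 0)
    (hy : inDir a₁ a₂ a₃ M N = inDir a₁ a₂ a₃ M 0) (k : ℤ) : M (k + N) = M k := by
  suffices h : M (k + N) = M k ∧ inDir a₁ a₂ a₃ M (k + N) = inDir a₁ a₂ a₃ M k from h.1
  induction k using Int.induction_on with
  | zero => rw [zero_add]; exact ⟨hx, hy⟩
  | succ i ih =>
    have := state_succ h₁ h₂ h₃ hM _ ih.1 ih.2
    rwa [add_right_comm] at this
  | pred i ih =>
    refine state_pred h₁ h₂ h₃ hM _ ?_ ?_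
    · rw [show -(i : ℤ) - 1 + N + 1 = -i + N by ring, sub_add_cancel]; exact ih.1
    · rw [show -(i : ℤ) - 1 + N + 1 = -i + N by ring, sub_add_cancel]; exact ih.2

end Trajectory

/-! ### Caustics as roots of the determinant of the Lax matrix. -/

section Caustics

variable {b ζ x y : Fin 3 → ℝ}

/-- The quadratic polynomial whose roots are the parameters of the caustics of the line through
`x` with direction `y`. -/
def causticPoly (b ζ x y : Fin 3 → ℝ) : ℝ[X] :=
  C (b 0 * y 0 ^ 2) * ((X - C (ζ 1)) * (X - C (ζ 2))) +
  C (b 1 * y 1 ^ 2) * ((X - C (ζ 0)) * (X - C (ζ 2))) +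
  C (b 2 * y 2 ^ 2) * ((X - C (ζ 0)) * (X - C (ζ 1))) -
  X * (C (b 0 * b 1 * (x 0 * y 1 - x 1 * y 0) ^ 2) * (X - C (ζ 2)) +
    C (b 0 * b 2 * (x 0 * y 2 - x 2 * y 0) ^ 2) * (X - C (ζ 1)) +
    C (b 1 * b 2 * (x 1 * y 2 - x 2 * y 1) ^ 2) * (X - C (ζ 0)))

theorem neg_det_lax : -(lax b ζ x y).det = X * causticPoly b ζ x y * nodal ζ := by
  simp only [lax, Matrix.det_fin_two_of, causticPoly, pencil, nodal, map_mul, map_pow, map_sub]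
  ring

/-- The two normalisations make the leading coefficient 1, so the two caustic parameters determine
the whole polynomial. -/
theorem causticPoly_eq (hx : moment b ζ 0 x x = 1) (hy : moment b ζ 0 x y = 1) :
    ∃ p q : ℝ, causticPoly b ζ x y = X ^ 2 + C p * X + C q := by
  obtain ⟨p, q, h⟩ : ∃ p q : ℝ, causticPoly b ζ x y =
      C (moment b ζ 0 y y - (moment b ζ 0 x x * moment b ζ 0 y y - moment b ζ 0 x y ^ 2)) * X ^ 2 +
        C p * X + C q := by
    refine ⟨-(b 0 * y 0 ^ 2 * (ζ 1 + ζ 2) + b 1 * y 1 ^ 2 * (ζ 0 + ζ 2) +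
        b 2 * y 2 ^ 2 * (ζ 0 + ζ 1)) + (b 0 * b 1 * (x 0 * y 1 - x 1 * y 0) ^ 2 * ζ 2 +
        b 0 * b 2 * (x 0 * y 2 - x 2 * y 0) ^ 2 * ζ 1 +
        b 1 * b 2 * (x 1 * y 2 - x 2 * y 1) ^ 2 * ζ 0),
      b 0 * y 0 ^ 2 * (ζ 1 * ζ 2) + b 1 * y 1 ^ 2 * (ζ 0 * ζ 2) + b 2 * y 2 ^ 2 * (ζ 0 * ζ 1), ?_⟩
    simp only [causticPoly, moment, map_mul, map_add, map_sub, map_neg, map_pow, pow_zero, mul_one]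
    ring
  refine ⟨p, q, ?_⟩
  rw [h, hx, hy]
  simp

theorem causticPoly_eq_of_isRoot (hx : moment b ζ 0 x x = 1) (hy : moment b ζ 0 x y = 1) {r s : ℝ}
    (hr : (causticPoly b ζ x y).eval r = 0) (hs : (causticPoly b ζ x y).eval s = 0)
    (hrs : r ≠ s) : causticPoly b ζ x y = (X - C r) * (X - C s) := by
  obtain ⟨p, q, h⟩ := causticPoly_eq hx hy
  rw [h] at hr hs ⊢
  simp at hr hs
  have hp : p = -(r + s) := mul_left_cancel₀ (sub_ne_zero.mpr hrs) (by linear_combination hr - hs)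
  subst hp
  have hq : q = r * s := by linear_combination hr
  subst hq
  simp only [map_neg, map_add, map_mul]
  ring

theorem causticPoly_eq_of_lax_eval_eq_zero (hx : moment b ζ 0 x x = 1)
    (hy : moment b ζ 0 x y = 1) {r : ℝ} (h0 : r ≠ 0) (hn : (nodal ζ).eval r ≠ 0)
    (h : (lax b ζ x y).map (eval r) = 0) :
    causticPoly b ζ x y = (X - C r) * (X - C r) := by
  have hd := eval_derivative_eq_zero h
  have hv : ((lax b ζ x y).map (eval r)).det = 0 := by rw [h]; simp
  have hv' : eval r (-(lax b ζ x y).det) = 0 := by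
    rw [Matrix.det_fin_two] at hv ⊢
    simp at hv ⊢
    linarith
  obtain ⟨p, q, hc⟩ := causticPoly_eq hx hy
  rw [neg_det_lax, hc] at hd hv'
  simp [h0, hn] at hv' hd
  rw [hv'] at hd
  have hp : 2 * r + p = 0 := by
    have : r * (nodal ζ).eval r * (2 * r + p) = 0 := by linear_combination hd
    exact (mul_eq_zero.mp this).resolve_left (mul_ne_zero h0 hn)
  have hp' : p = -(2 * r) := by linarith
  subst hp'
  have hq : q = r * r := by linear_combination hv'
  subst hq
  rw [hc]
  simp only [map_neg, map_mul, map_ofNat]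
  ring

end Caustics

/-! ### Passage to the inverse parameter, and touching conditions. -/

section Parameters

variable {a₁ a₂ a₃ : ℝ}

/-- The inverse spectral parameter. -/
def inverseParameter : OnePoint ℝ → ℝ
  | OnePoint.infty => 0
  | OnePoint.some l => l⁻¹

/-- Zero is left out because the convention `0⁻¹ = 0` would identify it with infinity. -/
theorem inverseParameter_injOn : Set.InjOn inverseParameter {((0 : ℝ) : OnePoint ℝ)}ᶜ := by
  intro g hg g' hg' h
  induction g using OnePoint.rec <;> induction g' using OnePoint.rec
  · rfl
  · rename_i l
    have : l = 0 := by simpa [inverseParameter] using h.symm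
    simp [this] at hg'
  · rename_i l
    have : l = 0 := by simpa [inverseParameter] using h
    simp [this] at hg
  · rw [inv_injective h]

theorem nodes_ne_inverseParameter (h₁ : 0 < a₁) (h₂ : 0 < a₂) (h₃ : 0 < a₃) {g : OnePoint ℝ}
    (hg : IsNondegenerate a₁ a₂ a₃ g) (i : Fin 3) : nodes a₁ a₂ a₃ i ≠ inverseParameter g := by
  obtain ⟨hg₁, hg₂, hg₃⟩ := hg
  induction g using OnePoint.rec with
  | infty => fin_cases i <;> simp [nodes, inverseParameter, h₁.ne', h₂.ne', h₃.ne']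
  | coe l =>
    intro h
    fin_cases i
    · exact hg₁ (congrArg _ (inv_injective h).symm)
    · exact hg₂ (congrArg _ (inv_injective h).symm)
    · refine hg₃ (congrArg _ (inv_injective (Eq.trans h.symm ?_)))
      simp [nodes, inv_neg]

theorem pencil_eval_inv (h₁ : 0 < a₁) (h₂ : 0 < a₂) (h₃ : 0 < a₃) {l : ℝ} (h0 : l ≠ 0)
    (hl : IsNondegenerate a₁ a₂ a₃ l) (x y : E21) :
    (pencil (weights a₁ a₂ a₃) (nodes a₁ a₂ a₃) x y).eval l⁻¹ =
      confForm a₁ a₂ a₃ l x y * (nodal (nodes a₁ a₂ a₃)).eval l⁻¹ := by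
  obtain ⟨hg₁, hg₂, hg₃⟩ := hl
  have e₁ : a₁ - l ≠ 0 := fun h => hg₁ (congrArg _ (sub_eq_zero.mp h).symm)
  have e₂ : a₂ - l ≠ 0 := fun h => hg₂ (congrArg _ (sub_eq_zero.mp h).symm)
  have e₃ : a₃ + l ≠ 0 := fun h => hg₃ (congrArg _ (by linarith))
  simp [pencil, nodal, confForm, weights, nodes]
  field_simp

theorem nodal_eval_ne_zero (h₁ : 0 < a₁) (h₂ : 0 < a₂) (h₃ : 0 < a₃) {g : OnePoint ℝ}
    (hg : IsNondegenerate a₁ a₂ a₃ g) : (nodal (nodes a₁ a₂ a₃)).eval (inverseParameter g) ≠ 0 := by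
  have h := nodes_ne_inverseParameter h₁ h₂ h₃ hg
  simp only [nodal, eval_mul, eval_sub, eval_X, eval_C]
  exact mul_ne_zero (mul_ne_zero (sub_ne_zero.mpr (h 0).symm) (sub_ne_zero.mpr (h 1).symm))
    (sub_ne_zero.mpr (h 2).symm)

theorem Touches.reparam {g : OnePoint ℝ} {x v : E21} (h : Touches a₁ a₂ a₃ g x v) (s c : ℝ) :
    Touches a₁ a₂ a₃ g (x + s • v) (c • v) := by
  induction g using OnePoint.rec with
  | infty =>
    change mink (c • v) (c • v) = 0
    change mink v v = 0 at h
    rw [mink_smul_right, mink_comm, mink_smul_right, h, mul_zero, mul_zero]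
  | coe l =>
    change confForm a₁ a₂ a₃ l x v ^ 2 =
        confForm a₁ a₂ a₃ l v v * (confForm a₁ a₂ a₃ l x x - 1) at h
    change confForm a₁ a₂ a₃ l _ _ ^ 2 =
        confForm a₁ a₂ a₃ l _ _ * (confForm a₁ a₂ a₃ l _ _ - 1)
    simp only [confForm, Pi.add_apply, Pi.smul_apply, smul_eq_mul] at h ⊢
    linear_combination c ^ 2 * h

theorem LiesOn.reparam {l : ℝ} {x v : E21} (h : LiesOn a₁ a₂ a₃ l x v) (s c : ℝ) :
    confForm a₁ a₂ a₃ l (x + s • v) (x + s • v) = 1 ∧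
    confForm a₁ a₂ a₃ l (x + s • v) (c • v) = 0 ∧ confForm a₁ a₂ a₃ l (c • v) (c • v) = 0 := by
  have key : ∀ t : ℝ, confForm a₁ a₂ a₃ l x x + 2 * t * confForm a₁ a₂ a₃ l x v +
      t ^ 2 * confForm a₁ a₂ a₃ l v v = 1 := fun t => by
    have := h t
    change confForm a₁ a₂ a₃ l _ _ = 1 at this
    simp only [confForm, Pi.add_apply, Pi.smul_apply, smul_eq_mul] at this ⊢
    linear_combination this
  have k0 := key 0
  have k1 := key 1
  have k2 := key (-1)
  have hA : confForm a₁ a₂ a₃ l v v = 0 := by linarith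
  have hB : confForm a₁ a₂ a₃ l x v = 0 := by linarith
  have hC : confForm a₁ a₂ a₃ l x x = 1 := by linarith
  simp only [confForm, Pi.add_apply, Pi.smul_apply, smul_eq_mul] at hA hB hC ⊢
  exact ⟨by linear_combination hC + 2 * s * hB + s ^ 2 * hA, by
    linear_combination c * hB + s * c * hA, by linear_combination c ^ 2 * hA⟩

/-- Parameter zero is the ellipsoid itself, which the line of a proper chord crosses transversally.
-/
theorem Touches.ne_zero {g : OnePoint ℝ} {x y : E21} (hx : mom a₁ a₂ a₃ 0 x x = 1)
    (hy : mom a₁ a₂ a₃ 0 x y = 1) (h : Touches a₁ a₂ a₃ g x y) : g ≠ ((0 : ℝ) : OnePoint ℝ) := by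
  rintro rfl
  change confForm a₁ a₂ a₃ 0 _ _ ^ 2 =
    confForm a₁ a₂ a₃ 0 _ _ * (confForm a₁ a₂ a₃ 0 _ _ - 1) at h
  rw [confForm_zero, confForm_zero, confForm_zero, hx, hy] at h
  norm_num at h

theorem Touches.causticPoly_eval (h₁ : 0 < a₁) (h₂ : 0 < a₂) (h₃ : 0 < a₃) {g : OnePoint ℝ}
    (hg : IsNondegenerate a₁ a₂ a₃ g) (h0 : g ≠ ((0 : ℝ) : OnePoint ℝ)) {x y : E21}
    (h : Touches a₁ a₂ a₃ g x y) :
    (causticPoly (weights a₁ a₂ a₃) (nodes a₁ a₂ a₃) x y).eval (inverseParameter g) = 0 := by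
  induction g using OnePoint.rec with
  | infty =>
    change mink y y = 0 at h
    rw [mink] at h
    simp [causticPoly, inverseParameter, weights, nodes]
    linear_combination (-a₁⁻¹ * a₂⁻¹ * a₃⁻¹) * h
  | coe l =>
    have hl : l ≠ 0 := fun hl => h0 (by rw [hl])
    have hn := nodal_eval_ne_zero h₁ h₂ h₃ hg
    have hd := congrArg (eval l⁻¹)
      (neg_det_lax (b := weights a₁ a₂ a₃) (ζ := nodes a₁ a₂ a₃) (x := x) (y := y))
    change confForm a₁ a₂ a₃ l _ _ ^ 2 =
      confForm a₁ a₂ a₃ l _ _ * (confForm a₁ a₂ a₃ l _ _ - 1) at h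
    change (nodal _).eval l⁻¹ ≠ 0 at hn
    change eval l⁻¹ _ = 0
    simp only [lax, Matrix.det_fin_two_of, eval_neg, eval_sub, eval_mul, eval_X,
      pencil_eval_inv h₁ h₂ h₃ hl hg] at hd
    have : (l⁻¹ * (nodal (nodes a₁ a₂ a₃)).eval l⁻¹) *
        eval l⁻¹ (causticPoly (weights a₁ a₂ a₃) (nodes a₁ a₂ a₃) x y) = 0 := by
      linear_combination -hd + (nodal (nodes a₁ a₂ a₃)).eval l⁻¹ ^ 2 * h
    exact (mul_eq_zero.mp this).resolve_left (mul_ne_zero (inv_ne_zero hl) hn)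

/-- The parameters of the caustics of a line meeting the ellipsoid. -/
theorem isAdmissible_and_isCausticLine (h₁ : 0 < a₁) (h₂ : 0 < a₂) (h₃ : 0 < a₃)
    (h₁₂ : a₁ ≠ a₂) {g₁ g₂ : OnePoint ℝ}
    (hg₁ : IsNondegenerate a₁ a₂ a₃ g₁) (hg₂ : IsNondegenerate a₁ a₂ a₃ g₂) {x v : E21} {s c : ℝ}
    (hx : mom a₁ a₂ a₃ 0 (x + s • v) (x + s • v) = 1)
    (hy : mom a₁ a₂ a₃ 0 (x + s • v) (c • v) = 1)
    (h : (g₁ ≠ g₂ ∧ Touches a₁ a₂ a₃ g₁ x v ∧ Touches a₁ a₂ a₃ g₂ x v) ∨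
      (g₁ = g₂ ∧ LiesOn a₁ a₂ a₃ g₁ x v)) :
    IsAdmissible (weights a₁ a₂ a₃) (nodes a₁ a₂ a₃) (inverseParameter g₁) (inverseParameter g₂) ∧
    IsCausticLine (weights a₁ a₂ a₃) (nodes a₁ a₂ a₃) (inverseParameter g₁) (inverseParameter g₂)
      (x + s • v) (c • v) := by
  have hpos : ∀ i, 0 < weights a₁ a₂ a₃ i := by
    intro i; fin_cases i <;> simp [weights, h₁, h₂, h₃]
  have hne : ∀ i, nodes a₁ a₂ a₃ i ≠ 0 := by
    intro i; fin_cases i <;> simp [nodes, h₁.ne', h₂.ne', h₃.ne']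
  have hinj : Function.Injective (nodes a₁ a₂ a₃) := by
    have := inv_pos.mpr h₁
    have := inv_pos.mpr h₂
    have := inv_pos.mpr h₃
    have e : a₁⁻¹ ≠ a₂⁻¹ := fun h => h₁₂ (inv_injective h)
    intro i j hij
    fin_cases i <;> fin_cases j <;> simp [nodes] at hij ⊢
    all_goals first
      | exact e (inv_injective.eq_iff.mpr hij)
      | exact e (inv_injective.eq_iff.mpr hij.symm)
      | linarith
  have hn₁ := nodes_ne_inverseParameter h₁ h₂ h₃ hg₁
  have hn₂ := nodes_ne_inverseParameter h₁ h₂ h₃ hg₂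
  rcases h with ⟨hne', ht₁, ht₂⟩ | ⟨rfl, hl⟩
  · have ht₁ := ht₁.reparam s c
    have ht₂ := ht₂.reparam s c
    have h0₁ := ht₁.ne_zero hx hy
    have h0₂ := ht₂.ne_zero hx hy
    have hp : inverseParameter g₁ ≠ inverseParameter g₂ := fun h =>
      hne' (inverseParameter_injOn h0₁ h0₂ h)
    refine ⟨⟨hpos, hne, hinj, hn₁, hn₂, fun h => absurd h hp⟩, ?_, fun h => absurd h hp⟩
    rw [neg_det_lax, causticPoly_eq_of_isRoot hx hy (ht₁.causticPoly_eval h₁ h₂ h₃ hg₁ h0₁)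
      (ht₂.causticPoly_eval h₁ h₂ h₃ hg₂ h0₂) hp]
  · induction g₁ using OnePoint.rec with
    | infty => exact hl.elim
    | coe l =>
      obtain ⟨hC, hB, hA⟩ := hl.reparam s c
      have h0 : l ≠ 0 := by
        rintro rfl
        rw [confForm_zero, hy] at hB
        exact one_ne_zero hB
      have hz : (lax (weights a₁ a₂ a₃) (nodes a₁ a₂ a₃) (x + s • v) (c • v)).map
          (eval l⁻¹) = 0 := by
        ext i j
        fin_cases i <;> fin_cases j <;> simp [lax, pencil_eval_inv h₁ h₂ h₃ h0 hg₁, hA, hB, hC]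
      refine ⟨⟨hpos, hne, hinj, hn₁, hn₂, fun _ => inv_ne_zero h0⟩, ?_, fun _ i j => ?_⟩
      · rw [neg_det_lax, causticPoly_eq_of_lax_eval_eq_zero hx hy (inv_ne_zero h0)
          (nodal_eval_ne_zero h₁ h₂ h₃ hg₁) hz]
        rfl
      · exact dvd_iff_isRoot.mpr (congrFun (congrFun hz i) j)

end Parameters

/-! ### Signs of the masses and the reflection counts. -/

section Counts

variable {b ζ : Fin 3 → ℝ}

theorem IsImpact.cases_sign {x y : Fin 3 → ℝ} {σ τ : ℝ}
    (h : IsImpact b ζ x y σ τ) : 0 ≤ τ ∧ (τ = 0 → σ ≠ 0) ∧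
      (0 ≤ moment b ζ 1 x x ↔ τ ≠ 0 ∨ 0 < σ) ∧ (moment b ζ 1 x x ≤ 0 ↔ τ ≠ 0 ∨ σ < 0) := by
  rcases h.law with ⟨h1, h2⟩ | ⟨h1, h2, -⟩
  · have hk : 0 < σ * moment b ζ 1 x x := by rw [h2]; norm_num
    subst h1
    rcases pos_and_pos_or_neg_and_neg_of_mul_pos hk with ⟨hs, hm⟩ | ⟨hs, hm⟩
    · exact ⟨le_rfl, fun _ => hs.ne', by simp [hs, hm.le], by simp [hm.not_ge, hs.not_gt]⟩
    · exact ⟨le_rfl, fun _ => hs.ne, by simp [hm.not_ge, hs.not_gt], by simp [hs, hm.le]⟩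
  · exact ⟨h2.le, fun h => absurd h h2.ne', by simp [h1, h2.ne'], by simp [h1, h2.ne']⟩

theorem ncard_lt_eq_card_filter (N : ℕ) (P : ℕ → Prop) [DecidablePred P] :
    Set.ncard {k : ℕ | k < N ∧ P k} = (Finset.univ.filter fun k : Fin N => P k).card := by
  rw [show {k : ℕ | k < N ∧ P k} = ((Finset.range N).filter P : Finset ℕ) by ext; simp,
    Set.ncard_coe_finset, Finset.card_filter, Finset.card_filter, Finset.sum_range]

end Counts

/-! ### Assembly of the orbit of a trajectory. -/

section Porism

variable {a₁ a₂ a₃ : ℝ} {M : ℤ → E21}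

theorem cap_or_tropic_iff {x : E21} (hx : x ∈ ellipsoid a₁ a₂ a₃) :
    InPolarCap a₁ a₂ a₃ x ∨ IsTropic a₁ a₂ a₃ x ↔ mom a₁ a₂ a₃ 1 x x ≤ 0 := by
  rw [inPolarCap_iff hx, isTropic_iff hx, le_iff_lt_or_eq]

theorem belt_or_tropic_iff {x : E21} (hx : x ∈ ellipsoid a₁ a₂ a₃) :
    InEquatorialBelt a₁ a₂ a₃ x ∨ IsTropic a₁ a₂ a₃ x ↔ 0 ≤ mom a₁ a₂ a₃ 1 x x := by
  rw [inEquatorialBelt_iff hx, isTropic_iff hx, le_iff_lt_or_eq, eq_comm (a := (0 : ℝ))]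

/-- The orbit of a billiard trajectory, together with the numbers of its reflections. -/
theorem exists_orbit (h₁ : 0 < a₁) (h₂ : 0 < a₂) (h₃ : 0 < a₃)
    (hM : IsBilliardTrajectory a₁ a₂ a₃ M) :
    ∃ O : Orbit (weights a₁ a₂ a₃) (nodes a₁ a₂ a₃), (∀ k : ℕ, O.x k = M k) ∧
      (∀ k : ℕ, O.y k = inDir a₁ a₂ a₃ M k) ∧ ∀ N : ℕ, 1 ≤ N →
        ((((O.prod N).trace + 2).roots.filter (· < 0)).card =
          Set.ncard {k : ℕ | k < N ∧ (InPolarCap a₁ a₂ a₃ (M k) ∨ IsTropic a₁ a₂ a₃ (M k))} ∧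
        (((O.prod N).trace + 2).roots.filter (0 < ·)).card =
          Set.ncard
            {k : ℕ | k < N ∧ (InEquatorialBelt a₁ a₂ a₃ (M k) ∨ IsTropic a₁ a₂ a₃ (M k))}) := by
  choose σ τ himp hdir using fun k : ℕ => exists_impact h₁ h₂ h₃ hM (k : ℤ)
  let O : Orbit (weights a₁ a₂ a₃) (nodes a₁ a₂ a₃) :=
    { x := fun k => M k
      y := fun k => inDir a₁ a₂ a₃ M k
      t := fun k => inLen a₁ a₂ a₃ M (k + 1)
      σ := σ
      τ := τ
      t_pos := fun k => inLen_pos h₁ h₂ h₃ hM _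
      impact := himp
      y_succ := fun k => by rw [← hdir k]; push_cast; rfl
      x_succ := fun k => by
        have := flight_eq h₁ h₂ h₃ hM (k : ℤ)
        push_cast
        exact this }
  refine ⟨O, fun _ => rfl, fun _ => rfl, fun N hN => ?_⟩
  have hs := fun k => (himp k).cases_sign
  have : NeZero N := ⟨by omega⟩
  obtain ⟨hp, hn⟩ := card_roots_trace_transfer (N := N) O.t_pos (fun k => (hs k).1)
    (fun k => (hs k).2.1)
  classical
  constructor
  · refine hn.trans ?_
    rw [ncard_lt_eq_card_filter]
    congr 1
    refine Finset.filter_congr fun k _ => ?_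
    rw [cap_or_tropic_iff (hM k).1]
    exact (hs k).2.2.2.symm
  · refine hp.trans ?_
    rw [ncard_lt_eq_card_filter]
    congr 1
    refine Finset.filter_congr fun k _ => ?_
    rw [belt_or_tropic_iff (hM k).1]
    exact (hs k).2.2.1.symm

theorem HasCaustics.initial_line (h₁ : 0 < a₁) (h₂ : 0 < a₂) (h₃ : 0 < a₃) (h₁₂ : a₁ ≠ a₂)
    {g₁ g₂ : OnePoint ℝ} (hg₁ : IsNondegenerate a₁ a₂ a₃ g₁) (hg₂ : IsNondegenerate a₁ a₂ a₃ g₂)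
    (hM : IsBilliardTrajectory a₁ a₂ a₃ M) (hc : HasCaustics a₁ a₂ a₃ g₁ g₂ M) :
    IsAdmissible (weights a₁ a₂ a₃) (nodes a₁ a₂ a₃) (inverseParameter g₁) (inverseParameter g₂) ∧
    IsCausticLine (weights a₁ a₂ a₃) (nodes a₁ a₂ a₃) (inverseParameter g₁) (inverseParameter g₂)
      (M 0) (inDir a₁ a₂ a₃ M 0) := by
  -- The state at time 0 carries the direction of the segment arriving at `M 0`, hence the segment
  -- with index -1.
  have hc := hc (-1)
  have hx := (mem_ellipsoid_iff _).mp (hM 0).1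
  have hy := mom_inDir h₁ h₂ h₃ hM 0
  rw [neg_add_cancel] at hc
  have e : M 0 = M (-1) + (1 : ℝ) • (M 0 - M (-1)) := by rw [one_smul]; abel
  have hd : inDir a₁ a₂ a₃ M 0 = (inLen a₁ a₂ a₃ M 0)⁻¹ • (M 0 - M (-1)) := rfl
  generalize hv : M 0 - M (-1) = v at *
  rw [hd] at hy ⊢
  rw [e] at hx hy ⊢
  exact isAdmissible_and_isCausticLine h₁ h₂ h₃ h₁₂ hg₁ hg₂ hx hy hc

end Porism

end MinkowskiBilliard
end

theorem theorem3p1 (a₁ a₂ a₃ : ℝ) (ha₂ : 0 < a₂) (ha₁ : a₂ < a₁) (ha₃ : 0 < a₃)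
    (g₁ g₂ : OnePoint ℝ)
    (hg₁ : MinkowskiBilliard.IsNondegenerate a₁ a₂ a₃ g₁)
    (hg₂ : MinkowskiBilliard.IsNondegenerate a₁ a₂ a₃ g₂)
    (M : ℤ → MinkowskiBilliard.E21)
    (hM : MinkowskiBilliard.IsBilliardTrajectory a₁ a₂ a₃ M)
    (hMg : MinkowskiBilliard.HasCaustics a₁ a₂ a₃ g₁ g₂ M)
    (n m₁ n₁ : ℕ) (hper : MinkowskiBilliard.IsPeriodic a₁ a₂ a₃ M n m₁ n₁)
    (M' : ℤ → MinkowskiBilliard.E21)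
    (hM' : MinkowskiBilliard.IsBilliardTrajectory a₁ a₂ a₃ M')
    (hMg' : MinkowskiBilliard.HasCaustics a₁ a₂ a₃ g₁ g₂ M') :
    MinkowskiBilliard.IsPeriodic a₁ a₂ a₃ M' n m₁ n₁ := by
  have h₁ := ha₂.trans ha₁
  obtain ⟨N, hN, hMN, hm, hn, hsum⟩ := hper
  obtain ⟨O, hOx, hOy, hO⟩ := MinkowskiBilliard.exists_orbit h₁ ha₂ ha₃ hM
  obtain ⟨O', hOx', hOy', hO'⟩ := MinkowskiBilliard.exists_orbit h₁ ha₂ ha₃ hM'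
  obtain ⟨hA, hL⟩ := hMg.initial_line h₁ ha₂ ha₃ ha₁.ne' hg₁ hg₂ hM
  obtain ⟨-, hL'⟩ := hMg'.initial_line h₁ ha₂ ha₃ ha₁.ne' hg₁ hg₂ hM'
  have hx : M N = M 0 := by simpa using hMN 0
  -- The incoming direction also involves the previous impact, so periodicity is used at -1 as well
  -- as at 0.
  have hy : MinkowskiBilliard.inDir a₁ a₂ a₃ M N = MinkowskiBilliard.inDir a₁ a₂ a₃ M 0 := by
    have h := hMN (0 - 1)
    rw [show (0 - 1 + N : ℤ) = N - 1 by ring] at h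
    rw [MinkowskiBilliard.inDir, MinkowskiBilliard.inDir, MinkowskiBilliard.inLen,
      MinkowskiBilliard.inLen, hx, h]
  obtain ⟨k, hk, hx', hy', htr⟩ := MinkowskiBilliard.Orbit.exists_period hA O O'
    (by rw [hOx, hOy]; exact hL) (by rw [hOx', hOy']; exact hL') hN
    (by rw [hOx, hOx]; exact hx) (by rw [hOy, hOy]; exact hy)
  rw [hOx', hOx'] at hx'
  rw [hOy', hOy'] at hy'
  refine ⟨k, hk, MinkowskiBilliard.periodic_of_state_eq h₁ ha₂ ha₃ hM' hx' hy', ?_, ?_, hsum⟩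
  · rw [← (hO' k hk).1, htr, (hO N hN).1, hm]
  · rw [← (hO' k hk).2, htr, (hO N hN).2, hn]
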